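/- Let $\mathbf k$ be a field of characteristic zero, $(\mathfrak a=\bigoplus_{i\ge 0}\mathfrak a^i,\partial_{\mathfrak a})$ a graded-commutative dg-$\mathbf k$-algebra, $(\mathfrak m=\bigoplus_{i\ge0}\mathfrak m^i,\partial)$ a dg-$\mathfrak a$-module with $\mathfrak m^i=0$ for all but finitely many $i$, and $t=\sum_{i\ge1}t_{2i+1}\in\mathfrak a$ an element all of whose components have odd degree $\ge 3$, with $\partial_{\mathfrak a}t=0$. Put $\partial_t=\partial+t\,\cdot$ and let $H^{ev}(\mathfrak m,\partial_t)$, $H^{od}(\mathfrak m,\partial_t)$ be the cohomology of the $\mathbb Z_2$-graded complex $(\mathfrak m^{ev}\oplus\mathfrak m^{od},\partial_t)$, where $\mathfrak m^{ev}$ and $\mathfrak m^{od}$ are the sums of the $\mathfrak m^i$ with $i$ even, respectively odd. (i) There is a cohomological spectral sequence $\{E_r^{p,q},d_r\}_{r\ge2}$, $p,q\in\mathbb Z$, namely the one of the $\mathbb Z_2$-graded complex $(\mathfrak m,\partial_t)$ filtered by $\mathbf F_p=\bigoplus_{j\ge p}\mathfrak m^j$ (in each parity), such that $E_2^{p,q}=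 H^p(\mathfrak m,\partial)$ for $q$ even (which is $0$ for $p<0$) and $E_2^{p,q}=0$ for $q$ odd. It converges to the twisted cohomology: let $G^{ev}_p$, $G^{od}_p$ $(p\ge 0)$ be the subspaces of $H^{ev}(\mathfrak m,\partial_t)$, $H^{od}(\mathfrak m,\partial_t)$ of classes of $\partial_t$-closed elements of $\mathbf F_p$. These are finite decreasing exhaustive filtrations, for all $r$ large enough $d_r=0$, and for such $r$ one has $E_\infty^{p,q}=E_r^{p,q}\cong G^{ev}_p/G^{ev}_{p+1}$ if $p+q$ is even and $E_\infty^{p,q}=E_r^{p,q}\cong G^{od}_p/G^{od}_{p+1}$ if $p+q$ is odd, for all $p\ge0$ and $q\in\mathbb Z$. All these isomorphisms are induced by the identity on representatives in $\mathfrak m$. (ii) For a finite-dimensional space $V$ let $\det V$ be the graded line $(\bigwedge^{\dim V}V,\dim V)$, and for a graded line let $(\ell,n)^{-1}=(\mathrm{Hom}(\ell,\mathbf k),-n)$. Suppose that $H^\bullet(\mathfrak m,\partial)$ is finite-dimensional. Then $H^{ev}(\mathfrak m,\partial_t)$ and $H^{od}(\mathfrak m,\partial_t)$ are finite-dimensional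 and there is a canonical isomorphism of graded lines $$\det H^\bullet(\mathfrak m,\partial):=\bigotimes_i(\det H^i(\mathfrak m,\partial))^{(-1)^i}\;\cong\;\det H^\bullet(\mathfrak m,\partial_t):=\det H^{ev}(\mathfrak m,\partial_t)\otimes(\det H^{od}(\mathfrak m,\partial_t))^{-1},$$ namely the composition $\det H^\bullet(\mathfrak m,\partial)\cong\det E_2\cong\det E_3\cong\cdots\cong\det E_\infty\cong\det H^\bullet(\mathfrak m,\partial_t)$. Here $E_r$ is regarded as the finite-dimensional $\mathbb Z_2$-graded complex with even part $\bigoplus_{p+q=0}E_r^{p,q}$ and odd part $\bigoplus_{p+q=1}E_r^{p,q}$ (using $E_r^{p,q}=E_r^{p,q+2}$), $\det E_r$ is the determinant of its even part tensored with the inverse of the determinant of its odd part, the first and last isomorphisms come from (i), and $\det E_r\cong\det H(E_r,d_r)\cong\det E_{r+1}$ is the canonical isomorphism between the determinant of a finite-dimensional $\mathbb Z_2$-graded complex and that of its cohomology, with the signs of the commutativity constraint $u\otimes w\mapsto(-1)^{n_1n_2}w\otimes u$ of graded lines. This isomorphism is functorial: let $\mathfrak n$ be another bounded dg-module over a commutative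 dg-$\mathbf k$-algebra, with a closed element $s$ of that algebra whose components have odd degree $\ge3$, and let $f:\mathfrak m\to\mathfrak n$ be a degree-preserving linear map which commutes with the differentials $\partial$ and with the twisted differentials $\partial_t,\partial_s$, and which is a quasi-isomorphism for $\partial$. Then $f$ induces isomorphisms on twisted cohomology, and the square formed by the canonical isomorphisms for $(\mathfrak m,t)$ and $(\mathfrak n,s)$ and by the isomorphisms of determinants induced by $f$ commutes. -/

import Mathlib

open scoped TensorProduct DirectSum

universe u v v' w

noncomputable section

/-! ### Graded lines and determinants -/

/-- A graded line over `k`: a one-dimensional vector space together with an integer degree. -/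
structure GradedLine (k : Type u) [Field k] where
  carrier : Type (max u w)
  [addCommGroup : AddCommGroup carrier]
  [module : Module k carrier]
  finrank_eq_one : Module.finrank k carrier = 1
  degree : ℤ

attribute [instance] GradedLine.addCommGroup GradedLine.module

namespace GradedLine

variable {k : Type u} [Field k]

/-- Isomorphisms of graded lines: linear isomorphisms between lines of the same degree. -/
@[ext]
structure Iso (L L' : GradedLine.{u, w} k) where
  equiv : L.carrier ≃ₗ[k] L'.carrier
  degree_eq : L.degree = L'.degree

namespace Iso

/-- The inverse isomorphism. -/
def symm {L L' : GradedLine.{u, w} k} (φ : Iso L L') : Iso L' L :=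
  ⟨φ.equiv.symm, φ.degree_eq.symm⟩

/-- Composition: first `φ`, then `ψ`. -/
def trans {L L' L'' : GradedLine.{u, w} k} (φ : Iso L L') (ψ : Iso L' L'') : Iso L L'' :=
  ⟨φ.equiv.trans ψ.equiv, φ.degree_eq.trans ψ.degree_eq⟩

end Iso

/-- The unit graded line `(k, 0)`. -/
def unit (k : Type u) [Field k] : GradedLine.{u, w} k where
  carrier := ULift.{w} k
  finrank_eq_one := by
    rw [LinearEquiv.finrank_eq (ULift.moduleEquiv : ULift.{w} k ≃ₗ[k] k)]
    exact Module.finrank_self k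
  degree := 0

/-- The tensor product `(ℓ₁ ⊗ ℓ₂, n₁ + n₂)`. -/
def tensor (L L' : GradedLine.{u, w} k) : GradedLine.{u, w} k where
  carrier := L.carrier ⊗[k] L'.carrier
  finrank_eq_one := by
    rw [Module.finrank_tensorProduct, L.finrank_eq_one, L'.finrank_eq_one]
  degree := L.degree + L'.degree

/-- The inverse `(Hom(ℓ, k), -n)`. -/
def inv (L : GradedLine.{u, w} k) : GradedLine.{u, w} k where
  carrier := Module.Dual k L.carrier
  finrank_eq_one := by rw [Subspace.dual_finrank_eq, L.finrank_eq_one]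
  degree := -L.degree

/-- For `x ≠ 0` in a line `L`, the element of `L⁻¹` which takes the value `1` at `x`. -/
def recip (L : GradedLine.{u, w} k) (x : L.carrier) : L.inv.carrier := by
  classical
  exact if h : ∃ ξ : Module.Dual k L.carrier, ξ x = 1 then h.choose else 0

/-- `L` if the sign is `false` (even), `L⁻¹` if it is `true` (odd). -/
def signPow (L : GradedLine.{u, w} k) : Bool → GradedLine.{u, w} k
  | false => L
  | true => L.inv

/-- The element `x` of `L`, respectively its reciprocal in `L⁻¹`. -/
def signElt (L : GradedLine.{u, w} k) (x : L.carrier) : ∀ s : Bool, (L.signPow s).carrier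
  | false => x
  | true => L.recip x

/-- The ordered tensor product `L 0 ⊗ L 1 ⊗ ⋯ ⊗ L (N - 1)`. -/
def prod (L : ℕ → GradedLine.{u, w} k) : ℕ → GradedLine.{u, w} k
  | 0 => unit k
  | n + 1 => (prod L n).tensor (L n)

/-- The decomposable element `x 0 ⊗ x 1 ⊗ ⋯ ⊗ x (N - 1)`. -/
def prodElt (L : ℕ → GradedLine.{u, w} k) (x : ∀ i, (L i).carrier) :
    ∀ N : ℕ, (prod L N).carrier
  | 0 => (ULift.up (1 : k) : ULift.{w} k)
  | n + 1 => (prodElt L x n) ⊗ₜ[k] (x n)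

namespace Iso

/-- Tensor product of isomorphisms. -/
def tensor {L₁ L₂ L₁' L₂' : GradedLine.{u, w} k} (φ : Iso L₁ L₁') (ψ : Iso L₂ L₂') :
    Iso (L₁.tensor L₂) (L₁'.tensor L₂') :=
  ⟨TensorProduct.congr φ.equiv ψ.equiv, congrArg₂ (· + ·) φ.degree_eq ψ.degree_eq⟩

/-- The isomorphism `L⁻¹ ≅ L'⁻¹` induced by an isomorphism `L ≅ L'`. -/
def inv {L L' : GradedLine.{u, w} k} (φ : Iso L L') : Iso L.inv L'.inv :=
  ⟨φ.equiv.symm.dualMap, congrArg (- ·) φ.degree_eq⟩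

/-- The induced isomorphism on `L` or on `L⁻¹`, according to the sign. -/
def signPow {L L' : GradedLine.{u, w} k} (φ : Iso L L') :
    ∀ s : Bool, Iso (L.signPow s) (L'.signPow s)
  | false => φ
  | true => φ.inv

/-- The isomorphism of ordered tensor products induced by isomorphisms of the factors. -/
def prod {L L' : ℕ → GradedLine.{u, w} k} (φ : ∀ i, Iso (L i) (L' i)) :
    ∀ N : ℕ, Iso (GradedLine.prod L N) (GradedLine.prod L' N)
  | 0 => ⟨LinearEquiv.refl k _, rfl⟩
  | n + 1 => (prod φ n).tensor (φ n)

end Iso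

/-- The determinant `(⋀ⁿ V, n)`, `n = dim V`, of a finite-dimensional vector space. -/
def det (k : Type u) [Field k] (V : Type w) [AddCommGroup V] [Module k V] :
    GradedLine.{u, w} k where
  carrier := ⋀[k]^(Module.finrank k V) V
  finrank_eq_one := by
    by_cases h : Module.Finite k V
    · rw [exteriorPower.finrank_eq, Nat.choose_self]
    · rw [Module.finrank_of_not_finite h,
        LinearEquiv.finrank_eq (exteriorPower.zeroEquiv k V), Module.finrank_self]
  degree := Module.finrank k V

/-- The isomorphism `⋀ⁿ V ≅ ⋀ⁿ W` induced by a linear isomorphism. -/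
def extPowerEquiv {V W : Type w} [AddCommGroup V] [Module k V] [AddCommGroup W] [Module k W]
    (n : ℕ) (e : V ≃ₗ[k] W) : (⋀[k]^n V) ≃ₗ[k] (⋀[k]^n W) :=
  LinearEquiv.ofLinearMap (exteriorPower.map n e.toLinearMap)
    (exteriorPower.map n e.symm.toLinearMap)
    (by rw [← exteriorPower.map_comp]; simp) (by rw [← exteriorPower.map_comp]; simp)

/-- The isomorphism of determinants induced by a linear isomorphism. -/
def Iso.det {V W : Type w} [AddCommGroup V] [Module k V] [AddCommGroup W] [Module k W]
    (e : V ≃ₗ[k] W) : Iso (det k V) (det k W) where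
  equiv := (extPowerEquiv (Module.finrank k V) e).trans
    (LinearEquiv.ofEq (⋀[k]^(Module.finrank k V) W) (⋀[k]^(Module.finrank k W) W)
      (by rw [e.finrank_eq]))
  degree_eq := congrArg (Nat.cast) e.finrank_eq

/-- `det V ⊗ (det W)⁻¹`, the determinant of the `ℤ/2`-graded space with even part `V` and odd
part `W`. -/
def detPair (k : Type u) [Field k] (V W : Type w) [AddCommGroup V] [Module k V]
    [AddCommGroup W] [Module k W] : GradedLine.{u, w} k :=
  (det k V).tensor (det k W).inv

/-- The isomorphism of determinants induced by an isomorphism of `ℤ/2`-graded spaces. -/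
def Iso.detPair {V W V' W' : Type w} [AddCommGroup V] [Module k V] [AddCommGroup W] [Module k W]
    [AddCommGroup V'] [Module k V'] [AddCommGroup W'] [Module k W']
    (e : V ≃ₗ[k] V') (e' : W ≃ₗ[k] W') :
    Iso (GradedLine.detPair k V W) (GradedLine.detPair k V' W') :=
  (Iso.det e).tensor (Iso.det e').inv

end GradedLine

/-- The list `l` is an (ordered) basis of `V`. -/
def IsBasisList (k : Type u) [Field k] {V : Type w} [AddCommGroup V] [Module k V]
    (l : List V) : Prop :=
  LinearIndependent k l.get ∧ Submodule.span k {x | x ∈ l} = ⊤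

section Volume

variable {k : Type u} [Field k] {V W : Type w} [AddCommGroup V] [Module k V]
  [AddCommGroup W] [Module k W]

theorem IsBasisList.finrank_eq {l : List V} (h : IsBasisList k l) :
    Module.finrank k V = l.length := by
  have hs : ⊤ ≤ Submodule.span k (Set.range l.get) := by
    rw [Set.range_list_get, h.2]
  simpa using Module.finrank_eq_card_basis (Module.Basis.mk h.1 hs)

/-- The element `x₁ ∧ ⋯ ∧ xₙ` of `det V` attached to an ordered basis `x₁, …, xₙ` of `V`. -/
def vol {l : List V} (h : IsBasisList k l) : (GradedLine.det k V).carrier :=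
  exteriorPower.ιMulti k (Module.finrank k V) (fun i => l.get (i.cast h.finrank_eq))

/-- The element `(x₁ ∧ ⋯ ∧ xₙ) ⊗ (y₁ ∧ ⋯ ∧ yₘ)⁻¹` of `det V ⊗ (det W)⁻¹`. -/
def volPair {l : List V} {l' : List W} (h : IsBasisList k l) (h' : IsBasisList k l') :
    (GradedLine.detPair k V W).carrier :=
  (vol h) ⊗ₜ[k] ((GradedLine.det k W).recip (vol h'))

end Volume

/-! ### `ℤ/2`-graded complexes -/

/-- A `ℤ/2`-graded complex over `k`. The even part is `X 0` and the odd part is `X 1`; the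
differential `X ε → X (ε + 1)` is given with a free name `ε'` for `ε + 1`. -/
structure Z2Complex (k : Type u) [Field k] where
  X : ZMod 2 → Type w
  [addCommGroup : ∀ ε, AddCommGroup (X ε)]
  [module : ∀ ε, Module k (X ε)]
  d : ∀ ε ε' : ZMod 2, ε' = ε + 1 → (X ε →ₗ[k] X ε')
  d_comp_d : ∀ (ε ε' ε'' : ZMod 2) (h : ε' = ε + 1) (h' : ε'' = ε' + 1),
    (d ε' ε'' h').comp (d ε ε' h) = 0

attribute [instance] Z2Complex.addCommGroup Z2Complex.module

theorem ZMod.two_eq_add_one_add_one (ε : ZMod 2) : ε = ε + 1 + 1 := by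
  revert ε; decide

namespace Z2Complex

variable {k : Type u} [Field k] (C : Z2Complex.{u, w} k)

/-- The closed elements of parity `ε`. -/
abbrev cycles (ε : ZMod 2) : Submodule k (C.X ε) := LinearMap.ker (C.d ε (ε + 1) rfl)

/-- The exact elements of parity `ε`. -/
abbrev boundaries (ε : ZMod 2) : Submodule k (C.X ε) :=
  LinearMap.range (C.d (ε + 1) ε (ZMod.two_eq_add_one_add_one ε))

/-- The cohomology of parity `ε`. -/
abbrev H (ε : ZMod 2) : Type w := C.cycles ε ⧸ (C.boundaries ε).submoduleOf (C.cycles ε)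

/-- The cohomology class of a closed element. -/
abbrev toH (ε : ZMod 2) : C.cycles ε →ₗ[k] C.H ε :=
  ((C.boundaries ε).submoduleOf (C.cycles ε)).mkQ

/-- `det C = det C^{ev} ⊗ (det C^{od})⁻¹`. -/
abbrev detLine : GradedLine.{u, w} k := GradedLine.detPair k (C.X 0) (C.X 1)

/-- `det H(C) = det H^{ev}(C) ⊗ (det H^{od}(C))⁻¹`. -/
abbrev detH : GradedLine.{u, w} k := GradedLine.detPair k (C.H 0) (C.H 1)

/-- The canonical isomorphism `det C ≅ det H(C)` of a finite-dimensional `ℤ/2`-graded complex.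
Let `x` and `y` be bases of complements of the closed elements in the even and in the odd part, and
let `h`, `h'` be closed elements whose classes are bases of the even and of the odd cohomology.
Then `(dy ∧ h ∧ x) ⊗ (dx ∧ h' ∧ y)⁻¹` is sent to `[h] ⊗ [h']⁻¹`, up to the sign that the
commutativity constraint of graded lines gives when the line of `x` is moved next to the inverse
of the line of `dx`, and the line of `dy` next to the inverse of the line of `y`. -/
def IsDetCohomologyIso (φ : GradedLine.Iso C.detLine C.detH) : Prop :=
  ∀ (x : List (C.X 0)) (y : List (C.X 1)) (h : List (C.cycles 0)) (h' : List (C.cycles 1))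
    (b₀ : IsBasisList k (y.map (C.d 1 0 rfl) ++ h.map (C.cycles 0).subtype ++ x))
    (b₁ : IsBasisList k (x.map (C.d 0 1 rfl) ++ h'.map (C.cycles 1).subtype ++ y))
    (c₀ : IsBasisList k (h.map (C.toH 0))) (c₁ : IsBasisList k (h'.map (C.toH 1))),
    φ.equiv (volPair b₀ b₁) =
      (-1 : k) ^ (x.length * (y.length + h'.length) + y.length * h.length) • volPair c₀ c₁

end Z2Complex

/-! ### The terms of the spectral sequence of a filtered `ℤ/2`-graded complex -/

namespace FilteredZ2

variable {k : Type u} [Field k] {M : Type w} [AddCommGroup M] [Module k M]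
  (D : M →ₗ[k] M) (F : ℤ → ZMod 2 → Submodule k M)

/-- `Z_r^p = {x ∈ F_p | D x ∈ F_{p+r}}`, in parity `ε`. -/
def Z (r p : ℤ) (ε : ZMod 2) : Submodule k M := F p ε ⊓ (F (p + r) (ε + 1)).comap D

/-- `B_r^p = Z_{r-1}^{p+1} + D Z_{r-1}^{p-r+1}`, in parity `ε`. -/
def B (r p : ℤ) (ε : ZMod 2) : Submodule k M :=
  Z D F (r - 1) (p + 1) ε ⊔ (Z D F (r - 1) (p - r + 1) (ε + 1)).map D

/-- `E_r^p = Z_r^p / B_r^p` in parity `ε`; this is the term `E_r^{p,q}` for `p + q ≡ ε`. -/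
abbrev E (r p : ℤ) (ε : ZMod 2) : Type w :=
  Z D F r p ε ⧸ (B D F r p ε).submoduleOf (Z D F r p ε)

/-- The class in `E_r^p` of an element of `Z_r^p`. -/
abbrev toE (r p : ℤ) (ε : ZMod 2) : Z D F r p ε →ₗ[k] E D F r p ε :=
  ((B D F r p ε).submoduleOf (Z D F r p ε)).mkQ

theorem D_mem_Z (hD : D.comp D = 0) {r p p' : ℤ} {ε ε' : ZMod 2} (hp : p' = p + r) (hε : ε' = ε + 1) {x : M}
    (hx : x ∈ Z D F r p ε) : D x ∈ Z D F r p' ε' := by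
  subst hp hε
  refine ⟨hx.2, ?_⟩
  have : D (D x) = 0 := LinearMap.congr_fun hD x
  simp [this]

theorem D_mem_B (hD : D.comp D = 0) {r p p' : ℤ} {ε ε' : ZMod 2} (hp : p' = p + r) (hε : ε' = ε + 1) {x : M}
    (hx : x ∈ B D F r p ε) : D x ∈ B D F r p' ε' := by
  subst hp hε
  obtain ⟨y, hy, _, ⟨z, hz, rfl⟩, rfl⟩ := Submodule.mem_sup.1 hx
  have h0 : D (D z) = 0 := LinearMap.congr_fun hD z
  rw [map_add, h0, add_zero]
  refine Submodule.mem_sup_right (Submodule.mem_map_of_mem ?_)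
  have h1 : p + r - r + 1 = p + 1 := by ring
  rw [h1, ← ZMod.two_eq_add_one_add_one]
  exact hy

variable (hD : D.comp D = 0)

/-- The differential `d_r : E_r^p → E_r^{p+r}` induced by `D`. -/
def dE (r p p' : ℤ) (ε ε' : ZMod 2) (hp : p' = p + r) (hε : ε' = ε + 1) :
    E D F r p ε →ₗ[k] E D F r p' ε' :=
  Submodule.mapQ _ _ (D.restrict (fun _ hx => D_mem_Z D F hD hp hε hx))
    (fun _ hx => D_mem_B D F hD hp hε hx)

/-- The page `E_r`, as a `ℤ/2`-graded complex: the part of parity `ε` is the direct sum of the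
`E_r^{p,q}` over a line `p + q = n` with `n ≡ ε`. -/
def page (r : ℤ) : Z2Complex.{u, w} k where
  X ε := ⨁ p : ℤ, E D F r p ε
  d ε ε' h := DirectSum.toModule k ℤ _ fun p =>
    (DirectSum.lof k ℤ (fun p => E D F r p ε') (p + r)).comp (dE D F hD r p (p + r) ε ε' rfl h)
  d_comp_d ε ε' ε'' h h' := by
    refine DirectSum.linearMap_ext k fun p => LinearMap.ext fun x => ?_
    obtain ⟨x, rfl⟩ := Submodule.mkQ_surjective _ x
    simp only [LinearMap.comp_apply, DirectSum.toModule_lof]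
    have : dE D F hD r (p + r) (p + r + r) ε' ε'' rfl h'
        (dE D F hD r p (p + r) ε ε' rfl h (toE D F r p ε x)) = 0 := by
      refine (Submodule.Quotient.mk_eq_zero _).2 ?_
      have h0 : D (D x) = 0 := LinearMap.congr_fun hD x
      change D (D x) ∈ B D F r _ ε''
      rw [h0]
      exact zero_mem _
    rw [this]
    simp

/-- The class in the page `E_r` of an element of `Z_r^p`. -/
abbrev toPage (r p : ℤ) (ε : ZMod 2) : Z D F r p ε →ₗ[k] (page D F hD r).X ε :=
  (DirectSum.lof k ℤ (fun p => E D F r p ε) p).comp (toE D F r p ε)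

/-- Isomorphisms `H(E_r) ≅ E_{r'}` which send the class of the class of `z` to the class of `z`,
for all `z` in `Z_{r'}` (here `r' = r + 1`). -/
def IsNextPageIso (r r' : ℤ)
    (e : ∀ ε, (page D F hD r).H ε ≃ₗ[k] (page D F hD r').X ε) : Prop :=
  ∀ (ε : ZMod 2) (p : ℤ) (z' : Z D F r' p ε) (z : Z D F r p ε) (c : (page D F hD r).cycles ε),
    (z' : M) = z → (c : (page D F hD r).X ε) = toPage D F hD r p ε z →
      e ε ((page D F hD r).toH ε c) = toPage D F hD r' p ε z'

/-- The isomorphism `det E_r ≅ det E_{r'}` obtained by composing the canonical isomorphism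
`det E_r ≅ det H(E_r, d_r)` with the one induced by `H(E_r, d_r) ≅ E_{r'}` (here `r' = r + 1`). -/
def IsDetNextPageIso (r r' : ℤ)
    (φ : GradedLine.Iso (page D F hD r).detLine (page D F hD r').detLine) : Prop :=
  ∃ ψ : GradedLine.Iso (page D F hD r).detLine (page D F hD r).detH,
    (page D F hD r).IsDetCohomologyIso ψ ∧
    ∃ e : ∀ ε, (page D F hD r).H ε ≃ₗ[k] (page D F hD r').X ε,
      IsNextPageIso D F hD r r' e ∧ φ = ψ.trans (GradedLine.Iso.detPair (e 0) (e 1))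

end FilteredZ2

/-! ### dg-algebras and dg-modules -/

/-- A (graded-)commutative differential graded `k`-algebra `𝔞 = ⨁_{i ≥ 0} 𝔞^i`. -/
structure CommDGAlgebra (k : Type u) [Field k] where
  carrier : Type v
  [ring : Ring carrier]
  [algebra : Algebra k carrier]
  deg : ℕ → Submodule k carrier
  [graded : GradedAlgebra deg]
  d : carrier →ₗ[k] carrier
  d_mem : ∀ {i : ℕ} {a : carrier}, a ∈ deg i → d a ∈ deg (i + 1)
  d_d : ∀ a, d (d a) = 0
  leibniz : ∀ {i : ℕ} {a : carrier} (b : carrier), a ∈ deg i →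
    d (a * b) = d a * b + (-1 : k) ^ i • (a * d b)
  comm : ∀ {i j : ℕ} {a b : carrier}, a ∈ deg i → b ∈ deg j →
    a * b = (-1 : k) ^ (i * j) • (b * a)

attribute [instance] CommDGAlgebra.ring CommDGAlgebra.algebra CommDGAlgebra.graded

/-- A dg-module `𝔪 = ⨁_{i ≥ 0} 𝔪^i` over a commutative dg-algebra. -/
structure DGModule {k : Type u} [Field k] (A : CommDGAlgebra.{u, v} k) where
  carrier : Type w
  [addCommGroup : AddCommGroup carrier]
  [module : Module k carrier]
  [moduleA : Module A.carrier carrier]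
  [tower : IsScalarTower k A.carrier carrier]
  deg : ℕ → Submodule k carrier
  isInternal : DirectSum.IsInternal deg
  smul_mem : ∀ {i j : ℕ} {a : A.carrier} {x : carrier}, a ∈ A.deg i → x ∈ deg j →
    a • x ∈ deg (i + j)
  d : carrier →ₗ[k] carrier
  d_mem : ∀ {i : ℕ} {x : carrier}, x ∈ deg i → d x ∈ deg (i + 1)
  d_d : ∀ x, d (d x) = 0
  leibniz : ∀ {i : ℕ} {a : A.carrier} (x : carrier), a ∈ A.deg i →
    d (a • x) = A.d a • x + (-1 : k) ^ i • (a • d x)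

attribute [instance] DGModule.addCommGroup DGModule.module DGModule.moduleA DGModule.tower

/-- A twisting element: closed, with all components of odd degree at least three. -/
structure CommDGAlgebra.Twist {k : Type u} [Field k] (A : CommDGAlgebra.{u, v} k) where
  val : A.carrier
  mem : val ∈ ⨆ (i : ℕ) (_ : Odd i ∧ 3 ≤ i), A.deg i
  closed : A.d val = 0

theorem CommDGAlgebra.mul_self_of_odd {k : Type u} [Field k] [CharZero k]
    (A : CommDGAlgebra.{u, v} k) {a : A.carrier}
    (ha : a ∈ ⨆ (i : ℕ) (_ : Odd i ∧ 3 ≤ i), A.deg i) : a * a = 0 := by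
  have key : ∀ b ∈ ⨆ (i : ℕ) (_ : Odd i ∧ 3 ≤ i), A.deg i,
      ∀ c ∈ ⨆ (i : ℕ) (_ : Odd i ∧ 3 ≤ i), A.deg i, b * c = -(c * b) := by
    intro b hb c hc
    rw [iSup_subtype'] at hb hc
    induction hb using Submodule.iSup_induction' with
    | mem i b hb =>
      induction hc using Submodule.iSup_induction' with
      | mem j c hc =>
        rw [A.comm hb hc, (i.2.1.mul j.2.1).neg_one_pow, neg_one_smul]
      | zero => simp
      | add c c' _ _ h h' => rw [mul_add, add_mul, h, h', neg_add]
    | zero => simp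
    | add b b' _ _ h h' => rw [mul_add, add_mul, h, h', neg_add]
  have h := key a ha a ha
  have h2 : (2 : k) • (a * a) = 0 := by
    rw [two_smul]; nth_rewrite 1 [h]; simp
  exact (smul_eq_zero.1 h2).resolve_left two_ne_zero

namespace DGModule

variable {k : Type u} [Field k] {A : CommDGAlgebra.{u, v} k} (m : DGModule.{u, v, w} A)

/-- All but finitely many of the homogeneous parts vanish. -/
def IsBounded : Prop := ∃ N : ℕ, ∀ i ≥ N, m.deg i = ⊥

/-- The cocycles of degree `p`. -/
def cocycles (p : ℕ) : Submodule k m.carrier := m.deg p ⊓ LinearMap.ker m.d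

/-- The coboundaries of degree `p`. -/
def coboundaries : ℕ → Submodule k m.carrier
  | 0 => ⊥
  | p + 1 => (m.deg p).map m.d

/-- The cohomology `H^p(𝔪, ∂)`. -/
abbrev H (p : ℕ) : Type w := m.cocycles p ⧸ (m.coboundaries p).submoduleOf (m.cocycles p)

/-- The class of a cocycle. -/
abbrev toH (p : ℕ) : m.cocycles p →ₗ[k] m.H p :=
  ((m.coboundaries p).submoduleOf (m.cocycles p)).mkQ

/-- `det H^•(𝔪, ∂)`, the ordered product of the `(det H^i)^{(-1)^i}` for `i < N`, where `N` is such
that `𝔪^i = 0` for `i ≥ N`. -/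
abbrev detH (N : ℕ) : GradedLine.{u, w} k :=
  GradedLine.prod (fun i => (GradedLine.det k (m.H i)).signPow i.bodd) N

variable (t : A.Twist)

/-- The twisted differential `∂_t = ∂ + t·`. -/
def twistedD : m.carrier →ₗ[k] m.carrier := m.d + Algebra.lsmul k k m.carrier t.val

/-- The even part (`ε = 0`) and the odd part (`ε = 1`) of `𝔪`. -/
def par (ε : ZMod 2) : Submodule k m.carrier := ⨆ (j : ℕ) (_ : (j : ZMod 2) = ε), m.deg j

/-- The filtration by degree of the even and of the odd part. -/
def fil (p : ℤ) (ε : ZMod 2) : Submodule k m.carrier :=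
  ⨆ (j : ℕ) (_ : p ≤ (j : ℤ) ∧ (j : ZMod 2) = ε), m.deg j

theorem d_twist_smul (x : m.carrier) : m.d (t.val • x) = -(t.val • m.d x) := by
  have key : ∀ a ∈ ⨆ (i : ℕ) (_ : Odd i ∧ 3 ≤ i), A.deg i,
      m.d (a • x) = A.d a • x - a • m.d x := by
    intro a ha
    rw [iSup_subtype'] at ha
    induction ha using Submodule.iSup_induction' with
    | mem i a ha => rw [m.leibniz x ha, i.2.1.neg_one_pow, neg_one_smul, sub_eq_add_neg]
    | zero => simp
    | add a b _ _ h h' => rw [add_smul, map_add, h, h', map_add, add_smul, add_smul]; abel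
  rw [key _ t.mem, t.closed, zero_smul, zero_sub]

theorem twistedD_apply (x : m.carrier) : m.twistedD t x = m.d x + t.val • x := rfl

theorem twistedD_comp_twistedD [CharZero k] : (m.twistedD t).comp (m.twistedD t) = 0 := by
  refine LinearMap.ext fun x => ?_
  rw [LinearMap.comp_apply, twistedD_apply, twistedD_apply, map_add, m.d_d, m.d_twist_smul t,
    smul_add, smul_smul, A.mul_self_of_odd t.mem, zero_smul]
  simp

theorem twistedD_mem_par {ε ε' : ZMod 2} (h : ε' = ε + 1) {x : m.carrier} (hx : x ∈ m.par ε) :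
    m.twistedD t x ∈ m.par ε' := by
  subst h
  unfold par at hx
  rw [iSup_subtype'] at hx
  induction hx using Submodule.iSup_induction' with
  | mem j x hx =>
    obtain ⟨j, rfl⟩ := j
    rw [twistedD_apply]
    refine add_mem ?_ ?_
    · exact Submodule.mem_iSup_of_mem (j + 1)
        (Submodule.mem_iSup_of_mem (by push_cast; rfl) (m.d_mem hx))
    · have key : ∀ a ∈ ⨆ (i : ℕ) (_ : Odd i ∧ 3 ≤ i), A.deg i,
          a • x ∈ m.par ((j : ZMod 2) + 1) := by
        intro a ha
        rw [iSup_subtype'] at ha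
        induction ha using Submodule.iSup_induction' with
        | mem i a ha =>
          refine Submodule.mem_iSup_of_mem (i.1 + j)
            (Submodule.mem_iSup_of_mem ?_ (m.smul_mem ha hx))
          have : ((i.1 : ℕ) : ZMod 2) = 1 := (ZMod.natCast_eq_one_iff_odd).2 i.2.1
          push_cast
          rw [this, add_comm]
        | zero => simp
        | add a b _ _ h h' => rw [add_smul]; exact add_mem h h'
      exact key _ t.mem
  | zero => simp
  | add x y _ _ h h' => rw [map_add]; exact add_mem h h'

section Twisted

variable [CharZero k]

/-- The `ℤ/2`-graded complex `(𝔪^{ev} ⊕ 𝔪^{od}, ∂_t)`. -/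
def twisted : Z2Complex.{u, w} k where
  X ε := m.par ε
  d _ _ h := (m.twistedD t).restrict (fun _ hx => m.twistedD_mem_par t h hx)
  d_comp_d ε ε' ε'' h h' := by
    refine LinearMap.ext fun x => Subtype.ext ?_
    exact LinearMap.congr_fun (m.twistedD_comp_twistedD t) x

/-- The inclusion of the `∂_t`-closed elements of parity `ε` into `𝔪`. -/
def twistedCyclesVal (ε : ZMod 2) : (m.twisted t).cycles ε →ₗ[k] m.carrier :=
  (m.par ε).subtype.comp ((m.twisted t).cycles ε).subtype

/-- The filtration of the twisted cohomology: `G_p` consists of the classes of the closed elements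
of the `p`-th step of the filtration by degree. -/
def twistedFil (ε : ZMod 2) (p : ℕ) : Submodule k ((m.twisted t).H ε) :=
  ((m.fil p ε).comap (m.twistedCyclesVal t ε)).map ((m.twisted t).toH ε)

/-- `Z_r^p`, for the filtered complex `(𝔪, ∂_t)`. -/
abbrev Zt (r p : ℤ) (ε : ZMod 2) : Submodule k m.carrier :=
  FilteredZ2.Z (m.twistedD t) m.fil r p ε

/-- `E_r^p`, for the filtered complex `(𝔪, ∂_t)`. -/
abbrev Et (r p : ℤ) (ε : ZMod 2) : Type w := FilteredZ2.E (m.twistedD t) m.fil r p ε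

/-- The class in `E_r^p` of an element of `Z_r^p`. -/
abbrev toEt (r p : ℤ) (ε : ZMod 2) : m.Zt t r p ε →ₗ[k] m.Et t r p ε :=
  FilteredZ2.toE (m.twistedD t) m.fil r p ε

/-- The page `E_r` of the filtered complex `(𝔪, ∂_t)`, as a `ℤ/2`-graded complex. -/
abbrev pageT (r : ℤ) : Z2Complex.{u, w} k :=
  FilteredZ2.page (m.twistedD t) m.fil (m.twistedD_comp_twistedD t) r

/-- The class in the page `E_r` of an element of `Z_r^p`. -/
abbrev toPageT (r p : ℤ) (ε : ZMod 2) : m.Zt t r p ε →ₗ[k] (m.pageT t r).X ε :=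
  FilteredZ2.toPage (m.twistedD t) m.fil (m.twistedD_comp_twistedD t) r p ε

/-- The family `κ` identifies `E` with the spectral sequence of the filtered complex `(𝔪, ∂_t)`:
the terms are the `Z_r/B_r`, the differentials are induced by `∂_t`, and the isomorphism
`H(E_r, d_r) ≅ E_{r+1}` is induced by the identity on representatives. -/
structure IsSpectralSequence
    (E : CategoryTheory.E₂CohomologicalSpectralSequence (ModuleCat.{w} k))
    (κ : ∀ (r : ℤ) (hr : 2 ≤ r) (p q : ℤ),
      m.Et t r p ((p + q : ℤ) : ZMod 2) ≃ₗ[k] (E.page r hr).X (p, q)) : Prop where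
  d_eq : ∀ (r : ℤ) (hr : 2 ≤ r) (p q : ℤ) (x : m.Et t r p ((p + q : ℤ) : ZMod 2)),
    ((E.page r hr).d (p, q) (p + r, q + (1 - r))).hom (κ r hr p q x) =
      κ r hr (p + r) (q + (1 - r))
        (FilteredZ2.dE (m.twistedD t) m.fil (m.twistedD_comp_twistedD t) r p (p + r)
          ((p + q : ℤ) : ZMod 2) ((p + r + (q + (1 - r)) : ℤ) : ZMod 2) rfl
          (by push_cast; ring) x)
  iso_eq : ∀ (r : ℤ) (hr : 2 ≤ r) (p q : ℤ) (z' : m.Zt t (r + 1) p ((p + q : ℤ) : ZMod 2))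
    (z : m.Zt t r p ((p + q : ℤ) : ZMod 2)) (c : (E.page r hr).cycles (p, q)),
    (z' : m.carrier) = z →
    ((E.page r hr).iCycles (p, q)).hom c = κ r hr p q (m.toEt t r p _ z) →
      (E.iso r (r + 1) (p, q) rfl hr).hom.hom (((E.page r hr).homologyπ (p, q)).hom c) =
        κ (r + 1) (by lia) p q (m.toEt t (r + 1) p _ z')

/-- The isomorphism `⨂_{i < N} (det H^i(𝔪, ∂))^{(-1)^i} ≅ det E_2` induced by
`H^p(𝔪, ∂) ≅ E_2^{p,q}`, `q` even (a cocycle of degree `p` lies in `Z_2^p` and is sent to its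
class). If `c i` represents an ordered basis of `H^i(𝔪, ∂)`, the product of the volume elements or
of their inverses is sent to (wedge of the even ones) ⊗ (wedge of the odd ones)⁻¹, up to the sign
given by the commutativity constraint of graded lines. -/
def IsDetSecondPageIso (N : ℕ) (φ : GradedLine.Iso (m.detH N) (m.pageT t 2).detLine) : Prop :=
  ∀ (c : ∀ i : ℕ, List (m.cocycles i)) (z : ∀ (ε : ZMod 2) (i : ℕ), List (m.Zt t 2 i ε))
    (_ : ∀ ε i, (z ε i).map (m.Zt t 2 i ε).subtype =
      if (i : ZMod 2) = ε then (c i).map (m.cocycles i).subtype else [])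
    (hc : ∀ i, IsBasisList k ((c i).map (m.toH i)))
    (b : ∀ ε, IsBasisList k
      ((List.range N).flatMap fun i => (z ε i).map (m.toPageT t 2 i ε))),
    φ.equiv (GradedLine.prodElt (fun i => (GradedLine.det k (m.H i)).signPow i.bodd)
        (fun i => (GradedLine.det k (m.H i)).signElt (vol (hc i)) i.bodd) N) =
      (-1 : k) ^ (∑ j ∈ Finset.range N, ∑ i ∈ Finset.range j,
        if Odd i then (c i).length * (c j).length else 0) • volPair (b 0) (b 1)

/-- The isomorphism `det E_r ≅ det H(𝔪, ∂_t)` induced by `E_r^{p,q} = E_∞^{p,q} ≅ G_p/G_{p+1}`,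
for `r` large: if the `z ε i` are closed, are in `Z_r^i`, and represent together an ordered basis
of `E_r`, then its volume element is sent to the one of the basis of `H(𝔪, ∂_t)` that they
represent. -/
def IsDetAbutmentIso (N : ℕ) (r : ℤ)
    (φ : GradedLine.Iso (m.pageT t r).detLine (m.twisted t).detH) : Prop :=
  ∀ (z : ∀ (ε : ZMod 2) (i : ℕ), List (m.Zt t r i ε))
    (c : ∀ (ε : ZMod 2) (_ : ℕ), List ((m.twisted t).cycles ε))
    (_ : ∀ ε i, (z ε i).map (m.Zt t r i ε).subtype = (c ε i).map (m.twistedCyclesVal t ε))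
    (b : ∀ ε, IsBasisList k
      ((List.range N).flatMap fun i => (z ε i).map (m.toPageT t r i ε)))
    (b' : ∀ ε, IsBasisList k
      ((List.range N).flatMap fun i => (c ε i).map ((m.twisted t).toH ε))),
    φ.equiv (volPair (b 0) (b 1)) = volPair (b' 0) (b' 1)

/-- `Φ : det H(𝔪, ∂) ≅ det H(𝔪, ∂_t)` is the composition
`det H(𝔪, ∂) ≅ det E_2 ≅ det E_3 ≅ ⋯ ≅ det E_∞ ≅ det H(𝔪, ∂_t)`. The isomorphism `Ψ r` is the
composition up to `det E_r`. -/
def IsCanonicalDetIso (N : ℕ) (Φ : GradedLine.Iso (m.detH N) (m.twisted t).detH) : Prop :=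
  ∃ Ψ : ∀ r : ℤ, 2 ≤ r → GradedLine.Iso (m.detH N) (m.pageT t r).detLine,
    m.IsDetSecondPageIso t N (Ψ 2 le_rfl) ∧
    (∀ (r : ℤ) (hr : 2 ≤ r),
      FilteredZ2.IsDetNextPageIso (m.twistedD t) m.fil (m.twistedD_comp_twistedD t)
        r (r + 1) ((Ψ r hr).symm.trans (Ψ (r + 1) (by lia)))) ∧
    ∃ r₀ : ℤ, ∀ (r : ℤ) (hr : 2 ≤ r), r₀ ≤ r →
      m.IsDetAbutmentIso t N r ((Ψ r hr).symm.trans Φ)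

end Twisted

end DGModule

/-! ### Morphisms -/

/-- A morphism from `(𝔪, t)` to `(𝔫, s)`: a `k`-linear map which preserves the grading, commutes
with the differentials `∂`, and commutes with the twisted differentials. The dg-algebras may be
different. -/
structure TwistedHom {k : Type u} [Field k] {A : CommDGAlgebra.{u, v} k}
    {B : CommDGAlgebra.{u, v'} k}
    (m : DGModule.{u, v, w} A) (t : A.Twist) (n : DGModule.{u, v', w} B) (s : B.Twist) where
  toFun : m.carrier →ₗ[k] n.carrier
  map_deg : ∀ {i : ℕ} {x : m.carrier}, x ∈ m.deg i → toFun x ∈ n.deg i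
  map_d : ∀ x, toFun (m.d x) = n.d (toFun x)
  map_twistedD : ∀ x, toFun (m.twistedD t x) = n.twistedD s (toFun x)

namespace TwistedHom

variable {k : Type u} [Field k] {A : CommDGAlgebra.{u, v} k}
    {B : CommDGAlgebra.{u, v'} k}
  {m : DGModule.{u, v, w} A} {t : A.Twist} {n : DGModule.{u, v', w} B} {s : B.Twist}
  (f : TwistedHom m t n s)

theorem map_cocycles {p : ℕ} {x : m.carrier} (hx : x ∈ m.cocycles p) :
    f.toFun x ∈ n.cocycles p := by
  refine ⟨f.map_deg hx.1, ?_⟩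
  have h : m.d x = 0 := hx.2
  change n.d (f.toFun x) = 0
  rw [← f.map_d, h, map_zero]

theorem map_coboundaries {p : ℕ} {x : m.carrier} (hx : x ∈ m.coboundaries p) :
    f.toFun x ∈ n.coboundaries p := by
  cases p with
  | zero =>
    have h : x = 0 := hx
    rw [h, map_zero]
    exact zero_mem _
  | succ p =>
    obtain ⟨y, hy, rfl⟩ := hx
    exact ⟨f.toFun y, f.map_deg hy, (f.map_d y).symm⟩

/-- The map induced on `H^p(·, ∂)`. -/
def mapH (p : ℕ) : m.H p →ₗ[k] n.H p :=
  Submodule.mapQ _ _ (f.toFun.restrict (fun _ hx => f.map_cocycles hx))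
    (fun _ hx => f.map_coboundaries hx)

/-- `f` induces isomorphisms on the (untwisted) cohomology. -/
def IsQuasiIso : Prop := ∀ p, Function.Bijective (f.mapH p)

/-- The isomorphism `det H(𝔪, ∂) ≅ det H(𝔫, ∂)` induced by a quasi-isomorphism. -/
def detH (hf : f.IsQuasiIso) (N : ℕ) : GradedLine.Iso (m.detH N) (n.detH N) :=
  GradedLine.Iso.prod (fun i =>
    (GradedLine.Iso.det (LinearEquiv.ofBijective (f.mapH i) (hf i))).signPow i.bodd) N

theorem map_par {ε : ZMod 2} {x : m.carrier} (hx : x ∈ m.par ε) : f.toFun x ∈ n.par ε := by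
  have h : m.par ε ≤ (n.par ε).comap f.toFun :=
    iSup₂_le fun j hj _ hx =>
      Submodule.mem_iSup_of_mem j (Submodule.mem_iSup_of_mem hj (f.map_deg hx))
  exact h hx

section Twisted

variable [CharZero k]

/-- The map induced on the part of parity `ε`. -/
def mapPar (ε : ZMod 2) : (m.twisted t).X ε →ₗ[k] (n.twisted s).X ε :=
  (f.toFun.domRestrict (m.par ε)).codRestrict (n.par ε) (fun x => f.map_par x.2)

theorem mapPar_d (ε ε' : ZMod 2) (h : ε' = ε + 1) (x : (m.twisted t).X ε) :
    f.mapPar ε' ((m.twisted t).d ε ε' h x) = (n.twisted s).d ε ε' h (f.mapPar ε x) :=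
  Subtype.ext (f.map_twistedD (Subtype.val (p := (· ∈ m.par ε)) x))

theorem mapPar_mem_cycles {ε : ZMod 2} {x : (m.twisted t).X ε}
    (hx : x ∈ (m.twisted t).cycles ε) : f.mapPar ε x ∈ (n.twisted s).cycles ε := by
  rw [LinearMap.mem_ker] at hx ⊢
  rw [← f.mapPar_d, hx, map_zero]

theorem mapPar_mem_boundaries {ε : ZMod 2} {x : (m.twisted t).X ε}
    (hx : x ∈ (m.twisted t).boundaries ε) : f.mapPar ε x ∈ (n.twisted s).boundaries ε := by
  obtain ⟨y, rfl⟩ := hx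
  exact ⟨f.mapPar (ε + 1) y, (f.mapPar_d _ _ _ y).symm⟩

/-- The map induced on twisted cohomology. -/
def mapTwistedH (ε : ZMod 2) : (m.twisted t).H ε →ₗ[k] (n.twisted s).H ε :=
  Submodule.mapQ _ _
    ((f.mapPar ε).restrict (fun _ hx => f.mapPar_mem_cycles hx))
    (fun _ hx => f.mapPar_mem_boundaries hx)

/-- The isomorphism `det H(𝔪, ∂_t) ≅ det H(𝔫, ∂_s)` induced by `f`, if `f` induces isomorphisms on
twisted cohomology. -/
def detTwistedH (hf : ∀ ε, Function.Bijective (f.mapTwistedH ε)) :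
    GradedLine.Iso (m.twisted t).detH (n.twisted s).detH :=
  GradedLine.Iso.detPair (LinearEquiv.ofBijective (f.mapTwistedH 0) (hf 0))
    (LinearEquiv.ofBijective (f.mapTwistedH 1) (hf 1))

end Twisted

end TwistedHom

end

noncomputable section

/-! ### Graded lines -/

namespace GradedLine

variable {k : Type u} [Field k] {L L' : GradedLine.{u, w} k}

/-! The terms of the spectral sequence are the concrete quotients `Z_r/B_r` of subspaces of `𝔪`.
Each comparison is therefore between two quotients of one space of representatives, and reduces to
an equality of kernels (`exists_equiv_of_ker_eq`). In particular `H(E_r, d_r) ≅ E_{r+1}` rests on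
two membership statements, `dE_toE_eq_zero_iff` and `toE_succ_eq_zero_iff`, valid for any decreasing
filtration.

The special input is about degrees. The operator `∂` raises the filtration by 1, multiplication by
`t` raises it by at least 3, and in a fixed parity the filtration only jumps at every second step.
Hence `E_2^p` sees only `∂` (`exists_equiv_Et_two`), and `E_r^p` vanishes when `p` has the wrong
parity. If `𝔪^i = 0` for `i ≥ N`, then for `r ≥ N + 1` and `p ≥ 0` the space `Z_r^p` consists of
closed elements, and those of its elements that lie in `B_r^p` are the sums of a closed element of
`F_{p+1}` and an exact one. So the differentials vanish and `E_r^p ≅ G_p/G_{p+1}`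
(`exists_equiv_gr`).

Each link of the chain of determinants is given by a rule on bases, and the point is that the rule
does not depend on the bases. An isomorphism of lines is determined by one nonzero value, so it
suffices that a change of bases multiplies the source and the target by the same scalar; this is the
content of the three lemmas `exists_smul`. For a complex, `dy ∧ h ∧ x` depends only on the product
of the `dy` in the image, of the classes of the `h`, and of the `dx` in the other image
(`wedge_adapted`). The scalars of the two images occur once in the even and once in the odd part,
and cancel. For the abutment, the later factors span `G_{p+1}`, so the earlier ones matter only
modulo `G_{p+1}` (`wedge_twistedH_eq_smul`). Once the differential is zero, the transition between
pages is the identity on representatives with sign 1, so the chain stabilises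
(`IsDetAbutmentIso.succ`).

A quasi-isomorphism is an isomorphism on `E_2`, hence on all later pages, hence on the graded pieces
of a finite filtration and on twisted cohomology. It carries bases of the required kinds to bases of
the same kinds and lengths, so every link gives a commutative square, and the squares are pasted. -/

theorem exists_smul_eq {x : L.carrier} (hx : x ≠ 0) (y : L.carrier) : ∃ c : k, c • x = y :=
  exists_smul_eq_of_finrank_eq_one L.finrank_eq_one hx y

theorem Iso.ext_of_apply_eq {φ ψ : Iso L L'} {x : L.carrier} (hx : x ≠ 0)
    (h : φ.equiv x = ψ.equiv x) : φ = ψ := by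
  refine Iso.ext (LinearEquiv.ext fun y => ?_)
  obtain ⟨c, rfl⟩ := exists_smul_eq hx y
  rw [map_smul, map_smul, h]

/-- Together with `Iso.ext_of_apply_eq` this lets every canonical isomorphism be built, and
identified, by its value on a single volume element. -/
theorem Iso.exists_apply_eq {x : L.carrier} {y : L'.carrier} (hx : x ≠ 0) (hy : y ≠ 0)
    (hd : L.degree = L'.degree) : ∃ φ : Iso L L', φ.equiv x = y := by
  have h1 : Module.Finite k L.carrier := Module.finite_of_finrank_eq_succ L.finrank_eq_one
  have h2 : Module.Finite k L'.carrier := Module.finite_of_finrank_eq_succ L'.finrank_eq_one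
  let e : L.carrier ≃ₗ[k] L'.carrier :=
    LinearEquiv.ofFinrankEq _ _ (L.finrank_eq_one.trans L'.finrank_eq_one.symm)
  have he : e x ≠ 0 := by simpa using hx
  obtain ⟨c, hc⟩ := exists_smul_eq he y
  have hc0 : c ≠ 0 := by
    rintro rfl
    exact hy (by rw [← hc, zero_smul])
  exact ⟨⟨e.trans (LinearEquiv.smulOfNeZero k _ c hc0), hd⟩, hc⟩

theorem recip_apply_self {x : L.carrier} (hx : x ≠ 0) :
    (show Module.Dual k L.carrier from L.recip x) x = 1 := by
  classical
  have h : ∃ ξ : Module.Dual k L.carrier, ξ x = 1 := by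
    obtain ⟨f, hf⟩ := Module.Projective.exists_dual_ne_zero k hx
    exact ⟨(f x)⁻¹ • f, by simp [hf]⟩
  have h1 : L.recip x = h.choose := dif_pos h
  rw [h1]
  exact h.choose_spec

/-- The functional `recip` is picked by choice; the choice is harmless because a functional on a
line is determined by its value at one nonzero vector. -/
theorem eq_recip {x : L.carrier} (hx : x ≠ 0) {ξ : Module.Dual k L.carrier} (h : ξ x = 1) :
    ξ = L.recip x := by
  refine LinearMap.ext fun y => ?_
  obtain ⟨c, rfl⟩ := exists_smul_eq hx y
  rw [map_smul, h]
  exact ((LinearMap.map_smul (show Module.Dual k L.carrier from L.recip x) c x).trans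
    (congrArg _ (recip_apply_self hx))).symm

theorem recip_ne_zero {x : L.carrier} (hx : x ≠ 0) : L.recip x ≠ 0 := by
  intro h
  have := recip_apply_self hx
  rw [h] at this
  exact zero_ne_one this

theorem recip_smul {x : L.carrier} (hx : x ≠ 0) {a : k} (ha : a ≠ 0) :
    L.recip (a • x) = a⁻¹ • L.recip x := by
  refine (eq_recip (smul_ne_zero ha hx)
    (ξ := a⁻¹ • (show Module.Dual k L.carrier from L.recip x)) ?_).symm
  rw [LinearMap.smul_apply, map_smul, recip_apply_self hx]
  simp [ha]

theorem Iso.inv_equiv_recip (φ : Iso L L') {x : L.carrier} (hx : x ≠ 0) :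
    φ.inv.equiv (L.recip x) = L'.recip (φ.equiv x) := by
  refine eq_recip (by simpa using hx) ?_
  change (show Module.Dual k L.carrier from L.recip x) (φ.equiv.symm (φ.equiv x)) = 1
  rw [φ.equiv.symm_apply_apply]
  exact recip_apply_self hx

theorem Iso.signPow_equiv_signElt (φ : Iso L L') {x : L.carrier} (hx : x ≠ 0) (s : Bool) :
    (φ.signPow s).equiv (L.signElt x s) = L'.signElt (φ.equiv x) s := by
  cases s
  · rfl
  · exact φ.inv_equiv_recip hx

theorem signElt_ne_zero {x : L.carrier} (hx : x ≠ 0) (s : Bool) : L.signElt x s ≠ 0 := by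
  cases s
  · exact hx
  · exact recip_ne_zero hx

theorem tmul_ne_zero {V W : Type*} [AddCommGroup V] [Module k V] [AddCommGroup W] [Module k W]
    {x : V} {y : W} (hx : x ≠ 0) (hy : y ≠ 0) : x ⊗ₜ[k] y ≠ 0 := by
  obtain ⟨f, hf⟩ := Module.Projective.exists_dual_ne_zero k hx
  obtain ⟨g, hg⟩ := Module.Projective.exists_dual_ne_zero k hy
  intro h
  have := congrArg (TensorProduct.lid k k ∘ TensorProduct.map f g) h
  simp [hf, hg] at this

theorem prodElt_ne_zero {L : ℕ → GradedLine.{u, w} k} {x : ∀ i, (L i).carrier}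
    (hx : ∀ i, x i ≠ 0) (N : ℕ) : prodElt L x N ≠ 0 := by
  induction N with
  | zero =>
    intro h
    exact one_ne_zero (congrArg ULift.down (show (ULift.up (1 : k) : ULift.{w} k) = 0 from h))
  | succ N ih => exact tmul_ne_zero ih (hx N)

theorem Iso.prod_equiv_prodElt {L L' : ℕ → GradedLine.{u, w} k} (φ : ∀ i, Iso (L i) (L' i))
    (x : ∀ i, (L i).carrier) (N : ℕ) :
    (Iso.prod φ N).equiv (prodElt L x N) = prodElt L' (fun i => (φ i).equiv (x i)) N := by
  induction N with
  | zero => rfl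
  | succ N ih =>
    exact congrArg (fun y => y ⊗ₜ[k] ((φ N).equiv (x N))) ih

theorem prodElt_smul {L : ℕ → GradedLine.{u, w} k} (x : ∀ i, (L i).carrier) (a : ℕ → k) (N : ℕ) :
    prodElt L (fun i => a i • x i) N = (∏ i ∈ Finset.range N, a i) • prodElt L x N := by
  induction N with
  | zero => exact (one_smul k _).symm
  | succ N ih =>
    rw [Finset.prod_range_succ]
    change (prodElt L (fun i => a i • x i) N) ⊗ₜ[k] (a N • x N) = _ • (_ ⊗ₜ[k] _)
    rw [ih, TensorProduct.smul_tmul_smul]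
    rfl

theorem prod_degree (L : ℕ → GradedLine.{u, w} k) (N : ℕ) :
    (prod L N).degree = ∑ i ∈ Finset.range N, (L i).degree := by
  induction N with
  | zero => rfl
  | succ N ih =>
    rw [Finset.sum_range_succ, ← ih]
    rfl

@[simp]
theorem Iso.trans_equiv_apply {L L' L'' : GradedLine.{u, w} k} (φ : Iso L L') (ψ : Iso L' L'')
    (x : L.carrier) : (φ.trans ψ).equiv x = ψ.equiv (φ.equiv x) := rfl

theorem Iso.symm_trans_trans {L L' L'' : GradedLine.{u, w} k} (φ : Iso L L') (ψ : Iso L' L'') :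
    φ.symm.trans (φ.trans ψ) = ψ :=
  Iso.ext (LinearEquiv.ext fun x => congrArg ψ.equiv (φ.equiv.apply_symm_apply x))

theorem Iso.trans_symm_trans {L L' L'' : GradedLine.{u, w} k} (φ : Iso L L') (ψ : Iso L L'') :
    φ.trans (φ.symm.trans ψ) = ψ :=
  Iso.ext (LinearEquiv.ext fun x => congrArg ψ.equiv (φ.equiv.symm_apply_apply x))

theorem Iso.trans_assoc {L L' L'' L''' : GradedLine.{u, w} k} (φ : Iso L L') (ψ : Iso L' L'')
    (χ : Iso L'' L''') : (φ.trans ψ).trans χ = φ.trans (ψ.trans χ) := rfl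

end GradedLine

/-! ### Ordered bases -/

section Lists

variable {k : Type u} [Field k] {V W : Type*} [AddCommGroup V] [Module k V]
  [AddCommGroup W] [Module k W]

/-- Separating repetitions from independence of the underlying set makes passage to sublists a
matter of monotonicity. -/
theorem linearIndependent_list_get_iff {l : List V} :
    LinearIndependent k l.get ↔ l.Nodup ∧ LinearIndepOn k id {x | x ∈ l} := by
  rw [List.nodup_iff_injective_get, ← Set.range_list_get]
  refine ⟨fun h => ⟨h.injective, h.linearIndepOn_id⟩, fun h => ?_⟩
  exact (linearIndepOn_id_range_iff h.1).1 h.2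

theorem linearIndependent_list_sublist {l l' : List V} (h : l.Sublist l')
    (hl : LinearIndependent k l'.get) : LinearIndependent k l.get := by
  rw [linearIndependent_list_get_iff] at hl ⊢
  exact ⟨hl.1.sublist h, hl.2.mono fun x hx => h.subset hx⟩

theorem linearIndependent_list_map {l : List V} (f : V →ₗ[k] W)
    (hl : LinearIndependent k (l.map f).get) : LinearIndependent k l.get := by
  refine LinearIndependent.of_comp f ?_
  have := hl.comp (Fin.cast (List.length_map (as := l) f).symm) (Fin.cast_injective _)
  convert this using 1
  ext i
  simp

theorem span_list_map (l : List V) (f : V →ₗ[k] W) :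
    Submodule.span k {x | x ∈ l.map f} = (Submodule.span k {x | x ∈ l}).map f := by
  rw [Submodule.map_span]
  congr 1
  ext x
  simp

theorem span_list_append (l l' : List V) :
    Submodule.span k {x | x ∈ l ++ l'} =
      Submodule.span k {x | x ∈ l} ⊔ Submodule.span k {x | x ∈ l'} := by
  rw [← Submodule.span_union]
  congr 1
  ext x
  simp

theorem span_list_flatMap {ι : Type*} (l : List ι) (f : ι → List V) :
    Submodule.span k {x | x ∈ l.flatMap f} = ⨆ i ∈ l, Submodule.span k {x | x ∈ f i} := by
  refine le_antisymm (Submodule.span_le.2 fun x hx => ?_) (iSup₂_le fun i hi =>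
    Submodule.span_mono fun x hx => List.mem_flatMap.2 ⟨i, hi, hx⟩)
  obtain ⟨i, hi, hx⟩ := List.mem_flatMap.1 hx
  exact Submodule.mem_iSup_of_mem i (Submodule.mem_iSup_of_mem hi (Submodule.subset_span hx))

theorem finite_of_span_list {l : List V} (h : Submodule.span k {x | x ∈ l} = ⊤) :
    Module.Finite k V :=
  ⟨h ▸ Submodule.fg_span (List.finite_toSet l)⟩

theorem finrank_le_length {l : List V} (h : Submodule.span k {x | x ∈ l} = ⊤) :
    Module.finrank k V ≤ l.length := by
  have := finrank_range_le_card (R := k) l.get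
  rw [Set.finrank, Set.range_list_get, h, finrank_top] at this
  simpa using this

namespace IsBasisList

/-- Most bases below are recognised in this way, by spanning and a length count, with no direct
check of independence. -/
theorem of_span {l : List V} (h : Submodule.span k {x | x ∈ l} = ⊤)
    (hl : l.length ≤ Module.finrank k V) : IsBasisList k l := by
  refine ⟨linearIndependent_of_top_le_span_of_card_eq_finrank ?_ ?_, h⟩
  · rw [Set.range_list_get, h]
  · rw [Fintype.card_fin]
    exact le_antisymm hl (finrank_le_length h)

theorem finite {l : List V} (h : IsBasisList k l) : Module.Finite k V :=
  finite_of_span_list h.2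

theorem map {l : List V} (h : IsBasisList k l) (e : V ≃ₗ[k] W) : IsBasisList k (l.map e) := by
  refine of_span ?_ ?_
  · exact (span_list_map l e.toLinearMap).trans (by rw [h.2]; simp)
  · rw [List.length_map, ← h.finrank_eq, e.finrank_eq]

variable (k V) in
theorem exists_of_finite [Module.Finite k V] : ∃ l : List V, IsBasisList k l := by
  refine ⟨List.ofFn (Module.finBasis k V), of_span ?_ (by simp)⟩
  have : {x | x ∈ List.ofFn (Module.finBasis k V)} = Set.range (Module.finBasis k V) := by
    ext x
    simp [List.mem_ofFn]
  rw [this, Module.Basis.span_eq]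

theorem exists_map_eq {f : V →ₗ[k] W} {l : List W} (hf : Function.Surjective f) :
    ∃ l' : List V, l'.map f = l := by
  obtain ⟨g, hg⟩ := hf.hasRightInverse
  exact ⟨l.map g, by simp [hg.comp_eq_id]⟩

end IsBasisList

end Lists

/-! ### Products of vectors in the exterior algebra -/

section Wedge

variable {k : Type u} [Field k] {V : Type*} {W : Type*} [AddCommGroup V] [Module k V]
  [AddCommGroup W] [Module k W]

variable (k) in
/-- The product `x₁ ∧ ⋯ ∧ xₙ` in the exterior algebra. -/
def wedge (l : List V) : ExteriorAlgebra k V := (l.map (ExteriorAlgebra.ι k)).prod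

@[simp]
theorem wedge_nil : wedge k ([] : List V) = 1 := rfl

theorem wedge_cons (x : V) (l : List V) : wedge k (x :: l) = ExteriorAlgebra.ι k x * wedge k l := by
  simp [wedge]

theorem wedge_append (l l' : List V) : wedge k (l ++ l') = wedge k l * wedge k l' := by
  simp [wedge]

theorem map_wedge (f : V →ₗ[k] W) (l : List V) :
    ExteriorAlgebra.map f (wedge k l) = wedge k (l.map f) := by
  induction l with
  | nil => simp
  | cons x l ih => rw [wedge_cons, map_mul, ih, ExteriorAlgebra.map_apply_ι, List.map_cons,
    wedge_cons]

theorem wedge_ofFn {n : ℕ} (x : Fin n → V) :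
    wedge k (List.ofFn x) = ExteriorAlgebra.ιMulti k n x := by
  rw [ExteriorAlgebra.ιMulti_apply, wedge, List.map_ofFn]
  rfl

theorem ExteriorAlgebra.ι_mul_ι_comm_neg (x y : V) :
    ExteriorAlgebra.ι k x * ExteriorAlgebra.ι k y =
      -(ExteriorAlgebra.ι k y * ExteriorAlgebra.ι k x) :=
  eq_neg_of_add_eq_zero_left (ExteriorAlgebra.ι_add_mul_swap x y)

theorem wedge_mul_ι (l : List V) (x : V) :
    wedge k l * ExteriorAlgebra.ι k x =
      (-1 : k) ^ l.length • (ExteriorAlgebra.ι k x * wedge k l) := by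
  induction l with
  | nil => simp
  | cons y l ih =>
    rw [wedge_cons, mul_assoc, ih, mul_smul_comm, ← mul_assoc, ExteriorAlgebra.ι_mul_ι_comm_neg,
      neg_mul, List.length_cons, pow_succ, mul_assoc]
    simp

theorem ι_mul_wedge_of_mem {l : List V} {x : V} (hx : x ∈ l) :
    ExteriorAlgebra.ι k x * wedge k l = 0 := by
  induction l with
  | nil => simp at hx
  | cons y l ih =>
    rw [wedge_cons, ← mul_assoc]
    rcases List.mem_cons.1 hx with rfl | hx
    · simp
    · rw [ExteriorAlgebra.ι_mul_ι_comm_neg, neg_mul, mul_assoc, ih hx, mul_zero, neg_zero]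

theorem ι_mul_wedge_of_mem_span {l : List V} {x : V} (hx : x ∈ Submodule.span k {x | x ∈ l}) :
    ExteriorAlgebra.ι k x * wedge k l = 0 := by
  have : Submodule.span k {x | x ∈ l} ≤
      LinearMap.ker ((LinearMap.mulRight k (wedge k l)).comp (ExteriorAlgebra.ι k)) :=
    Submodule.span_le.2 fun y hy => ι_mul_wedge_of_mem hy
  exact this hx

theorem wedge_mul_ι_of_mem_span {l : List V} {x : V} (hx : x ∈ Submodule.span k {x | x ∈ l}) :
    wedge k l * ExteriorAlgebra.ι k x = 0 := by
  rw [wedge_mul_ι, ι_mul_wedge_of_mem_span hx, smul_zero]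

/-- If `P ∧ v = 0` for `v` in `K`, then `P ∧ x₁ ∧ ⋯ ∧ xₙ` depends only on the `xᵢ` modulo `K`. -/
theorem mul_wedge_congr {K : Submodule k V} {P : ExteriorAlgebra k V}
    (hP : ∀ x ∈ K, P * ExteriorAlgebra.ι k x = 0) {l l' : List V}
    (h : List.Forall₂ (fun x y => x - y ∈ K) l l') : P * wedge k l = P * wedge k l' := by
  induction h generalizing P with
  | nil => rfl
  | @cons x y l l' hxy _ ih =>
    have h1 : P * ExteriorAlgebra.ι k x = P * ExteriorAlgebra.ι k y := by
      rw [← sub_eq_zero, ← mul_sub, ← map_sub]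
      exact hP _ hxy
    rw [wedge_cons, wedge_cons, ← mul_assoc, ← mul_assoc, h1]
    -- Right multiplication by `x` preserves the hypothesis on `P`: moving `z` past `x` costs only a
    -- sign.
    refine ih fun z hz => ?_
    rw [mul_assoc, ExteriorAlgebra.ι_mul_ι_comm_neg, mul_neg, ← mul_assoc, hP z hz, zero_mul,
      neg_zero]

/-- If `v ∧ P = 0` for `v` in `K`, then `x₁ ∧ ⋯ ∧ xₙ ∧ P` depends only on the `xᵢ` modulo `K`. -/
theorem wedge_mul_congr {K : Submodule k V} {P : ExteriorAlgebra k V}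
    (hP : ∀ x ∈ K, ExteriorAlgebra.ι k x * P = 0) {l l' : List V}
    (h : List.Forall₂ (fun x y => x - y ∈ K) l l') : wedge k l * P = wedge k l' * P := by
  have key : ∀ (l : List V), ∀ x ∈ K, ExteriorAlgebra.ι k x * (wedge k l * P) = 0 := by
    intro l x hx
    have h1 := wedge_mul_ι (k := k) l x
    -- The sign in `wedge_mul_ι` squares to 1, so `x` can be moved through `l` in the other
    -- direction, next to `P`.
    have h2 : ((-1 : k) ^ l.length * (-1 : k) ^ l.length) • (ExteriorAlgebra.ι k x * wedge k l) =
        (-1 : k) ^ l.length • (wedge k l * ExteriorAlgebra.ι k x) := by rw [h1, smul_smul]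
    rw [← mul_pow, neg_one_mul, neg_neg, one_pow, one_smul] at h2
    rw [← mul_assoc, h2, smul_mul_assoc, mul_assoc, hP x hx, mul_zero, smul_zero]
  induction h with
  | nil => rfl
  | @cons x y l l' hxy _ ih =>
    rw [wedge_cons, wedge_cons, mul_assoc, mul_assoc, ih, ← sub_eq_zero, ← sub_mul, ← map_sub]
    exact key l' _ hxy

end Wedge

/-! ### Volume elements -/

section Volume

variable {k : Type u} [Field k] {V W : Type w} [AddCommGroup V] [Module k V]
  [AddCommGroup W] [Module k W]

variable (k V) in
/-- The inclusion of the determinant line into the exterior algebra. -/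
def detVal : (GradedLine.det k V).carrier →ₗ[k] ExteriorAlgebra k V :=
  (⋀[k]^(Module.finrank k V) V).subtype

theorem detVal_injective : Function.Injective (detVal k V) := Subtype.val_injective

theorem detVal_vol {l : List V} (h : IsBasisList k l) : detVal k V (vol h) = wedge k l := by
  have h1 : detVal k V (vol h) =
      ExteriorAlgebra.ιMulti k _ (fun i => l.get (i.cast h.finrank_eq)) :=
    exteriorPower.ιMulti_apply_coe _ _ _
  rw [h1, ← wedge_ofFn]
  congr 1
  refine List.ext_get (by simp [h.finrank_eq]) fun i h1 h2 => ?_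
  simp

/-- The determinant relative to the basis itself is a functional on the top exterior power which
takes the value 1 on this element. -/
theorem vol_ne_zero {l : List V} (h : IsBasisList k l) : vol h ≠ 0 := by
  have hs : ⊤ ≤ Submodule.span k (Set.range l.get) := by
    rw [Set.range_list_get, h.2]
  let b := (Module.Basis.mk h.1 hs).reindex (finCongr h.finrank_eq.symm)
  have hb : ∀ i, b i = l.get (i.cast h.finrank_eq) := by
    intro i
    simp [b]
  intro h0
  have h1 := exteriorPower.alternatingMapLinearEquiv_apply_ιMulti b.det
    (fun i => l.get (i.cast h.finrank_eq))
  have h2 : exteriorPower.ιMulti k (Module.finrank k V)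
    (fun i => l.get (i.cast h.finrank_eq)) = 0 := h0
  rw [h2, map_zero] at h1
  have h3 : (fun i => l.get (i.cast h.finrank_eq)) = b := funext fun i => (hb i).symm
  rw [h3, b.det_self] at h1
  exact zero_ne_one h1

theorem IsBasisList.exists_vol_eq_smul {l l' : List V} (h : IsBasisList k l)
    (h' : IsBasisList k l') : ∃ a : k, a ≠ 0 ∧ vol h = a • vol h' := by
  obtain ⟨a, ha⟩ := GradedLine.exists_smul_eq (vol_ne_zero h') (vol h)
  refine ⟨a, ?_, ha.symm⟩
  rintro rfl
  exact vol_ne_zero h (by rw [← ha, zero_smul])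

/-- Moves comparisons of volume elements into the exterior algebra, where concatenated lists
multiply and the degree `finrank` no longer appears in the type. -/
theorem vol_eq_smul_iff {l l' : List V} (h : IsBasisList k l) (h' : IsBasisList k l') {a : k} :
    vol h = a • vol h' ↔ wedge k l = a • wedge k l' := by
  rw [← detVal_injective.eq_iff, map_smul, detVal_vol, detVal_vol]

theorem IsBasisList.exists_wedge_eq_smul {l l' : List V} (h : IsBasisList k l)
    (h' : IsBasisList k l') : ∃ a : k, a ≠ 0 ∧ wedge k l = a • wedge k l' := by
  obtain ⟨a, ha, h1⟩ := h.exists_vol_eq_smul h'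
  exact ⟨a, ha, (vol_eq_smul_iff h h').1 h1⟩

theorem volPair_ne_zero {l : List V} {l' : List W} (h : IsBasisList k l) (h' : IsBasisList k l') :
    volPair h h' ≠ 0 :=
  GradedLine.tmul_ne_zero (vol_ne_zero h) (GradedLine.recip_ne_zero (vol_ne_zero h'))

theorem volPair_eq_smul {l₁ l₂ : List V} {l₁' l₂' : List W} (h₁ : IsBasisList k l₁)
    (h₁' : IsBasisList k l₁') (h₂ : IsBasisList k l₂) (h₂' : IsBasisList k l₂') {a b : k}
    (hb : b ≠ 0) (ha : wedge k l₁ = a • wedge k l₂) (hb' : wedge k l₁' = b • wedge k l₂') :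
    volPair h₁ h₁' = (a * b⁻¹) • volPair h₂ h₂' := by
  unfold volPair
  rw [(vol_eq_smul_iff h₁ h₂).2 ha, (vol_eq_smul_iff h₁' h₂').2 hb',
    GradedLine.recip_smul (vol_ne_zero h₂') hb]
  exact TensorProduct.smul_tmul_smul _ _ _ _

theorem volPair_congr {l₁ l₂ : List V} {l₁' l₂' : List W} (h₁ : IsBasisList k l₁)
    (h₁' : IsBasisList k l₁') (h₂ : IsBasisList k l₂) (h₂' : IsBasisList k l₂') (h : l₁ = l₂)
    (h' : l₁' = l₂') : volPair h₁ h₁' = volPair h₂ h₂' := by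
  subst h h'
  rfl

namespace GradedLine

theorem Iso.det_equiv_vol (e : V ≃ₗ[k] W) {l : List V} (h : IsBasisList k l) :
    (Iso.det e).equiv (vol h) = vol (h.map e) := by
  refine detVal_injective ?_
  rw [detVal_vol]
  have h1 : detVal k W ((Iso.det e).equiv (vol h)) =
      (exteriorPower.map (Module.finrank k V) e.toLinearMap (exteriorPower.ιMulti k _
        (fun i => l.get (i.cast h.finrank_eq))) : ExteriorAlgebra k W) := rfl
  rw [h1, exteriorPower.map_apply_ιMulti, exteriorPower.ιMulti_apply_coe, ← wedge_ofFn]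
  congr 1
  refine List.ext_get (by simp [h.finrank_eq]) fun i h1 h2 => ?_
  simp

theorem Iso.detPair_equiv_volPair {V' W' : Type w} [AddCommGroup V'] [Module k V']
    [AddCommGroup W'] [Module k W'] (e : V ≃ₗ[k] V') (e' : W ≃ₗ[k] W') {l : List V} {l' : List W}
    (h : IsBasisList k l) (h' : IsBasisList k l') :
    (Iso.detPair e e').equiv (volPair h h') = volPair (h.map e) (h'.map e') := by
  have h1 : (Iso.detPair e e').equiv (volPair h h') =
    ((Iso.det e).equiv (vol h)) ⊗ₜ[k]
      ((Iso.det e').inv.equiv ((GradedLine.det k W).recip (vol h'))) := rfl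
  rw [h1, Iso.det_equiv_vol, Iso.inv_equiv_recip _ (vol_ne_zero h'), Iso.det_equiv_vol]
  rfl

theorem detPair_degree {l : List V} {l' : List W} (h : IsBasisList k l) (h' : IsBasisList k l') :
    (detPair k V W).degree = (l.length : ℤ) - l'.length := by
  rw [← h.finrank_eq, ← h'.finrank_eq]
  rfl

end GradedLine

end Volume

/-! ### Comparison of quotients, and images in direct sums -/

section Quotients

variable {k : Type u} [Field k]

/-- Two quotients of the same space with the same kernel are isomorphic. -/
theorem exists_equiv_of_ker_eq {A P Q : Type*} [AddCommGroup A] [Module k A] [AddCommGroup P]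
    [Module k P] [AddCommGroup Q] [Module k Q] (a : A →ₗ[k] P) (b : A →ₗ[k] Q)
    (ha : Function.Surjective a) (hb : Function.Surjective b)
    (h : ∀ x, a x = 0 ↔ b x = 0) : ∃ e : P ≃ₗ[k] Q, ∀ x, e (a x) = b x := by
  have hk : LinearMap.ker a = LinearMap.ker b := by
    ext x
    exact h x
  refine ⟨(a.quotKerEquivOfSurjective ha).symm.trans
    ((Submodule.quotEquivOfEq _ _ hk).trans (b.quotKerEquivOfSurjective hb)), fun x => ?_⟩
  have h1 : (a.quotKerEquivOfSurjective ha).symm (a x) = Submodule.Quotient.mk x := by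
    rw [LinearEquiv.symm_apply_eq]
    rfl
  rw [LinearEquiv.trans_apply, h1]
  rfl

theorem Submodule.mkQ_submoduleOf_eq_zero {V : Type*} [AddCommGroup V] [Module k V]
    {P Q : Submodule k V} {x : Q} : (P.submoduleOf Q).mkQ x = 0 ↔ (x : V) ∈ P :=
  Submodule.Quotient.mk_eq_zero _

theorem DirectSum.mem_range_lmap {ι : Type*} [DecidableEq ι] {M N : ι → Type*}
    [∀ i, AddCommGroup (M i)] [∀ i, Module k (M i)] [∀ i, AddCommGroup (N i)]
    [∀ i, Module k (N i)] (f : ∀ i, M i →ₗ[k] N i) (x : ⨁ i, N i)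
    (h : ∀ i, x i ∈ LinearMap.range (f i)) : x ∈ LinearMap.range (DirectSum.lmap f) := by
  classical
  rw [← DirectSum.sum_support_of x]
  refine sum_mem fun i _ => ?_
  obtain ⟨y, hy⟩ := h i
  exact ⟨DirectSum.lof k ι M i y, by rw [DirectSum.lmap_lof, hy]; rfl⟩

end Quotients

/-! ### Representatives of cycles and boundaries of consecutive pages -/

namespace FilteredZ2

variable {k : Type u} [Field k] {M : Type w} [AddCommGroup M] [Module k M]
  {D : M →ₗ[k] M} {F : ℤ → ZMod 2 → Submodule k M}

theorem toE_eq_zero_iff {r p : ℤ} {ε : ZMod 2} (z : Z D F r p ε) :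
    toE D F r p ε z = 0 ↔ (z : M) ∈ B D F r p ε :=
  Submodule.mkQ_submoduleOf_eq_zero

theorem toE_surjective (r p : ℤ) (ε : ZMod 2) : Function.Surjective (toE D F r p ε) :=
  Submodule.mkQ_surjective _

theorem mem_Z_iff {r p p' : ℤ} {ε ε' : ZMod 2} (hp : p' = p + r) (hε : ε' = ε + 1) {x : M} :
    x ∈ Z D F r p ε ↔ x ∈ F p ε ∧ D x ∈ F p' ε' := by
  subst hp hε
  exact Iff.rfl

/-- The position and parity of the source of `d_r` receive free names `p'` and `ε'`, so that `p - r
+ 1` and `ε + 1` never have to be rewritten inside types. -/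
theorem mem_B_iff {r p p' : ℤ} {ε ε' : ZMod 2} (hp : p = p' + r) (hε : ε = ε' + 1) {x : M} :
    x ∈ B D F r p ε ↔ ∃ y ∈ Z D F (r - 1) (p + 1) ε, ∃ z ∈ Z D F (r - 1) (p' + 1) ε',
      x = y + D z := by
  have h1 : p - r + 1 = p' + 1 := by rw [hp]; ring
  have h2 : ε + 1 = ε' := by rw [hε, ← ZMod.two_eq_add_one_add_one]
  unfold B
  rw [h1, h2, Submodule.mem_sup]
  constructor
  · rintro ⟨y, hy, _, ⟨z, hz, rfl⟩, rfl⟩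
    exact ⟨y, hy, z, hz, rfl⟩
  · rintro ⟨y, hy, z, hz, rfl⟩
    exact ⟨y, hy, _, ⟨z, hz, rfl⟩, rfl⟩

variable (hF : ∀ ε, Antitone fun p => F p ε)
include hF

theorem Z_mono {r r' p p' : ℤ} (ε : ZMod 2) (hp : p' ≤ p) (hr : p' + r' ≤ p + r) :
    Z D F r p ε ≤ Z D F r' p' ε := fun _ hx => ⟨hF _ hp hx.1, hF _ hr hx.2⟩

theorem Z_succ_le (r p : ℤ) (ε : ZMod 2) : Z D F (r + 1) p ε ≤ Z D F r p ε :=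
  Z_mono hF ε le_rfl (by lia)

theorem toE_comp_inclusion {r p : ℤ} {ε : ZMod 2} (z' : Z D F (r + 1) p ε) (z : Z D F r p ε)
    (h : (z' : M) = z) :
    (toE D F r p ε).comp (Submodule.inclusion (Z_succ_le hF r p ε)) z' = toE D F r p ε z := by
  have h1 : Submodule.inclusion (Z_succ_le hF r p ε) z' = z := Subtype.ext h
  rw [LinearMap.comp_apply, h1]

variable (hD : D.comp D = 0)

/-- A class of `E_r` on which `d_r` vanishes is represented by an element of `Z_{r+1}`. -/
theorem dE_toE_eq_zero_iff {r p p' : ℤ} {ε ε' : ZMod 2} (hp : p' = p + r) (hε : ε' = ε + 1)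
    (z : Z D F r p ε) : dE D F hD r p p' ε ε' hp hε (toE D F r p ε z) = 0 ↔
      ∃ z' : Z D F (r + 1) p ε, ∃ h : (z' : M) ∈ Z D F r p ε,
        toE D F r p ε ⟨z', h⟩ = toE D F r p ε z := by
  have hDD : ∀ x, D (D x) = 0 := LinearMap.congr_fun hD
  have h0 : dE D F hD r p p' ε ε' hp hε (toE D F r p ε z) = 0 ↔ D z ∈ B D F r p' ε' :=
    toE_eq_zero_iff (⟨D z, D_mem_Z D F hD hp hε z.2⟩ : Z D F r p' ε')
  rw [h0, mem_B_iff hp hε]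
  constructor
  · rintro ⟨y, hy, w, hw, h⟩
    have hw' : w ∈ Z D F r p ε := Z_mono hF ε (by lia) (by lia) hw
    -- From `D z = y + D w` one gets `D (z - w) = y`, which lies in `F_{p+r+1}`. The correction `w`
    -- lies in `Z_{r-1}^{p+1}`, a part of `B_r^p`, so the class in `E_r` is unchanged.
    have h1 : (z : M) - w ∈ Z D F (r + 1) p ε := by
      rw [mem_Z_iff (p' := p' + 1) (by lia) hε]
      refine ⟨sub_mem z.2.1 hw'.1, ?_⟩
      rw [map_sub, h, add_sub_cancel_right]
      exact hy.1
    refine ⟨⟨z - w, h1⟩, Z_succ_le hF _ _ _ h1, ?_⟩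
    rw [← sub_eq_zero, ← map_sub, toE_eq_zero_iff]
    refine (mem_B_iff (p' := p - r) (ε' := ε + 1) (by lia)
      (ZMod.two_eq_add_one_add_one _)).2
        ⟨-w, neg_mem (Z_mono hF _ (by lia) (by lia) hw), 0, zero_mem _, ?_⟩
    simp
  · rintro ⟨z', h, h1⟩
    rw [← sub_eq_zero, ← map_sub, toE_eq_zero_iff] at h1
    have h2 := D_mem_B D F hD hp hε h1
    -- Since `D z'` is closed and lies in `F_{p'+1}`, it belongs to the first summand of `B_r`; the
    -- difference between `D z'` and `D z` was treated by `D_mem_B`.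
    have h3 : D (z' : M) ∈ B D F r p' ε' := by
      refine (mem_B_iff hp hε).2 ⟨D z', ?_, 0, zero_mem _, by simp⟩
      exact ⟨((mem_Z_iff (p' := p' + 1) (by lia) hε).1 z'.2).2, by simp [hDD]⟩
    have h4 := sub_mem h3 h2
    rw [← mem_B_iff hp hε]
    simpa using h4

/-- An element of `Z_{r+1}` is zero in `E_{r+1}` if and only if its class in `E_r` is in the image
of `d_r`. -/
theorem toE_succ_eq_zero_iff {r p p' : ℤ} {ε ε' : ZMod 2} (hp : p = p' + r) (hε : ε = ε' + 1)
    (z : Z D F (r + 1) p ε) (h : (z : M) ∈ Z D F r p ε) : toE D F (r + 1) p ε z = 0 ↔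
      ∃ y : E D F r p' ε', dE D F hD r p' p ε' ε hp hε y = toE D F r p ε ⟨z, h⟩ := by
  have hDD : ∀ x, D (D x) = 0 := LinearMap.congr_fun hD
  rw [toE_eq_zero_iff, mem_B_iff (p' := p' - 1) (by lia) hε]
  have e1 : r + 1 - 1 = r := by ring
  have e2 : p' - 1 + 1 = p' := by ring
  rw [e1, e2]
  constructor
  · rintro ⟨u, hu, y, hy, h1⟩
    refine ⟨toE D F r p' ε' ⟨y, hy⟩, ?_⟩
    change toE D F r p ε ⟨D y, D_mem_Z D F hD hp hε hy⟩ = _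
    rw [← sub_eq_zero, ← map_sub, toE_eq_zero_iff, mem_B_iff hp hε]
    refine ⟨-u, neg_mem (Z_mono hF _ le_rfl (by lia) hu), 0, zero_mem _, ?_⟩
    simp [h1]
  · rintro ⟨y, hy⟩
    obtain ⟨y, rfl⟩ := toE_surjective _ _ _ y
    change toE D F r p ε ⟨D y, D_mem_Z D F hD hp hε y.2⟩ = _ at hy
    rw [eq_comm, ← sub_eq_zero, ← map_sub, toE_eq_zero_iff, mem_B_iff hp hε] at hy
    obtain ⟨u, hu, w, hw, h1⟩ := hy
    have h2 : (z : M) = u + D ((y : M) + w) := by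
      rw [map_add, add_comm (D (y : M)), ← add_assoc, ← h1]
      simp
    refine ⟨u, (mem_Z_iff (p' := p + 1 + r) rfl rfl).2 ⟨hu.1, ?_⟩, (y : M) + w,
      add_mem y.2 (Z_mono hF _ (by lia) (by lia) hw), h2⟩
    -- A priori `u` is only in `Z_{r-1}^{p+1}`. But `D u = D z` because `D² = 0`, and `z` in
    -- `Z_{r+1}^p` puts `D z` in `F_{p+1+r}`, one step further, as is needed for `B_{r+1}`.
    have h3 : D u = D (z : M) := by rw [h2, map_add, hDD, add_zero]
    rw [h3]
    exact ((mem_Z_iff (p' := p + 1 + r) (by lia) rfl).1 z.2).2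

end FilteredZ2

/-! ### The pages as direct sums -/

namespace FilteredZ2

variable {k : Type u} [Field k] {M : Type w} [AddCommGroup M] [Module k M]
  {D : M →ₗ[k] M} {F : ℤ → ZMod 2 → Submodule k M} (hD : D.comp D = 0)

/-- The differential of the page `E_r`, as a map of direct sums. -/
def pageD (r : ℤ) (ε ε' : ZMod 2) (hε : ε' = ε + 1) :
    (⨁ p : ℤ, E D F r p ε) →ₗ[k] ⨁ p : ℤ, E D F r p ε' :=
  DirectSum.toModule k ℤ _ fun p =>
    (DirectSum.lof k ℤ (fun p => E D F r p ε') (p + r)).comp (dE D F hD r p (p + r) ε ε' rfl hε)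

theorem pageD_lof (r p p' : ℤ) (ε ε' : ZMod 2) (hp : p' = p + r) (hε : ε' = ε + 1)
    (x : E D F r p ε) : pageD hD r ε ε' hε (DirectSum.lof k ℤ (fun p => E D F r p ε) p x) =
      DirectSum.lof k ℤ (fun p => E D F r p ε') p' (dE D F hD r p p' ε ε' hp hε x) := by
  subst hp
  exact DirectSum.toModule_lof k _ _

theorem pageD_apply (r p p' : ℤ) (ε ε' : ZMod 2) (hp : p' = p + r) (hε : ε' = ε + 1)
    (x : ⨁ p : ℤ, E D F r p ε) : pageD hD r ε ε' hε x p' = dE D F hD r p p' ε ε' hp hε (x p) := by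
  induction x using DirectSum.induction_on with
  | zero => rw [map_zero, DirectSum.zero_apply, DirectSum.zero_apply, map_zero]
  | of i y =>
    rw [← DirectSum.lof_eq_of k, pageD_lof hD r i (i + r) ε ε' rfl hε y]
    by_cases hip : i = p
    · subst hip hp
      rw [DirectSum.lof_apply, DirectSum.lof_apply]
    · rw [DirectSum.lof_eq_of, DirectSum.lof_eq_of, DirectSum.of_eq_of_ne _ _ _ (by lia),
        DirectSum.of_eq_of_ne _ _ _ (Ne.symm hip), map_zero]
  | add x y hx hy => rw [map_add, DirectSum.add_apply, DirectSum.add_apply, map_add, hx, hy]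

theorem toPage_eq_of_toE_eq {r p : ℤ} {ε : ZMod 2} {z z' : Z D F r p ε}
    (h : toE D F r p ε z = toE D F r p ε z') : toPage D F hD r p ε z = toPage D F hD r p ε z' :=
  congrArg (DirectSum.lof k ℤ (fun p => E D F r p ε) p) h

variable (hF : ∀ ε, Antitone fun p => F p ε)
include hF

theorem d_toPage_eq_zero {r p : ℤ} {ε : ZMod 2} {z : Z D F r p ε}
    (hz : (z : M) ∈ Z D F (r + 1) p ε) :
    (page D F hD r).d ε (ε + 1) rfl (toPage D F hD r p ε z) = 0 := by
  refine (pageD_lof hD r p (p + r) ε (ε + 1) rfl rfl _).trans ?_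
  rw [(dE_toE_eq_zero_iff hF hD rfl rfl z).2 ⟨⟨z, hz⟩, z.2, rfl⟩, map_zero]
  rfl

/-- The cycle of `E_r` defined by an element of `Z_{r+1}`. -/
def toPageCycles (r p : ℤ) (ε : ZMod 2) : Z D F (r + 1) p ε →ₗ[k] (page D F hD r).cycles ε :=
  ((toPage D F hD r p ε).comp (Submodule.inclusion (Z_succ_le hF r p ε))).codRestrict _
    fun z => d_toPage_eq_zero hD hF z.2

/-- Both `H(E_r)` and `E_{r+1}` are quotients of `⨁ Z_{r+1}^p`, by the maps `a` followed by the
class, and `b`. The map `j` records the representatives in `E_r`, and the two kernels agree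
component by component. -/
theorem exists_isNextPageIso_aux (r : ℤ) (ε : ZMod 2) :
    ∃ e : (page D F hD r).H ε ≃ₗ[k] (page D F hD (r + 1)).X ε,
      ∀ (p : ℤ) (z : Z D F (r + 1) p ε),
        e ((page D F hD r).toH ε (toPageCycles hD hF r p ε z)) = toPage D F hD (r + 1) p ε z := by
  let a : (⨁ p : ℤ, Z D F (r + 1) p ε) →ₗ[k] (page D F hD r).cycles ε :=
    DirectSum.toModule k ℤ _ fun p => toPageCycles hD hF r p ε
  let b : (⨁ p : ℤ, Z D F (r + 1) p ε) →ₗ[k] ⨁ p : ℤ, E D F (r + 1) p ε :=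
    DirectSum.lmap fun p => toE D F (r + 1) p ε
  let j : (⨁ p : ℤ, Z D F (r + 1) p ε) →ₗ[k] ⨁ p : ℤ, E D F r p ε :=
    DirectSum.lmap fun p => (toE D F r p ε).comp (Submodule.inclusion (Z_succ_le hF r p ε))
  have haj : ∀ x, ((a x : (page D F hD r).cycles ε) : (page D F hD r).X ε) = j x := by
    intro x
    have : ((page D F hD r).cycles ε).subtype.comp a = j := by
      refine DirectSum.linearMap_ext k fun i => LinearMap.ext fun y => ?_
      have h1 := DirectSum.toModule_lof k (φ := fun p => toPageCycles hD hF r p ε) i y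
      have h2 := DirectSum.lmap_lof (fun p => (toE D F r p ε).comp
        (Submodule.inclusion (Z_succ_le hF r p ε))) i y
      exact (congrArg Subtype.val h1).trans h2.symm
    exact LinearMap.congr_fun this x
  have ha : Function.Surjective (((page D F hD r).toH ε).comp a) := by
    intro x
    obtain ⟨⟨c, hc⟩, rfl⟩ := Submodule.mkQ_surjective _ x
    have h1 : (show ⨁ p : ℤ, E D F r p ε from c) ∈ LinearMap.range j := by
      refine DirectSum.mem_range_lmap _ _ fun p => ?_
      have h2 := pageD_apply hD r p (p + r) ε (ε + 1) rfl rfl c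
      have h3 : pageD hD r ε (ε + 1) rfl c = 0 := hc
      rw [h3, DirectSum.zero_apply] at h2
      obtain ⟨z, hz⟩ := toE_surjective r p ε ((show ⨁ p : ℤ, E D F r p ε from c) p)
      have h5 : toE D F r p ε z = DFinsupp.toFun c p := hz
      rw [← hz] at h2 ⊢
      obtain ⟨z', h, h4⟩ := (dE_toE_eq_zero_iff hF hD rfl rfl z).1 h2.symm
      exact ⟨z', h4⟩
    obtain ⟨y, hy⟩ := h1
    exact ⟨y, congrArg _ (Subtype.ext ((haj y).trans hy))⟩
  have hb : Function.Surjective b :=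
    (DirectSum.lmap_surjective _).2 fun p => toE_surjective _ _ _
  have hab : ∀ x, ((page D F hD r).toH ε).comp a x = 0 ↔ b x = 0 := by
    intro x
    rw [LinearMap.comp_apply, Submodule.mkQ_submoduleOf_eq_zero, haj]
    have hbx : b x = 0 ↔ ∀ p, toE D F (r + 1) p ε (x p) = 0 := by
      rw [DFinsupp.ext_iff]
      exact forall_congr' fun p => by rw [DirectSum.lmap_apply]; rfl
    rw [hbx]
    -- A boundary of the page is detected in each component, since only the source component `p - r`
    -- contributes to the component `p` of the differential.
    have key : ∀ p, toE D F (r + 1) p ε (x p) = 0 ↔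
        ∃ y : E D F r (p - r) (ε + 1), dE D F hD r (p - r) p (ε + 1) ε (by ring)
          (ZMod.two_eq_add_one_add_one ε) y = j x p := by
      intro p
      rw [toE_succ_eq_zero_iff hF hD (p' := p - r) (ε' := ε + 1) (by ring)
        (ZMod.two_eq_add_one_add_one ε) (x p) (Z_succ_le hF _ _ _ (x p).2), DirectSum.lmap_apply]
      rfl
    simp_rw [key]
    constructor
    · rintro ⟨y, hy⟩ p
      refine ⟨(show ⨁ p : ℤ, E D F r p (ε + 1) from y) (p - r), ?_⟩
      rw [← pageD_apply]
      exact congrArg (fun y : ⨁ p : ℤ, E D F r p ε => y p) hy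
    · intro h
      change j x ∈ LinearMap.range (pageD hD r (ε + 1) ε (ZMod.two_eq_add_one_add_one ε))
      -- The componentwise preimages are assembled into an element of the direct sum over the finite
      -- support of `j x`.
      classical
      rw [← DirectSum.sum_support_of (j x)]
      refine sum_mem fun p _ => ?_
      obtain ⟨y, hy⟩ := h p
      exact ⟨DirectSum.lof k ℤ (fun p => E D F r p (ε + 1)) (p - r) y,
        (pageD_lof hD r (p - r) p (ε + 1) ε (by ring) _ y).trans (by rw [hy]; rfl)⟩
  obtain ⟨e, he⟩ : ∃ e : (page D F hD r).H ε ≃ₗ[k] ⨁ p : ℤ, E D F (r + 1) p ε,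
      ∀ x, e (((page D F hD r).toH ε).comp a x) = b x := 
    exists_equiv_of_ker_eq (Q := ⨁ p : ℤ, E D F (r + 1) p ε) _ b ha hb hab
  refine ⟨e, fun p z => ?_⟩
  have := he (DirectSum.lof k ℤ (fun p => Z D F (r + 1) p ε) p z)
  rw [DirectSum.lmap_lof, LinearMap.comp_apply, DirectSum.toModule_lof] at this
  exact this

theorem exists_isNextPageIso (r : ℤ) :
    ∃ e : ∀ ε, (page D F hD r).H ε ≃ₗ[k] (page D F hD (r + 1)).X ε,
      IsNextPageIso D F hD r (r + 1) e := by
  choose e he using exists_isNextPageIso_aux hD hF r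
  refine ⟨e, fun ε p z' z c hz hc => ?_⟩
  rw [← he]
  congr 2
  refine Subtype.ext (hc.trans ?_)
  have : z = Submodule.inclusion (Z_succ_le hF r p ε) z' := Subtype.ext hz.symm
  rw [this]
  rfl

/-- The classes of elements of `Z_{r+1}` span the cohomology of `E_r`. -/
theorem page_H_induction {r : ℤ} {ε : ZMod 2} {P : (page D F hD r).H ε → Prop}
    (h0 : P 0) (hadd : ∀ x y, P x → P y → P (x + y))
    (hz : ∀ (p : ℤ) (z : Z D F (r + 1) p ε), P ((page D F hD r).toH ε (toPageCycles hD hF r p ε z)))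
    (x : (page D F hD r).H ε) : P x := by
  obtain ⟨e, he⟩ := exists_isNextPageIso_aux hD hF r ε
  have key : ∀ y : ⨁ p : ℤ, E D F (r + 1) p ε, P (e.symm y) := by
    intro y
    induction y using DirectSum.induction_on with
    | zero =>
      have : e.symm (0 : ⨁ p : ℤ, E D F (r + 1) p ε) = 0 := map_zero e.symm
      rw [this]
      exact h0
    | of p y =>
      obtain ⟨z, rfl⟩ := toE_surjective _ _ _ y
      have h1 := he p z
      rw [← e.eq_symm_apply] at h1
      have := hz p z
      rw [h1] at this
      exact this
    | add x y hx hy =>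
      have : e.symm (x + y : ⨁ p : ℤ, E D F (r + 1) p ε) = e.symm x + e.symm y :=
        map_add e.symm _ _
      rw [this]
      exact hadd _ _ hx hy
  have := key (e x)
  have h2 : e.symm (e x) = x := e.symm_apply_apply x
  rw [← h2]
  exact this

end FilteredZ2

/-! ### Morphisms of filtered complexes -/

namespace FilteredZ2

variable {k : Type u} [Field k] {M M' : Type w} [AddCommGroup M] [Module k M]
  [AddCommGroup M'] [Module k M'] {D : M →ₗ[k] M} {F : ℤ → ZMod 2 → Submodule k M}
  {D' : M' →ₗ[k] M'} {F' : ℤ → ZMod 2 → Submodule k M'}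
  {g : M →ₗ[k] M'} (hg : ∀ x, g (D x) = D' (g x)) (hgF : ∀ p ε, F p ε ≤ (F' p ε).comap g)

include hg hgF

theorem Z_le_comap (r p : ℤ) (ε : ZMod 2) : Z D F r p ε ≤ (Z D' F' r p ε).comap g := by
  intro x hx
  refine ⟨hgF _ _ hx.1, ?_⟩
  change D' (g x) ∈ F' (p + r) (ε + 1)
  rw [← hg]
  exact hgF _ _ hx.2

theorem B_le_comap (r p : ℤ) (ε : ZMod 2) : B D F r p ε ≤ (B D' F' r p ε).comap g := by
  refine sup_le ((Z_le_comap hg hgF _ _ _).trans (Submodule.comap_mono le_sup_left)) ?_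
  rw [Submodule.map_le_iff_le_comap]
  intro x hx
  change g (D x) ∈ B D' F' r p ε
  rw [hg]
  exact Submodule.mem_sup_right (Submodule.mem_map_of_mem (Z_le_comap hg hgF _ _ _ hx))

/-- The map induced on `E_r^p`. -/
def mapE (r p : ℤ) (ε : ZMod 2) : E D F r p ε →ₗ[k] E D' F' r p ε :=
  Submodule.mapQ _ _ (g.restrict (Z_le_comap hg hgF r p ε)) fun _ hx => B_le_comap hg hgF r p ε hx

theorem mapE_toE (r p : ℤ) (ε : ZMod 2) (z : Z D F r p ε) :
    mapE hg hgF r p ε (toE D F r p ε z) = toE D' F' r p ε ⟨g z, Z_le_comap hg hgF r p ε z.2⟩ := rfl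

theorem mapE_dE (hD : D.comp D = 0) (hD' : D'.comp D' = 0) {r p p' : ℤ} {ε ε' : ZMod 2}
    (hp : p' = p + r) (hε : ε' = ε + 1) (x : E D F r p ε) :
    mapE hg hgF r p' ε' (dE D F hD r p p' ε ε' hp hε x) =
      dE D' F' hD' r p p' ε ε' hp hε (mapE hg hgF r p ε x) := by
  obtain ⟨z, rfl⟩ := toE_surjective _ _ _ x
  exact congrArg (toE D' F' r p' ε') (Subtype.ext (hg z))

/-- A morphism which is bijective on `E_r` and commutes with `d_r` is bijective on cohomology. The
argument is carried out on representatives, by the descriptions of cycles and boundaries in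
`dE_toE_eq_zero_iff` and `toE_succ_eq_zero_iff`. -/
theorem mapE_succ_bijective (hF : ∀ ε, Antitone fun p => F p ε)
    (hF' : ∀ ε, Antitone fun p => F' p ε) (hD : D.comp D = 0) (hD' : D'.comp D' = 0) {r : ℤ}
    (h : ∀ p ε, Function.Bijective (mapE hg hgF r p ε)) (p : ℤ) (ε : ZMod 2) :
    Function.Bijective (mapE hg hgF (r + 1) p ε) := by
  have hp : p = p - r + r := by ring
  have hε := ZMod.two_eq_add_one_add_one ε
  constructor
  · rw [injective_iff_map_eq_zero]
    intro x hx
    obtain ⟨z, rfl⟩ := toE_surjective _ _ _ x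
    rw [mapE_toE, toE_succ_eq_zero_iff hF' hD' hp hε ⟨g z, _⟩
      (Z_le_comap hg hgF _ _ _ (Z_succ_le hF _ _ _ z.2))] at hx
    obtain ⟨y, hy⟩ := hx
    obtain ⟨y, rfl⟩ := (h _ _).2 y
    rw [← mapE_dE hg hgF hD hD'] at hy
    rw [toE_succ_eq_zero_iff hF hD hp hε _ (Z_succ_le hF _ _ _ z.2)]
    exact ⟨y, (h _ _).1 hy⟩
  · intro x
    obtain ⟨z', rfl⟩ := toE_surjective _ _ _ x
    have hz' := Z_succ_le hF' _ _ _ z'.2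
    obtain ⟨y, hy⟩ := (h p ε).2 (toE D' F' r p ε ⟨z', hz'⟩)
    obtain ⟨z, rfl⟩ := toE_surjective _ _ _ y
    -- The preimage in `E_r` of a `d_r`-cycle is again a cycle, by injectivity at the position `p +
    -- r`. It may therefore be represented in `Z_{r+1}`.
    have h1 : dE D F hD r p (p + r) ε (ε + 1) rfl rfl (toE D F r p ε z) = 0 := by
      refine (h _ _).1 ?_
      rw [mapE_dE hg hgF hD hD', hy, map_zero, dE_toE_eq_zero_iff hF' hD']
      exact ⟨z', hz', rfl⟩
    rw [dE_toE_eq_zero_iff hF hD] at h1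
    obtain ⟨z₁, hz₁, h2⟩ := h1
    refine ⟨toE D F (r + 1) p ε z₁, ?_⟩
    rw [mapE_toE, ← sub_eq_zero, ← map_sub, toE_succ_eq_zero_iff hF' hD' hp hε _
      (Z_succ_le hF' _ _ _ (Subtype.prop _))]
    -- The two classes already agree in `E_r`, so their difference is the image of zero under `d_r`.
    refine ⟨0, ?_⟩
    rw [← h2, mapE_toE] at hy
    rw [map_zero, eq_comm]
    rw [← sub_eq_zero, ← map_sub] at hy
    exact hy

theorem mapE_bijective_of_le (hF : ∀ ε, Antitone fun p => F p ε)
    (hF' : ∀ ε, Antitone fun p => F' p ε) (hD : D.comp D = 0) (hD' : D'.comp D' = 0) {r₀ r : ℤ}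
    (h : ∀ p ε, Function.Bijective (mapE hg hgF r₀ p ε)) (hr : r₀ ≤ r) (p : ℤ) (ε : ZMod 2) :
    Function.Bijective (mapE hg hgF r p ε) := by
  induction r, hr using Int.leInduction generalizing p ε with
  | base => exact h p ε
  | succ r _ ih => exact mapE_succ_bijective hg hgF hF hF' hD hD' ih p ε

variable (hD : D.comp D = 0) (hD' : D'.comp D' = 0)

/-- The isomorphism of pages induced by isomorphisms of the terms. -/
def mapPage {r : ℤ} (h : ∀ p ε, Function.Bijective (mapE hg hgF r p ε)) (ε : ZMod 2) :
    (page D F hD r).X ε ≃ₗ[k] (page D' F' hD' r).X ε :=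
  LinearEquiv.ofBijective
    (DirectSum.lmap (M := fun p => E D F r p ε) (N := fun p => E D' F' r p ε)
      fun p => mapE hg hgF r p ε)
    ⟨(DirectSum.lmap_injective _).2 fun p => (h p ε).1,
      (DirectSum.lmap_surjective _).2 fun p => (h p ε).2⟩

theorem mapPage_toPage {r : ℤ} (h : ∀ p ε, Function.Bijective (mapE hg hgF r p ε)) (p : ℤ)
    (ε : ZMod 2) (z : Z D F r p ε) : mapPage hg hgF hD hD' h ε (toPage D F hD r p ε z) =
      toPage D' F' hD' r p ε ⟨g z, Z_le_comap hg hgF r p ε z.2⟩ :=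
  DirectSum.lmap_lof _ _ _

theorem mapPage_d {r : ℤ} (h : ∀ p ε, Function.Bijective (mapE hg hgF r p ε)) (ε ε' : ZMod 2)
    (hε : ε' = ε + 1) (x : (page D F hD r).X ε) :
    mapPage hg hgF hD hD' h ε' ((page D F hD r).d ε ε' hε x) =
      (page D' F' hD' r).d ε ε' hε (mapPage hg hgF hD hD' h ε x) := by
  have key : (DirectSum.lmap (M := fun p => E D F r p ε') (N := fun p => E D' F' r p ε')
      fun p => mapE hg hgF r p ε').comp (pageD hD r ε ε' hε) = (pageD hD' r ε ε' hε).comp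
      (DirectSum.lmap (M := fun p => E D F r p ε) (N := fun p => E D' F' r p ε)
      fun p => mapE hg hgF r p ε) := by
    refine DirectSum.linearMap_ext k fun p => LinearMap.ext fun y => ?_
    simp only [LinearMap.comp_apply]
    rw [pageD_lof hD r p (p + r) ε ε' rfl hε, DirectSum.lmap_lof, DirectSum.lmap_lof,
      pageD_lof hD' r p (p + r) ε ε' rfl hε, mapE_dE hg hgF hD hD']
  exact LinearMap.congr_fun key x

end FilteredZ2

/-! ### The determinant of a `ℤ/2`-graded complex -/

section Adapted

variable {k : Type u} [Field k] {V W : Type w} [AddCommGroup V] [Module k V]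
  [AddCommGroup W] [Module k W] {d : V →ₗ[k] W} {d' : W →ₗ[k] V}

/-- Apply `d'` to the spanning list of `W`: the vectors `dx` and `h'` die, so the `d'y` alone span
the image. -/
theorem span_map_eq_range_of_adapted {x : List V} {y : List W} {h' : List W}
    (hdd : ∀ v, d' (d v) = 0) (hh' : ∀ c ∈ h', d' c = 0)
    (b₁ : IsBasisList k (x.map d ++ h' ++ y)) :
    Submodule.span k {v | v ∈ y.map d'} = LinearMap.range d' := by
  rw [span_list_map, LinearMap.range_eq_map, ← b₁.2, span_list_append, span_list_append,
    Submodule.map_sup, Submodule.map_sup]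
  have h1 : (Submodule.span k {v | v ∈ x.map d}).map d' = ⊥ := by
    rw [span_list_map, ← Submodule.map_comp, show d' ∘ₗ d = 0 from LinearMap.ext hdd,
      Submodule.map_zero]
  have h2 : (Submodule.span k {v | v ∈ h'}).map d' = ⊥ := by
    rw [eq_bot_iff, Submodule.map_span_le]
    intro c hc
    rw [hh' c hc]
    exact zero_mem _
  rw [h1, h2, bot_sup_eq, bot_sup_eq]

/-- The product of the vectors of a basis `(d'y, h, x)` depends only on the product of the `d'y` in
the image of `d'`, the product of the `dx` in the image of `d`, and the product of the `h` in the
cohomology. -/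
theorem wedge_adapted {x x₀ : List V} {y y₀ : List W} {h h₀ : List (LinearMap.ker d)}
    (hy : Submodule.span k {v | v ∈ y.map d'} = LinearMap.range d')
    (c : Submodule.span k {v | v ∈ h.map
      ((LinearMap.range d').submoduleOf (LinearMap.ker d)).mkQ} = ⊤)
    {α β γ : k}
    (hα : wedge k (y.map d'.rangeRestrict) = α • wedge k (y₀.map d'.rangeRestrict))
    (hβ : wedge k (x.map d.rangeRestrict) = β • wedge k (x₀.map d.rangeRestrict))
    (hγ : wedge k (h.map ((LinearMap.range d').submoduleOf (LinearMap.ker d)).mkQ) =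
      γ • wedge k (h₀.map ((LinearMap.range d').submoduleOf (LinearMap.ker d)).mkQ)) :
    wedge k (y.map d' ++ h.map (LinearMap.ker d).subtype ++ x) =
      (α * γ * β) • wedge k (y₀.map d' ++ h₀.map (LinearMap.ker d).subtype ++ x₀) := by
  have h1 : ∀ l : List W, wedge k (l.map d') =
      ExteriorAlgebra.map (LinearMap.range d').subtype (wedge k (l.map d'.rangeRestrict)) := by
    intro l
    rw [map_wedge, List.map_map]
    rfl
  -- The linear sections `s` and `σ` express the products of the `h` and of the `x` through their
  -- classes. They are not canonical, but the ambiguity lies in what the factors to the left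
  -- annihilate: the image of `d'` for `s`, the kernel of `d` for `σ`.
  obtain ⟨s, hs⟩ := LinearMap.exists_rightInverse_of_surjective
    ((LinearMap.range d').submoduleOf (LinearMap.ker d)).mkQ (Submodule.range_mkQ _)
  obtain ⟨σ, hσ⟩ := LinearMap.exists_rightInverse_of_surjective d.rangeRestrict
    (LinearMap.range_rangeRestrict d)
  have h2 : ∀ l : List (LinearMap.ker d), wedge k (y.map d') *
      wedge k (l.map (LinearMap.ker d).subtype) = wedge k (y.map d') *
      ExteriorAlgebra.map ((LinearMap.ker d).subtype.comp s)
        (wedge k (l.map ((LinearMap.range d').submoduleOf (LinearMap.ker d)).mkQ)) := by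
    intro l
    rw [map_wedge, List.map_map]
    refine mul_wedge_congr (K := LinearMap.range d') (fun v hv => ?_) ?_
    · rw [← hy] at hv
      exact wedge_mul_ι_of_mem_span hv
    · rw [List.forall₂_map_left_iff, List.forall₂_map_right_iff, List.forall₂_same]
      intro v _
      have : ((LinearMap.range d').submoduleOf (LinearMap.ker d)).mkQ
          (v - s (((LinearMap.range d').submoduleOf (LinearMap.ker d)).mkQ v)) = 0 := by
        rw [map_sub, sub_eq_zero]
        exact (LinearMap.congr_fun hs _).symm
      exact Submodule.mkQ_submoduleOf_eq_zero.1 this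
  have h3 : ∀ l : List V, wedge k (y.map d' ++ h.map (LinearMap.ker d).subtype) * wedge k l =
      wedge k (y.map d' ++ h.map (LinearMap.ker d).subtype) *
        ExteriorAlgebra.map σ (wedge k (l.map d.rangeRestrict)) := by
    intro l
    rw [map_wedge, List.map_map]
    refine mul_wedge_congr (K := LinearMap.ker d) (fun v hv => ?_) ?_
    · refine wedge_mul_ι_of_mem_span ?_
      rw [span_list_append, hy, span_list_map]
      -- The kernel of `d` is spanned by the `d'y` and the `h`, because the classes of the `h` span
      -- the cohomology. Hence the product of these vectors annihilates it.
      have h4 : ((LinearMap.range d').submoduleOf (LinearMap.ker d)).mkQ ⟨v, hv⟩ ∈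
          (Submodule.span k {v | v ∈ h}).map
            ((LinearMap.range d').submoduleOf (LinearMap.ker d)).mkQ := by
        rw [← span_list_map, c]
        trivial
      obtain ⟨u, hu, h5⟩ := h4
      rw [← sub_eq_zero, ← map_sub, Submodule.mkQ_submoduleOf_eq_zero] at h5
      have h6 : v = -((u - ⟨v, hv⟩ : LinearMap.ker d) : V) + (u : V) := by simp
      rw [h6]
      exact Submodule.add_mem_sup (neg_mem h5) (Submodule.mem_map_of_mem hu)
    · rw [List.forall₂_map_right_iff, List.forall₂_same]
      intro v _
      have : d.rangeRestrict (v - σ (d.rangeRestrict v)) = 0 := by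
        rw [map_sub, sub_eq_zero]
        exact (LinearMap.congr_fun hσ _).symm
      exact congrArg Subtype.val this
  -- The factors are exchanged from the right: first `x`, then `h`, then `d'y`. Each exchange uses
  -- that the factors to its left are still the original ones.
  rw [wedge_append _ x, h3, hβ, map_smul, mul_smul_comm, ← h3, wedge_append _ (h.map _), h2, hγ,
    map_smul, mul_smul_comm, ← h2, h1, hα, map_smul, ← h1, wedge_append _ x₀, wedge_append]
  simp only [smul_mul_assoc, smul_smul]
  congr 1
  ring

end Adapted

section Adapted

variable {k : Type u} [Field k] {V W : Type w} [AddCommGroup V] [Module k V]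
  [AddCommGroup W] [Module k W] {d : V →ₗ[k] W} {d' : W →ₗ[k] V}

theorem isBasisList_rangeRestrict {l l' : List V} {y : List W}
    (b : IsBasisList k (y.map d' ++ l ++ l'))
    (hy : Submodule.span k {v | v ∈ y.map d'} = LinearMap.range d') :
    IsBasisList k (y.map d'.rangeRestrict) := by
  have h1 : (y.map d'.rangeRestrict).map (LinearMap.range d').subtype = y.map d' := by
    rw [List.map_map]
    rfl
  refine ⟨linearIndependent_list_map (LinearMap.range d').subtype ?_, ?_⟩
  · rw [h1]
    refine linearIndependent_list_sublist ?_ b.1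
    exact (List.sublist_append_left _ _).trans (List.sublist_append_left _ _)
  · refine Submodule.map_injective_of_injective (LinearMap.range d').injective_subtype ?_
    rw [← span_list_map, h1, hy, Submodule.map_top, Submodule.range_subtype]

/-- For spanning, match `d v` by the `dx` and subtract, then match the remaining cohomology class by
the `h`; what is left lies in the span of the `d'y`. The length count is rank-nullity together with
`dim H = dim ker d - dim im d'`. -/
theorem isBasisList_adapted [Module.Finite k V] (hdd' : ∀ v, d (d' v) = 0) {x : List V}
    {y : List W} {h : List (LinearMap.ker d)} (hx : IsBasisList k (x.map d.rangeRestrict))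
    (hy : IsBasisList k (y.map d'.rangeRestrict))
    (c : IsBasisList k (h.map ((LinearMap.range d').submoduleOf (LinearMap.ker d)).mkQ)) :
    IsBasisList k (y.map d' ++ h.map (LinearMap.ker d).subtype ++ x) := by
  have hle : LinearMap.range d' ≤ LinearMap.ker d := by
    rintro _ ⟨v, rfl⟩
    exact hdd' v
  have hy' : Submodule.span k {v | v ∈ y.map d'} = LinearMap.range d' := by
    have h1 : (y.map d'.rangeRestrict).map (LinearMap.range d').subtype = y.map d' := by
      rw [List.map_map]
      rfl
    rw [← h1, span_list_map, hy.2, Submodule.map_top, Submodule.range_subtype]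
  refine IsBasisList.of_span ?_ ?_
  · rw [span_list_append, span_list_append, hy', span_list_map, eq_top_iff]
    intro v _
    have h1 : d.rangeRestrict v ∈ (Submodule.span k {v | v ∈ x}).map d.rangeRestrict := by
      rw [← span_list_map, hx.2]
      trivial
    obtain ⟨u, hu, h2⟩ := h1
    have h3 : v - u ∈ LinearMap.ker d := by
      rw [← sub_eq_zero, ← map_sub] at h2
      have h4 := congrArg Subtype.val h2
      have h5 : d (u - v) = 0 := h4
      rw [LinearMap.mem_ker, ← neg_sub, map_neg, h5, neg_zero]
    have h4 : ((LinearMap.range d').submoduleOf (LinearMap.ker d)).mkQ ⟨v - u, h3⟩ ∈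
        (Submodule.span k {v | v ∈ h}).map
          ((LinearMap.range d').submoduleOf (LinearMap.ker d)).mkQ := by
      rw [← span_list_map, c.2]
      trivial
    obtain ⟨z, hz, h5⟩ := h4
    rw [eq_comm, ← sub_eq_zero, ← map_sub, Submodule.mkQ_submoduleOf_eq_zero] at h5
    have h6 : v = ((⟨v - u, h3⟩ - z : LinearMap.ker d) : V) + (z : V) + u := by simp
    rw [h6]
    exact Submodule.add_mem_sup (Submodule.add_mem_sup h5 (Submodule.mem_map_of_mem hz)) hu
  · have h1 := hx.finrank_eq
    have h2 := hy.finrank_eq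
    have h3 := c.finrank_eq
    have h4 := d.finrank_range_add_finrank_ker
    have h5 := Submodule.finrank_quotient_add_finrank
      ((LinearMap.range d').submoduleOf (LinearMap.ker d))
    have h6 := (Submodule.submoduleOfEquivOfLe hle).finrank_eq
    simp only [List.length_map, List.length_append] at *
    lia

end Adapted

namespace Z2Complex

variable {k : Type u} [Field k] (C : Z2Complex.{u, w} k)

theorem d_d_apply (ε ε' ε'' : ZMod 2) (h : ε' = ε + 1) (h' : ε'' = ε' + 1) (x : C.X ε) :
    C.d ε' ε'' h' (C.d ε ε' h x) = 0 :=
  LinearMap.congr_fun (C.d_comp_d ε ε' ε'' h h') x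

/-- Lists of elements which give adapted bases of the two parts of a `ℤ/2`-graded complex and of
its cohomology. -/
structure AdaptedBasis where
  x : List (C.X 0)
  y : List (C.X 1)
  h : List (C.cycles 0)
  h' : List (C.cycles 1)
  b₀ : IsBasisList k (y.map (C.d 1 0 rfl) ++ h.map (C.cycles 0).subtype ++ x)
  b₁ : IsBasisList k (x.map (C.d 0 1 rfl) ++ h'.map (C.cycles 1).subtype ++ y)
  c₀ : IsBasisList k (h.map (C.toH 0))
  c₁ : IsBasisList k (h'.map (C.toH 1))

theorem nonempty_adaptedBasis [Module.Finite k (C.X 0)] [Module.Finite k (C.X 1)] :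
    Nonempty C.AdaptedBasis := by
  obtain ⟨l₀, hl₀⟩ := IsBasisList.exists_of_finite k (LinearMap.range (C.d 0 1 rfl))
  obtain ⟨l₁, hl₁⟩ := IsBasisList.exists_of_finite k (LinearMap.range (C.d 1 0 rfl))
  obtain ⟨m₀, hm₀⟩ := IsBasisList.exists_of_finite k (C.H 0)
  obtain ⟨m₁, hm₁⟩ := IsBasisList.exists_of_finite k (C.H 1)
  obtain ⟨x, rfl⟩ := IsBasisList.exists_map_eq (l := l₀) (C.d 0 1 rfl).surjective_rangeRestrict
  obtain ⟨y, rfl⟩ := IsBasisList.exists_map_eq (l := l₁) (C.d 1 0 rfl).surjective_rangeRestrict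
  obtain ⟨h, rfl⟩ := IsBasisList.exists_map_eq (l := m₀) (Submodule.mkQ_surjective _)
  obtain ⟨h', rfl⟩ := IsBasisList.exists_map_eq (l := m₁) (Submodule.mkQ_surjective _)
  exact ⟨⟨x, y, h, h', isBasisList_adapted (C.d_d_apply _ _ _ _ _) hl₀ hl₁ hm₀,
    isBasisList_adapted (C.d_d_apply _ _ _ _ _) hl₁ hl₀ hm₁, hm₀, hm₁⟩⟩

/-- Euler characteristic: the lengths of `x` and of `y` occur in both parities and cancel. -/
theorem AdaptedBasis.degree_eq {C : Z2Complex.{u, w} k} (a : C.AdaptedBasis) :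
    C.detLine.degree = C.detH.degree := by
  rw [detLine, detH, GradedLine.detPair_degree a.b₀ a.b₁, GradedLine.detPair_degree a.c₀ a.c₁]
  simp only [List.length_map, List.length_append]
  push_cast
  ring

namespace AdaptedBasis

variable {C} (a a₀ : C.AdaptedBasis)

theorem span_y : Submodule.span k {v | v ∈ a.y.map (C.d 1 0 rfl)} = LinearMap.range (C.d 1 0 rfl) :=
  span_map_eq_range_of_adapted (C.d_d_apply _ _ _ _ _)
    (fun c hc => by
      obtain ⟨c, _, rfl⟩ := List.mem_map.1 hc
      exact c.2) a.b₁

theorem span_x : Submodule.span k {v | v ∈ a.x.map (C.d 0 1 rfl)} = LinearMap.range (C.d 0 1 rfl) :=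
  span_map_eq_range_of_adapted (C.d_d_apply _ _ _ _ _)
    (fun c hc => by
      obtain ⟨c, _, rfl⟩ := List.mem_map.1 hc
      exact c.2) a.b₀

theorem isBasisList_y : IsBasisList k (a.y.map (C.d 1 0 rfl).rangeRestrict) :=
  isBasisList_rangeRestrict a.b₀ a.span_y

theorem isBasisList_x : IsBasisList k (a.x.map (C.d 0 1 rfl).rangeRestrict) :=
  isBasisList_rangeRestrict a.b₁ a.span_x

/-- The scalars `α` and `β` by which the bases of the two images change occur in the even and in the
odd volume element alike, and disappear from the ratio. What remains is the change `γ δ⁻¹` of the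
cohomology bases. -/
theorem exists_smul : ∃ q : k, volPair a.b₀ a.b₁ = q • volPair a₀.b₀ a₀.b₁ ∧
    volPair a.c₀ a.c₁ = q • volPair a₀.c₀ a₀.c₁ := by
  obtain ⟨α, hα, h1⟩ := a.isBasisList_y.exists_wedge_eq_smul a₀.isBasisList_y
  obtain ⟨β, hβ, h2⟩ := a.isBasisList_x.exists_wedge_eq_smul a₀.isBasisList_x
  obtain ⟨γ, hγ, h3⟩ := a.c₀.exists_wedge_eq_smul a₀.c₀
  obtain ⟨δ, hδ, h4⟩ := a.c₁.exists_wedge_eq_smul a₀.c₁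
  have h5 := wedge_adapted a.span_y a.c₀.2 h1 h2 h3
  have h6 := wedge_adapted a.span_x a.c₁.2 h2 h1 h4
  refine ⟨γ * δ⁻¹, ?_, volPair_eq_smul _ _ _ _ hδ h3 h4⟩
  rw [volPair_eq_smul a.b₀ a.b₁ a₀.b₀ a₀.b₁ (mul_ne_zero (mul_ne_zero hβ hδ) hα) h5 h6]
  congr 1
  field_simp

/-- The sign in the definition of the canonical isomorphism. -/
def sign : k :=
  (-1 : k) ^ (a.x.length * (a.y.length + a.h'.length) + a.y.length * a.h.length)

/-- All the lengths involved are dimensions of images and of cohomology spaces, hence independent of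
the choices. -/
theorem sign_eq : a.sign = a₀.sign := by
  have h1 := a.isBasisList_y.finrank_eq.symm.trans a₀.isBasisList_y.finrank_eq
  have h2 := a.isBasisList_x.finrank_eq.symm.trans a₀.isBasisList_x.finrank_eq
  have h3 := a.c₀.finrank_eq.symm.trans a₀.c₀.finrank_eq
  have h4 := a.c₁.finrank_eq.symm.trans a₀.c₁.finrank_eq
  simp only [List.length_map] at h1 h2 h3 h4
  rw [sign, sign, h1, h2, h3, h4]

theorem sign_ne_zero : a.sign ≠ 0 := pow_ne_zero _ (neg_ne_zero.2 one_ne_zero)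

/-- By `exists_smul` and `sign_eq` the rule for one adapted basis implies the rule for all of them;
existence and uniqueness follow at once. -/
theorem isDetCohomologyIso_iff (φ : GradedLine.Iso C.detLine C.detH) :
    C.IsDetCohomologyIso φ ↔ φ.equiv (volPair a.b₀ a.b₁) = a.sign • volPair a.c₀ a.c₁ := by
  refine ⟨fun h => h _ _ _ _ _ _ _ _, fun h x y z z' b₀ b₁ c₀ c₁ => ?_⟩
  let a' : C.AdaptedBasis := ⟨x, y, z, z', b₀, b₁, c₀, c₁⟩
  obtain ⟨q, h1, h2⟩ := a'.exists_smul a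
  change φ.equiv (volPair a'.b₀ a'.b₁) = a'.sign • volPair a'.c₀ a'.c₁
  rw [h1, h2, map_smul, h, a'.sign_eq a, smul_comm]

end AdaptedBasis

theorem exists_isDetCohomologyIso [Module.Finite k (C.X 0)] [Module.Finite k (C.X 1)] :
    ∃ φ, C.IsDetCohomologyIso φ := by
  obtain ⟨a⟩ := C.nonempty_adaptedBasis
  obtain ⟨φ, hφ⟩ := GradedLine.Iso.exists_apply_eq (volPair_ne_zero a.b₀ a.b₁)
    (smul_ne_zero a.sign_ne_zero (volPair_ne_zero a.c₀ a.c₁)) a.degree_eq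
  exact ⟨φ, (a.isDetCohomologyIso_iff φ).2 hφ⟩

variable {C}

theorem IsDetCohomologyIso.unique [Module.Finite k (C.X 0)] [Module.Finite k (C.X 1)]
    {φ φ' : GradedLine.Iso C.detLine C.detH} (h : C.IsDetCohomologyIso φ)
    (h' : C.IsDetCohomologyIso φ') : φ = φ' := by
  obtain ⟨a⟩ := C.nonempty_adaptedBasis
  rw [a.isDetCohomologyIso_iff] at h h'
  exact GradedLine.Iso.ext_of_apply_eq (volPair_ne_zero a.b₀ a.b₁) (h.trans h'.symm)

/-- The canonical isomorphism is natural for isomorphisms of complexes. -/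
theorem IsDetCohomologyIso.natural [Module.Finite k (C.X 0)] [Module.Finite k (C.X 1)]
    {C' : Z2Complex.{u, w} k} {φ : GradedLine.Iso C.detLine C.detH}
    {φ' : GradedLine.Iso C'.detLine C'.detH} (h : C.IsDetCohomologyIso φ)
    (h' : C'.IsDetCohomologyIso φ') (g : ∀ ε, C.X ε ≃ₗ[k] C'.X ε)
    (hg : ∀ ε ε' hε x, g ε' (C.d ε ε' hε x) = C'.d ε ε' hε (g ε x))
    (gH : ∀ ε, C.H ε ≃ₗ[k] C'.H ε)
    (hgH : ∀ ε (c : C.cycles ε) (c' : C'.cycles ε), (c' : C'.X ε) = g ε c →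
      gH ε (C.toH ε c) = C'.toH ε c') :
    φ.trans (GradedLine.Iso.detPair (gH 0) (gH 1)) =
      (GradedLine.Iso.detPair (g 0) (g 1)).trans φ' := by
  obtain ⟨a⟩ := C.nonempty_adaptedBasis
  have hc : ∀ ε, ∀ c ∈ C.cycles ε, g ε c ∈ C'.cycles ε := by
    intro ε c hc
    rw [LinearMap.mem_ker] at hc ⊢
    rw [← hg, hc, map_zero]
  let gc : ∀ ε, C.cycles ε → C'.cycles ε := fun ε c => ⟨g ε c, hc ε c c.2⟩
  have e₀ : (a.y.map (C.d 1 0 rfl) ++ a.h.map (C.cycles 0).subtype ++ a.x).map (g 0) =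
      (a.y.map (g 1)).map (C'.d 1 0 rfl) ++ (a.h.map (gc 0)).map (C'.cycles 0).subtype ++
        a.x.map (g 0) := by
    simp [List.map_append, hg, gc, Function.comp_def]
  have e₁ : (a.x.map (C.d 0 1 rfl) ++ a.h'.map (C.cycles 1).subtype ++ a.y).map (g 1) =
      (a.x.map (g 0)).map (C'.d 0 1 rfl) ++ (a.h'.map (gc 1)).map (C'.cycles 1).subtype ++
        a.y.map (g 1) := by
    simp [List.map_append, hg, gc, Function.comp_def]
  have e₂ : (a.h.map (C.toH 0)).map (gH 0) = (a.h.map (gc 0)).map (C'.toH 0) := by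
    rw [List.map_map, List.map_map]
    exact List.map_congr_left fun c _ => hgH 0 c _ rfl
  have e₃ : (a.h'.map (C.toH 1)).map (gH 1) = (a.h'.map (gc 1)).map (C'.toH 1) := by
    rw [List.map_map, List.map_map]
    exact List.map_congr_left fun c _ => hgH 1 c _ rfl
  -- The image under `g` of an adapted basis is adapted, with the same lengths and hence the same
  -- sign, so both sides can be evaluated on one volume element.
  let a' : C'.AdaptedBasis := ⟨a.x.map (g 0), a.y.map (g 1), a.h.map (gc 0), a.h'.map (gc 1),
    e₀ ▸ a.b₀.map (g 0), e₁ ▸ a.b₁.map (g 1), e₂ ▸ a.c₀.map (gH 0), e₃ ▸ a.c₁.map (gH 1)⟩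
  rw [a.isDetCohomologyIso_iff] at h
  rw [a'.isDetCohomologyIso_iff] at h'
  have hs : a'.sign = a.sign := by simp [AdaptedBasis.sign, a']
  refine GradedLine.Iso.ext_of_apply_eq (volPair_ne_zero a.b₀ a.b₁) ?_
  rw [GradedLine.Iso.trans_equiv_apply, h, map_smul, GradedLine.Iso.detPair_equiv_volPair,
    GradedLine.Iso.trans_equiv_apply, GradedLine.Iso.detPair_equiv_volPair,
    volPair_congr (a.b₀.map (g 0)) (a.b₁.map (g 1)) a'.b₀ a'.b₁ e₀ e₁, h', hs,
    volPair_congr (a.c₀.map (gH 0)) (a.c₁.map (gH 1)) a'.c₀ a'.c₁ e₂ e₃]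

end Z2Complex

namespace DGModule

variable {k : Type u} [Field k] {A : CommDGAlgebra.{u, v} k} (m : DGModule.{u, v, w} A)

/-! ### The filtration by degree -/

theorem deg_le_fil {j : ℕ} {p : ℤ} {ε : ZMod 2} (hp : p ≤ j) (hε : (j : ZMod 2) = ε) :
    m.deg j ≤ m.fil p ε :=
  le_iSup₂_of_le j ⟨hp, hε⟩ le_rfl

theorem fil_le {p : ℤ} {ε : ZMod 2} {P : Submodule k m.carrier}
    (h : ∀ j : ℕ, p ≤ j → (j : ZMod 2) = ε → m.deg j ≤ P) : m.fil p ε ≤ P :=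
  iSup₂_le fun j hj => h j hj.1 hj.2

theorem fil_antitone (ε : ZMod 2) : Antitone fun p => m.fil p ε := fun _ _ hpq =>
  m.fil_le fun _ hj hε => m.deg_le_fil (hpq.trans hj) hε

theorem fil_eq_par {p : ℤ} (hp : p ≤ 0) (ε : ZMod 2) : m.fil p ε = m.par ε :=
  le_antisymm (m.fil_le fun j _ hε => le_iSup₂_of_le j hε le_rfl)
    (iSup₂_le fun j hε => m.deg_le_fil (by lia) hε)

theorem fil_le_par (p : ℤ) (ε : ZMod 2) : m.fil p ε ≤ m.par ε :=
  m.fil_le fun j _ hε => le_iSup₂_of_le j hε le_rfl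

theorem fil_eq_bot {N : ℕ} (hN : ∀ i ≥ N, m.deg i = ⊥) {p : ℤ} (hp : N ≤ p) (ε : ZMod 2) :
    m.fil p ε = ⊥ :=
  eq_bot_iff.2 (m.fil_le fun j hj _ => (hN j (by lia)).le)

/-- Only `𝔪^p` could be lost in this step, and it is absent: either `p` is negative or its parity is
not `ε`. -/
theorem fil_le_fil_succ {p : ℤ} {ε : ZMod 2} (h : p < 0 ∨ (p : ZMod 2) ≠ ε) :
    m.fil p ε ≤ m.fil (p + 1) ε := by
  refine m.fil_le fun j hj hε => m.deg_le_fil ?_ hε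
  rcases hj.lt_or_eq with hj | rfl
  · lia
  · rcases h with h | h
    · lia
    · exact absurd (by simpa using hε) h

theorem fil_natCast (p : ℕ) {ε : ZMod 2} (h : (p : ZMod 2) = ε) :
    m.fil p ε = m.deg p ⊔ m.fil (p + 1) ε := by
  refine le_antisymm (m.fil_le fun j hj hε => ?_)
    (sup_le (m.deg_le_fil le_rfl h) (m.fil_antitone ε (by lia)))
  rcases hj.lt_or_eq with hj | hj
  · exact le_sup_of_le_right (m.deg_le_fil (by lia) hε)
  · obtain rfl : p = j := by exact_mod_cast hj
    exact le_sup_left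

theorem eq_zero_of_mem_deg_of_mem_fil {j : ℕ} {p : ℤ} {ε : ZMod 2} (hp : j < p) {x : m.carrier}
    (hx : x ∈ m.deg j) (hx' : x ∈ m.fil p ε) : x = 0 := by
  have h1 := m.isInternal.submodule_iSupIndep j
  have h2 : m.fil p ε ≤ ⨆ i, ⨆ (_ : i ≠ j), m.deg i :=
    m.fil_le fun i hi _ => le_iSup₂_of_le i (by lia) le_rfl
  exact Submodule.disjoint_def.1 h1 x hx (h2 hx')

variable (t : A.Twist)

theorem d_mem_fil {p : ℤ} {ε ε' : ZMod 2} (hε : ε' = ε + 1) {x : m.carrier} (hx : x ∈ m.fil p ε) :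
    m.d x ∈ m.fil (p + 1) ε' := by
  have : m.fil p ε ≤ (m.fil (p + 1) ε').comap m.d := by
    refine m.fil_le fun j hj hj' x hx => ?_
    exact m.deg_le_fil (by push_cast; lia) (by push_cast; rw [hj', hε]) (m.d_mem hx)
  exact this hx

/-- This is where the bound 3 on the degrees of `t` enters: the twist moves past the range of
filtration visible on `E_2`. -/
theorem twist_smul_mem_fil {p : ℤ} {ε ε' : ZMod 2} (hε : ε' = ε + 1) {x : m.carrier}
    (hx : x ∈ m.fil p ε) : t.val • x ∈ m.fil (p + 3) ε' := by
  have key : ∀ a ∈ ⨆ (i : ℕ) (_ : Odd i ∧ 3 ≤ i), A.deg i,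
      m.fil p ε ≤ (m.fil (p + 3) ε').comap (Algebra.lsmul k k m.carrier a) := by
    intro a ha
    refine m.fil_le fun j hj hj' x hx => ?_
    have h : (⨆ (i : ℕ) (_ : Odd i ∧ 3 ≤ i), A.deg i) ≤
        (m.fil (p + 3) ε').comap ((Algebra.lsmul k k m.carrier).toLinearMap.flip x) := by
      refine iSup₂_le fun i hi a ha => ?_
      refine m.deg_le_fil ?_ ?_ (m.smul_mem ha hx)
      · push_cast
        lia
      · rw [Nat.cast_add, ZMod.natCast_eq_one_iff_odd.2 hi.1, hj', hε, add_comm]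
    exact h ha
  exact key _ t.mem hx

theorem twistedD_mem_fil {p : ℤ} {ε ε' : ZMod 2} (hε : ε' = ε + 1) {x : m.carrier}
    (hx : x ∈ m.fil p ε) : m.twistedD t x ∈ m.fil (p + 1) ε' := by
  rw [twistedD_apply]
  exact add_mem (m.d_mem_fil hε hx)
    (m.fil_antitone ε' (by lia) (m.twist_smul_mem_fil t hε hx))

/-! ### The second page -/

theorem mem_Zt_two_of_mem_cocycles {p : ℕ} {ε : ZMod 2} (h : (p : ZMod 2) = ε) {c : m.carrier}
    (hc : c ∈ m.cocycles p) : c ∈ m.Zt t 2 p ε := by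
  have h1 := m.deg_le_fil (p := p) le_rfl h hc.1
  refine ⟨h1, ?_⟩
  have h2 : m.d c = 0 := hc.2
  change m.twistedD t c ∈ m.fil (p + 2) (ε + 1)
  rw [twistedD_apply, h2, zero_add]
  exact m.fil_antitone _ (by lia) (m.twist_smul_mem_fil t rfl h1)

/-- Since `∂_t` raises the filtration, membership in `Z_1^p` is automatic, and `B_2` needs no
condition on differentials. The index is written `2 - 1` as it appears in the definition of `B_2`.
-/
theorem mem_Zt_one {p : ℤ} {ε : ZMod 2} {x : m.carrier} (hx : x ∈ m.fil p ε) :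
    x ∈ m.Zt t (2 - 1) p ε :=
  ⟨hx, m.fil_antitone _ (by lia) (m.twistedD_mem_fil t rfl hx)⟩

/-- The isomorphism `H^p(𝔪, ∂) ≅ E_2^p`. -/
theorem exists_equiv_Et_two (p : ℕ) {ε : ZMod 2} (h : (p : ZMod 2) = ε) :
    ∃ η : m.H p ≃ₗ[k] m.Et t 2 p ε, ∀ (c : m.cocycles p) (z : m.Zt t 2 p ε),
      (c : m.carrier) = z → η (m.toH p c) = m.toEt t 2 p ε z := by
  have hle : m.cocycles p ≤ m.Zt t 2 p ε := fun _ => m.mem_Zt_two_of_mem_cocycles t h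
  have hε := ZMod.two_eq_add_one_add_one ε
  obtain ⟨η, hη⟩ := exists_equiv_of_ker_eq (m.toH p)
    ((m.toEt t 2 p ε).comp (Submodule.inclusion hle)) (Submodule.mkQ_surjective _) (by
      intro y
      obtain ⟨⟨z, hz⟩, rfl⟩ := FilteredZ2.toE_surjective _ _ _ y
      have hz' := hz.1
      rw [m.fil_natCast p h] at hz'
      obtain ⟨a, ha, b, hb, rfl⟩ := Submodule.mem_sup.1 hz'
      -- There is nothing of parity `ε` in degree `p + 1`.
      have hb' : b ∈ m.fil (p + 2) ε := by
        have := m.fil_le_fil_succ (p := p + 1) (ε := ε) (Or.inr (by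
          subst h; push_cast; simp)) hb
        rwa [add_assoc] at this
      have h1 : m.d a ∈ m.fil (p + 2) (ε + 1) := by
        -- The leading term `a` is a cocycle: `∂a` has degree `p + 1`, yet every term on the right
        -- lies in `F_{p+2}`.
        have h2 : m.d a = m.twistedD t (a + b) - t.val • a - m.twistedD t b := by
          rw [map_add, twistedD_apply _ _ a]
          abel
        rw [h2]
        refine sub_mem (sub_mem hz.2 ?_) ?_
        · exact m.fil_antitone _ (by lia)
            (m.twist_smul_mem_fil t rfl (m.deg_le_fil (p := p) le_rfl h ha))
        · exact m.fil_antitone _ (by lia) (m.twistedD_mem_fil t rfl hb')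
      have h2 : m.d a = 0 :=
        m.eq_zero_of_mem_deg_of_mem_fil (by push_cast; lia) (m.d_mem ha) h1
      refine ⟨⟨a, ha, h2⟩, ?_⟩
      rw [LinearMap.comp_apply, ← sub_eq_zero, ← map_sub, FilteredZ2.toE_eq_zero_iff]
      refine Submodule.mem_sup_left ?_
      have h3 : a - (a + b) = -b := by abel
      change a - (a + b) ∈ _
      rw [h3]
      exact neg_mem (m.mem_Zt_one t hb)) (by
      intro c
      rw [LinearMap.comp_apply, FilteredZ2.toE_eq_zero_iff, Submodule.mkQ_submoduleOf_eq_zero,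
        FilteredZ2.mem_B_iff (p' := p - 2) (by ring) hε]
      change (c : m.carrier) ∈ m.coboundaries p ↔ ∃ y ∈ _, ∃ z ∈ _, (c : m.carrier) = y + _
      constructor
      · intro hc
        cases p with
        | zero =>
          have h1 : (c : m.carrier) = 0 := hc
          exact ⟨0, zero_mem _, 0, zero_mem _, by simp [h1]⟩
        | succ p =>
          obtain ⟨y, hy, h1⟩ := hc
          have hy' : y ∈ m.fil p (ε + 1) :=
            m.deg_le_fil le_rfl (by rw [← h]; push_cast; exact ZMod.two_eq_add_one_add_one _) hy
          -- A coboundary `∂y` equals `∂_t y - t y`, and the second term is far down the filtration.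
          refine ⟨-(t.val • y), neg_mem (m.mem_Zt_one t (m.fil_antitone _ (by push_cast; lia)
            (m.twist_smul_mem_fil t hε hy'))), y,
              m.mem_Zt_one t (m.fil_antitone _ (by push_cast; lia) hy'), ?_⟩
          rw [twistedD_apply, ← h1]
          abel
      · rintro ⟨u, hu, z, hz, h1⟩
        cases p with
        | zero =>
          -- In degree 0 the element `z` starts in `F_{-1}` of odd parity, which is `F_1`. So `c`
          -- lies in `F_1` and in degree 0, hence vanishes.
          have h2 : z ∈ m.fil (0 + 1) (ε + 1) := by
            have h3 := m.fil_le_fil_succ (Or.inl (by norm_num)) hz.1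
            have h4 := m.fil_le_fil_succ (p := 0) (ε := ε + 1) (Or.inr (by
              subst h; simp)) (m.fil_antitone _ (by norm_num) h3)
            exact h4
          refine m.eq_zero_of_mem_deg_of_mem_fil (p := 0 + 1) (ε := ε) (by norm_num) c.2.1 ?_
          rw [h1]
          exact add_mem hu.1 (m.fil_antitone _ (by norm_num) (m.twistedD_mem_fil t hε h2))
        | succ p =>
          have hp : (p : ZMod 2) = ε + 1 := by
            rw [← h]; push_cast; exact ZMod.two_eq_add_one_add_one _
          have hz1 : z ∈ m.fil p (ε + 1) := m.fil_antitone _ (by push_cast; lia) hz.1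
          rw [m.fil_natCast p hp] at hz1
          obtain ⟨a, ha, b, hb, rfl⟩ := Submodule.mem_sup.1 hz1
          refine ⟨a, ha, ?_⟩
          rw [eq_comm, ← sub_eq_zero]
          -- For the leading term `a` of `z`, the difference `c - ∂a` is homogeneous of degree `p +
          -- 1` and lies in `F_{p+2}`, so it is zero.
          refine m.eq_zero_of_mem_deg_of_mem_fil (p := p + 2) (ε := ε) (by push_cast; lia)
            (sub_mem c.2.1 (m.d_mem ha)) ?_
          have h2 : (c : m.carrier) - m.d a = u + t.val • a + m.twistedD t b := by
            rw [h1, map_add, twistedD_apply _ _ a]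
            abel
          rw [h2]
          refine add_mem (add_mem (m.fil_antitone _ (by push_cast; lia) hu.1) ?_) ?_
          · exact m.fil_antitone _ (by lia)
              (m.twist_smul_mem_fil t hε (m.deg_le_fil (p := p) le_rfl hp ha))
          · exact m.fil_antitone _ (by lia) (m.twistedD_mem_fil t hε hb))
  refine ⟨η, fun c z hcz => ?_⟩
  rw [hη]
  exact congrArg (m.toEt t 2 p ε) (Subtype.ext hcz)

/-- If `F_p` is contained in `F_{p+1}`, then `Z_r^p` is contained in `Z_{r-1}^{p+1}`, a summand of
`B_r^p`. -/
theorem subsingleton_Et_of_fil_le {r p : ℤ} {ε : ZMod 2} (h : m.fil p ε ≤ m.fil (p + 1) ε) :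
    Subsingleton (m.Et t r p ε) := by
  refine subsingleton_of_forall_eq 0 fun x => ?_
  obtain ⟨z, rfl⟩ := FilteredZ2.toE_surjective _ _ _ x
  rw [FilteredZ2.toE_eq_zero_iff]
  refine Submodule.mem_sup_left ⟨h z.2.1, ?_⟩
  have h1 : p + 1 + (r - 1) = p + r := by ring
  rw [h1]
  exact z.2.2

theorem subsingleton_Et {r p : ℤ} {ε : ZMod 2} (h : p < 0 ∨ (p : ZMod 2) ≠ ε) :
    Subsingleton (m.Et t r p ε) :=
  m.subsingleton_Et_of_fil_le t (m.fil_le_fil_succ h)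

theorem subsingleton_Et_of_le {N : ℕ} (hN : ∀ i ≥ N, m.deg i = ⊥) {r p : ℤ} (hp : N ≤ p)
    (ε : ZMod 2) : Subsingleton (m.Et t r p ε) :=
  m.subsingleton_Et_of_fil_le t (by rw [m.fil_eq_bot hN hp]; exact bot_le)

/-! ### The limit page -/

variable {N : ℕ} (hN : ∀ i ≥ N, m.deg i = ⊥)
include hN

theorem mem_Zt_iff_of_le {r p : ℤ} (hr : N ≤ p + r) {ε : ZMod 2} {z : m.carrier} :
    z ∈ m.Zt t r p ε ↔ z ∈ m.fil p ε ∧ m.twistedD t z = 0 := by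
  unfold Zt FilteredZ2.Z
  rw [m.fil_eq_bot hN hr]
  rfl

theorem dE_eq_zero_of_le {r : ℤ} (hD : (m.twistedD t).comp (m.twistedD t) = 0) (hr : N ≤ r)
    {p p' : ℤ} {ε ε' : ZMod 2} (hp : p' = p + r) (hε : ε' = ε + 1) :
    FilteredZ2.dE (m.twistedD t) m.fil hD r p p' ε ε' hp hε = 0 := by
  refine LinearMap.ext fun x => ?_
  rcases lt_or_ge p 0 with h0 | h0
  · have := m.subsingleton_Et t (r := r) (ε := ε) (Or.inl h0)
    rw [Subsingleton.elim x 0, map_zero, map_zero]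
  · obtain ⟨z, rfl⟩ := FilteredZ2.toE_surjective _ _ _ x
    rw [LinearMap.zero_apply, FilteredZ2.dE_toE_eq_zero_iff m.fil_antitone]
    have := (m.mem_Zt_iff_of_le t hN (by lia)).1 z.2
    exact ⟨⟨z, (m.mem_Zt_iff_of_le t hN (by lia)).2 this⟩, z.2, rfl⟩

theorem mem_Bt_iff_of_le {r p : ℤ} (hr : N + 1 ≤ r) (h0 : 0 ≤ p) {ε : ZMod 2} {z : m.carrier}
    (hz : z ∈ m.Zt t r p ε) : z ∈ FilteredZ2.B (m.twistedD t) m.fil r p ε ↔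
      ∃ u ∈ m.fil (p + 1) ε, m.twistedD t u = 0 ∧
        ∃ w ∈ m.par (ε + 1), z = u + m.twistedD t w := by
  rw [FilteredZ2.mem_B_iff (p' := p - r) (by ring) (ZMod.two_eq_add_one_add_one ε)]
  constructor
  · rintro ⟨u, hu, w, hw, h⟩
    have hu' := (m.mem_Zt_iff_of_le t hN (by lia)).1 hu
    exact ⟨u, hu'.1, hu'.2, w, m.fil_le_par _ _ hw.1, h⟩
  · rintro ⟨u, hu, hu', w, hw, h⟩
    refine ⟨u, (m.mem_Zt_iff_of_le t hN (by lia)).2 ⟨hu, hu'⟩, ?_⟩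
    rcases lt_or_ge p N with hp | hp
    -- For `p < N` the index `p - r + 1` is at most 0, so the filtration condition on `w` is empty.
    -- For `p ≥ N` both `z` and `u` are zero, and `w` is replaced by 0.
    · refine ⟨w, ⟨by rwa [m.fil_eq_par (by lia)], ?_⟩, h⟩
      have h1 : p - r + 1 + (r - 1) = p := by ring
      rw [h1, ← ZMod.two_eq_add_one_add_one]
      have h2 : m.twistedD t w = z - u := by rw [h]; abel
      change m.twistedD t w ∈ m.fil p ε
      rw [h2]
      exact sub_mem hz.1 (m.fil_antitone _ (by lia) hu)
    · refine ⟨0, zero_mem _, ?_⟩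
      have h2 := m.fil_eq_bot hN hp ε
      have h3 := m.fil_eq_bot hN (show (N : ℤ) ≤ p + 1 by lia) ε
      have h4 := hz.1
      rw [h2] at h4
      rw [h3] at hu
      rw [(Submodule.mem_bot k).1 h4, (Submodule.mem_bot k).1 hu]
      simp

omit hN in
-- Puts membership in `G_p` in the same form as `mem_Bt_iff_of_le`, so that the kernels of the maps
-- to `E_r^p` and to `G_p/G_{p+1}` can be compared.
theorem mem_twistedFil_iff [CharZero k] {ε : ZMod 2} {p : ℕ} {c : (m.twisted t).cycles ε} :
    (m.twisted t).toH ε c ∈ m.twistedFil t ε p ↔ ∃ u ∈ m.fil p ε, m.twistedD t u = 0 ∧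
      ∃ w ∈ m.par (ε + 1), m.twistedCyclesVal t ε c = u + m.twistedD t w := by
  constructor
  · rintro ⟨c', hc', h⟩
    rw [eq_comm, ← sub_eq_zero, ← map_sub, Submodule.mkQ_submoduleOf_eq_zero] at h
    obtain ⟨w, hw⟩ := h
    refine ⟨m.twistedCyclesVal t ε c', hc', congrArg Subtype.val c'.2, w.1, w.2, ?_⟩
    have h1 : m.twistedD t w.1 = m.twistedCyclesVal t ε (c - c') := congrArg Subtype.val hw
    rw [h1, map_sub]
    abel
  · rintro ⟨u, hu, hu', w, hw, h⟩
    refine ⟨⟨⟨u, m.fil_le_par _ _ hu⟩, Subtype.ext hu'⟩, hu, ?_⟩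
    rw [eq_comm, ← sub_eq_zero, ← map_sub, Submodule.mkQ_submoduleOf_eq_zero]
    refine ⟨⟨w, hw⟩, Subtype.ext ?_⟩
    change m.twistedD t w = m.twistedCyclesVal t ε c - u
    rw [h]
    abel

variable [CharZero k]

theorem toEt_eq_zero_iff_of_le {r : ℤ} (hr : N + 1 ≤ r) {p : ℕ} {ε : ZMod 2} (z : m.Zt t r p ε)
    (c : (m.twisted t).cycles ε) (hzc : (z : m.carrier) = m.twistedCyclesVal t ε c) :
    m.toEt t r p ε z = 0 ↔ (m.twisted t).toH ε c ∈ m.twistedFil t ε (p + 1) := by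
  rw [FilteredZ2.toE_eq_zero_iff, m.mem_Bt_iff_of_le t hN hr (by lia) z.2, mem_twistedFil_iff, hzc]
  push_cast
  rfl

omit hN in
theorem twistedFil_antitone (ε : ZMod 2) : Antitone (m.twistedFil t ε) := fun _ _ hpq =>
  Submodule.map_mono (Submodule.comap_mono (m.fil_antitone ε (by exact_mod_cast hpq)))

omit hN in
theorem twistedFil_zero (ε : ZMod 2) : m.twistedFil t ε 0 = ⊤ := by
  refine eq_top_iff.2 fun x _ => ?_
  obtain ⟨c, rfl⟩ := Submodule.mkQ_surjective _ x
  refine ⟨c, ?_, rfl⟩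
  change m.twistedCyclesVal t ε c ∈ m.fil (0 : ℕ) ε
  rw [m.fil_eq_par (by simp)]
  exact c.1.2

theorem twistedFil_eq_bot (ε : ZMod 2) {p : ℕ} (hp : N ≤ p) : m.twistedFil t ε p = ⊥ := by
  refine eq_bot_iff.2 ?_
  rintro _ ⟨c, hc, rfl⟩
  have h1 : m.twistedCyclesVal t ε c ∈ m.fil p ε := hc
  rw [m.fil_eq_bot hN (by exact_mod_cast hp), Submodule.mem_bot] at h1
  have h2 : c = 0 := Subtype.ext (Subtype.ext h1)
  rw [h2, map_zero]
  exact zero_mem _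

/-- The isomorphism `E_∞^p ≅ G_p/G_{p+1}`. -/
theorem exists_equiv_gr {r : ℤ} (hr : N + 1 ≤ r) (p : ℕ) (ε : ZMod 2) :
    ∃ l : m.Et t r p ε ≃ₗ[k]
      (m.twistedFil t ε p ⧸ (m.twistedFil t ε (p + 1)).submoduleOf (m.twistedFil t ε p)),
      ∀ (z : m.Zt t r p ε) (c : (m.twisted t).cycles ε) (g : m.twistedFil t ε p),
        (z : m.carrier) = m.twistedCyclesVal t ε c →
        (g : (m.twisted t).H ε) = (m.twisted t).toH ε c →
        l (m.toEt t r p ε z) = Submodule.Quotient.mk g := by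
  let P := (m.fil p ε).comap (m.twistedCyclesVal t ε)
  have hP : ∀ c ∈ P, m.twistedCyclesVal t ε c ∈ m.Zt t r p ε := fun c hc =>
    (m.mem_Zt_iff_of_le t hN (by lia)).2 ⟨hc, congrArg Subtype.val c.2⟩
  let a : P →ₗ[k] m.Zt t r p ε := (m.twistedCyclesVal t ε).restrict hP
  let b : P →ₗ[k] m.twistedFil t ε p :=
    ((m.twisted t).toH ε).restrict (fun _ hc => Submodule.mem_map_of_mem hc)
  -- Both sides are quotients of the space `P` of closed elements of `F_p`.
  obtain ⟨l, hl⟩ := exists_equiv_of_ker_eq ((m.toEt t r p ε).comp a)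
    (((m.twistedFil t ε (p + 1)).submoduleOf (m.twistedFil t ε p)).mkQ.comp b) (by
      intro x
      obtain ⟨z, rfl⟩ := FilteredZ2.toE_surjective _ _ _ x
      have hz := (m.mem_Zt_iff_of_le t hN (by lia)).1 z.2
      exact ⟨⟨⟨⟨z, m.fil_le_par _ _ hz.1⟩, Subtype.ext hz.2⟩, hz.1⟩, rfl⟩) (by
      intro x
      obtain ⟨⟨_, c, hc, rfl⟩, rfl⟩ := Submodule.mkQ_surjective _ x
      exact ⟨⟨c, hc⟩, rfl⟩) (by
      intro c
      exact (m.toEt_eq_zero_iff_of_le t hN hr (a c) c rfl).trans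
        (Submodule.mkQ_submoduleOf_eq_zero (x := b c)).symm)
  refine ⟨l, fun z c g hzc hgc => ?_⟩
  have hc : c ∈ P := by
    change m.twistedCyclesVal t ε c ∈ m.fil p ε
    rw [← hzc]
    exact z.2.1
  have h1 : z = a ⟨c, hc⟩ := Subtype.ext hzc
  have h2 : g = b ⟨c, hc⟩ := Subtype.ext hgc
  rw [h1, h2]
  exact hl ⟨c, hc⟩

end DGModule

/-! ### Homology of a complex of modules through representatives -/

namespace HomologicalComplex

open CategoryTheory

/-- A description of the homology of a complex of modules as a quotient of a space of
representatives of the cycles. -/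
theorem exists_homologyIso {k : Type u} [Field k] {ι : Type*} {c : ComplexShape ι}
    (K : HomologicalComplex (ModuleCat.{w} k) c) (i j l : ι) (hi : c.prev j = i)
    (hl : c.next j = l) {A Q : Type w} [AddCommGroup A] [Module k A] [AddCommGroup Q] [Module k Q]
    (a : A →ₗ[k] K.X j) (b : A →ₗ[k] Q)
    (ha : ∀ y, (K.d j l).hom y = 0 ↔ ∃ x, a x = y) (hb : Function.Surjective b)
    (hab : ∀ x, b x = 0 ↔ ∃ y, (K.d i j).hom y = a x) :
    ∃ e : K.homology j ≅ ModuleCat.of k Q, ∀ (z : K.cycles j) (x : A),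
      (K.iCycles j).hom z = a x → e.hom.hom ((K.homologyπ j).hom z) = b x := by
  have hi_inj : Function.Injective (K.iCycles j).hom :=
    (ModuleCat.mono_iff_injective _).1 inferInstance
  have hπ : Function.Surjective (K.homologyπ j).hom :=
    (ModuleCat.epi_iff_surjective _).1 inferInstance
  let α : ModuleCat.of k A ⟶ K.cycles j := K.liftCycles (ModuleCat.ofHom a) l hl (by
    refine ModuleCat.hom_ext (LinearMap.ext fun x => ?_)
    exact (ha _).2 ⟨x, rfl⟩)
  have hα : ∀ x, (K.iCycles j).hom (α.hom x) = a x := fun x =>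
    LinearMap.congr_fun (congrArg ModuleCat.Hom.hom (K.liftCycles_i (ModuleCat.ofHom a) l hl _)) x
  -- Exactness says that a cycle with zero homology class comes from `toCycles`, which turns the
  -- abstract homology into the kernel comparison with `b`.
  have hex := (ShortComplex.mk _ _ (K.toCycles_comp_homologyπ i j)).exact_of_g_is_cokernel
    (K.homologyIsCokernel i j hi)
  rw [ShortComplex.moduleCat_exact_iff] at hex
  obtain ⟨e, he⟩ := exists_equiv_of_ker_eq ((K.homologyπ j).hom.comp α.hom) b
    (by
      intro y
      obtain ⟨z, rfl⟩ := hπ y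
      have h1 : (K.d j l).hom ((K.iCycles j).hom z) = 0 :=
        LinearMap.congr_fun (congrArg ModuleCat.Hom.hom (K.iCycles_d j l)) z
      obtain ⟨x, hx⟩ := (ha _).1 h1
      refine ⟨x, congrArg (K.homologyπ j).hom (hi_inj ?_)⟩
      rw [← hx]
      exact hα x) hb (by
      intro x
      rw [hab]
      constructor
      · intro h
        obtain ⟨y, hy⟩ := hex _ h
        refine ⟨y, ?_⟩
        rw [← hα x]
        refine Eq.trans ?_ (congrArg (K.iCycles j).hom hy)
        exact (LinearMap.congr_fun (congrArg ModuleCat.Hom.hom (K.toCycles_i i j)) y).symm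
      · rintro ⟨y, hy⟩
        have h1 : α.hom x = (K.toCycles i j).hom y := by
          refine hi_inj ?_
          rw [hα, ← hy]
          exact (LinearMap.congr_fun (congrArg ModuleCat.Hom.hom (K.toCycles_i i j)) y).symm
        rw [LinearMap.comp_apply, h1]
        exact LinearMap.congr_fun (congrArg ModuleCat.Hom.hom (K.toCycles_comp_homologyπ i j)) y)
  refine ⟨e.toModuleIso, fun z x hzx => ?_⟩
  have h1 : z = α.hom x := hi_inj (hzx.trans (hα x).symm)
  rw [h1]
  exact he x

end HomologicalComplex

/-! ### The spectral sequence -/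

namespace DGModule

open CategoryTheory

variable {k : Type u} [Field k] {A : CommDGAlgebra.{u, v} k} (m : DGModule.{u, v, w} A)
  (t : A.Twist) [CharZero k]

theorem parity_eq {r p q p' q' : ℤ} (hp : p' = p + r) (hq : q' = q + (1 - r)) :
    ((p' + q' : ℤ) : ZMod 2) = ((p + q : ℤ) : ZMod 2) + 1 := by
  subst hp hq
  push_cast
  ring

/-- The page `E_r` of the spectral sequence. -/
def spectralPage (r : ℤ) :
    HomologicalComplex (ModuleCat.{w} k) (ComplexShape.up' (⟨r, 1 - r⟩ : ℤ × ℤ)) where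
  X pq := ModuleCat.of k (m.Et t r pq.1 ((pq.1 + pq.2 : ℤ) : ZMod 2))
  -- The case distinction carries the index equations as hypotheses of `dE`, so that no transport
  -- between terms with equal indices is needed.
  d pq pq' := if h : pq'.1 = pq.1 + r ∧ pq'.2 = pq.2 + (1 - r) then
      ModuleCat.ofHom (FilteredZ2.dE (m.twistedD t) m.fil (m.twistedD_comp_twistedD t) r pq.1 pq'.1
        ((pq.1 + pq.2 : ℤ) : ZMod 2) ((pq'.1 + pq'.2 : ℤ) : ZMod 2) h.1 (parity_eq h.1 h.2))
    else 0
  shape pq pq' h := dif_neg fun h' => h (Prod.ext h'.1.symm h'.2.symm)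
  d_comp_d' pq pq' pq'' h h' := by
    have e1 : pq'.1 = pq.1 + r := (congrArg Prod.fst h).symm
    have e2 : pq'.2 = pq.2 + (1 - r) := (congrArg Prod.snd h).symm
    have e3 : pq''.1 = pq'.1 + r := (congrArg Prod.fst h').symm
    have e4 : pq''.2 = pq'.2 + (1 - r) := (congrArg Prod.snd h').symm
    rw [dif_pos ⟨e1, e2⟩, dif_pos ⟨e3, e4⟩]
    refine ModuleCat.hom_ext (LinearMap.ext fun x => ?_)
    obtain ⟨z, rfl⟩ := FilteredZ2.toE_surjective _ _ _ x
    refine (FilteredZ2.toE_eq_zero_iff _).2 ?_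
    change m.twistedD t (m.twistedD t z) ∈ _
    rw [show m.twistedD t (m.twistedD t z) = 0 from
      LinearMap.congr_fun (m.twistedD_comp_twistedD t) z]
    exact zero_mem _

theorem spectralPage_d (r p q p' q' : ℤ) (hp : p' = p + r) (hq : q' = q + (1 - r))
    (x : m.Et t r p ((p + q : ℤ) : ZMod 2)) :
    ((m.spectralPage t r).d (p, q) (p', q')).hom x =
      FilteredZ2.dE (m.twistedD t) m.fil (m.twistedD_comp_twistedD t) r p p'
        ((p + q : ℤ) : ZMod 2) ((p' + q' : ℤ) : ZMod 2) hp (parity_eq hp hq) x := by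
  have h : (m.spectralPage t r).d (p, q) (p', q') = ModuleCat.ofHom
      (FilteredZ2.dE (m.twistedD t) m.fil (m.twistedD_comp_twistedD t) r p p'
        ((p + q : ℤ) : ZMod 2) ((p' + q' : ℤ) : ZMod 2) hp (parity_eq hp hq)) := dif_pos ⟨hp, hq⟩
  rw [h]
  rfl

theorem spectralPage_d_toEt_eq_zero_iff (r p q : ℤ) (y : m.Et t r p ((p + q : ℤ) : ZMod 2)) :
    ((m.spectralPage t r).d (p, q) (p + r, q + (1 - r))).hom y = 0 ↔
      ∃ z : m.Zt t (r + 1) p ((p + q : ℤ) : ZMod 2), (m.toEt t r p ((p + q : ℤ) : ZMod 2)).comp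
        (Submodule.inclusion (FilteredZ2.Z_succ_le m.fil_antitone r p _)) z = y := by
  obtain ⟨z, rfl⟩ := FilteredZ2.toE_surjective _ _ _ y
  rw [m.spectralPage_d t r p q (p + r) (q + (1 - r)) rfl rfl]
  refine (FilteredZ2.dE_toE_eq_zero_iff m.fil_antitone _ rfl (parity_eq rfl rfl) z).trans ?_
  exact ⟨fun ⟨z', _, h⟩ => ⟨z', h⟩, fun ⟨z', h⟩ =>
    ⟨z', FilteredZ2.Z_succ_le m.fil_antitone r p _ z'.2, h⟩⟩

theorem toEt_succ_eq_zero_iff (r p q p' q' : ℤ) (hp : p = p' + r) (hq : q = q' + (1 - r))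
    (z : m.Zt t (r + 1) p ((p + q : ℤ) : ZMod 2)) :
    m.toEt t (r + 1) p ((p + q : ℤ) : ZMod 2) z = 0 ↔
      ∃ y : m.Et t r p' ((p' + q' : ℤ) : ZMod 2),
      ((m.spectralPage t r).d (p', q') (p, q)).hom y =
        (m.toEt t r p ((p + q : ℤ) : ZMod 2)).comp
          (Submodule.inclusion (FilteredZ2.Z_succ_le m.fil_antitone r p _)) z := by
  refine (FilteredZ2.toE_succ_eq_zero_iff m.fil_antitone (m.twistedD_comp_twistedD t) hp
    (parity_eq hp hq) z (FilteredZ2.Z_succ_le m.fil_antitone r p _ z.2)).trans ?_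
  refine exists_congr fun y => ?_
  rw [m.spectralPage_d t r p' q' p q hp hq]
  rfl

theorem exists_spectralPage_iso (r p q : ℤ) :
    ∃ e : (m.spectralPage t r).homology (p, q) ≅ (m.spectralPage t (r + 1)).X (p, q),
      ∀ (z' : m.Zt t (r + 1) p ((p + q : ℤ) : ZMod 2)) (z : m.Zt t r p ((p + q : ℤ) : ZMod 2))
        (c : (m.spectralPage t r).cycles (p, q)), (z' : m.carrier) = z →
        ((m.spectralPage t r).iCycles (p, q)).hom c = m.toEt t r p _ z →
        e.hom.hom (((m.spectralPage t r).homologyπ (p, q)).hom c) = m.toEt t (r + 1) p _ z' := by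
  obtain ⟨e, he⟩ := (m.spectralPage t r).exists_homologyIso (p - r, q - (1 - r)) (p, q)
    (p + r, q + (1 - r)) (ComplexShape.prev_eq' _ (Prod.ext (sub_add_cancel p r)
      (sub_add_cancel q (1 - r)))) (ComplexShape.next_eq' _ rfl)
    (A := m.Zt t (r + 1) p ((p + q : ℤ) : ZMod 2))
    (Q := m.Et t (r + 1) p ((p + q : ℤ) : ZMod 2))
    ((m.toEt t r p ((p + q : ℤ) : ZMod 2)).comp
      (Submodule.inclusion (FilteredZ2.Z_succ_le m.fil_antitone r p _)))
    (m.toEt t (r + 1) p ((p + q : ℤ) : ZMod 2)) (m.spectralPage_d_toEt_eq_zero_iff t r p q)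
    (FilteredZ2.toE_surjective _ _ _) (m.toEt_succ_eq_zero_iff t r p q (p - r) (q - (1 - r))
      (sub_add_cancel p r).symm (sub_add_cancel q (1 - r)).symm)
  refine ⟨e, fun z' z c hzz hc => he c z' (hc.trans ?_)⟩
  exact (FilteredZ2.toE_comp_inclusion m.fil_antitone z' z hzz).symm

/-- The spectral sequence of the filtered complex `(𝔪, ∂_t)`. -/
def spectralSequence : E₂CohomologicalSpectralSequence (ModuleCat.{w} k) where
  page r _ := m.spectralPage t r
  iso r r' pq h _ := (m.exists_spectralPage_iso t r pq.1 pq.2).choose ≪≫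
    eqToIso (by rw [h])

theorem isSpectralSequence_spectralSequence : m.IsSpectralSequence t (m.spectralSequence t)
    (fun r _ p q => LinearEquiv.refl k (m.Et t r p ((p + q : ℤ) : ZMod 2))) where
  d_eq r _ p q x := m.spectralPage_d t r p q _ _ rfl rfl x
  iso_eq r hr p q z' z c hz hc := by
    have h := (m.exists_spectralPage_iso t r p q).choose_spec z' z c hz hc
    -- When the second index is literally `r + 1`, the correcting `eqToIso` is an identity.
    have h1 : (m.spectralSequence t).iso r (r + 1) (p, q) rfl hr =
        (m.exists_spectralPage_iso t r p q).choose :=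
      Iso.ext (Category.comp_id _)
    rw [h1]
    exact h

end DGModule

/-! ### Bases of direct sums -/

section Lists

/-- Bases are lists in different subtypes that represent the same vectors of `𝔪`; this transfers an
equality of representatives to one of classes. -/
theorem List.map_eq_map_of_map_eq_map {α β γ δ : Type*} {a : α → γ} {b : β → γ} {f : α → δ}
    {g : β → δ} (h : ∀ x y, a x = b y → f x = g y) {l : List α} {l' : List β}
    (hl : l.map a = l'.map b) : l.map f = l'.map g := by
  induction l generalizing l' with
  | nil =>
    cases l' with
    | nil => rfl
    | cons y l' => simp at hl
  | cons x l ih =>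
    cases l' with
    | nil => simp at hl
    | cons y l' =>
      simp only [List.map_cons, List.cons.injEq] at hl ⊢
      exact ⟨h _ _ hl.1, ih hl.2⟩

theorem List.length_flatMap_range {α : Type*} (f : ℕ → List α) (N : ℕ) :
    ((List.range N).flatMap f).length = ∑ i ∈ Finset.range N, (f i).length := by
  induction N with
  | zero => rfl
  | succ N ih => rw [List.range_succ, List.flatMap_append, List.length_append, ih,
      Finset.sum_range_succ]; simp

variable {k : Type u} [Field k]

theorem wedge_flatMap_range_eq_smul {V : Type*} [AddCommGroup V] [Module k V] {f g : ℕ → List V}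
    {a : ℕ → k} {N : ℕ} (h : ∀ i < N, wedge k (f i) = a i • wedge k (g i)) :
    wedge k ((List.range N).flatMap f) =
      (∏ i ∈ Finset.range N, a i) • wedge k ((List.range N).flatMap g) := by
  induction N with
  | zero => simp
  | succ N ih =>
    rw [List.range_succ, List.flatMap_append, List.flatMap_append, wedge_append, wedge_append,
      ih fun i hi => h i (by lia), Finset.prod_range_succ, List.flatMap_singleton,
      List.flatMap_singleton, h N (by lia), smul_mul_smul_comm]

variable {E : ℤ → Type w} [∀ p, AddCommGroup (E p)] [∀ p, Module k (E p)]

theorem isBasisList_of_flatMap_lof {N : ℕ} {l : ∀ i : ℕ, List (E i)}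
    (h : IsBasisList k ((List.range N).flatMap fun i => (l i).map (DirectSum.lof k ℤ E i)))
    {i : ℕ} (hi : i < N) : IsBasisList k (l i) := by
  have hi' := List.mem_range.2 hi
  constructor
  · refine linearIndependent_list_map (DirectSum.lof k ℤ E i) ?_
    refine linearIndependent_list_sublist ?_ h.1
    exact List.sublist_flatten_of_mem
      (List.mem_map_of_mem (f := fun i : ℕ => (l i).map (DirectSum.lof k ℤ E i)) hi')
  · have h1 : Function.Surjective (DirectSum.component k ℤ E i) := fun x =>
      ⟨DirectSum.lof k ℤ E i x, DirectSum.component.lof_self _ _ _⟩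
    rw [eq_top_iff, ← LinearMap.range_eq_top.2 h1, LinearMap.range_eq_map, ← h.2,
      Submodule.map_span_le]
    intro x hx
    obtain ⟨j, _, hx⟩ := List.mem_flatMap.1 hx
    obtain ⟨y, hy, rfl⟩ := List.mem_map.1 hx
    by_cases hij : j = i
    · subst hij
      rw [DirectSum.component.lof_self]
      exact Submodule.subset_span hy
    · rw [DirectSum.component.of, dif_neg (by exact_mod_cast hij)]
      exact zero_mem _

/-- Spanning holds because all summands outside `[0, N)` vanish. The length bound comes from the
injection of the finite product of the remaining summands into the direct sum. -/
theorem isBasisList_flatMap_lof {N : ℕ} {l : ∀ i : ℕ, List (E i)}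
    (hE : ∀ p : ℤ, p < 0 ∨ (N : ℤ) ≤ p → Subsingleton (E p)) (h : ∀ i < N, IsBasisList k (l i)) :
    IsBasisList k ((List.range N).flatMap fun i => (l i).map (DirectSum.lof k ℤ E i)) := by
  classical
  have hs : Submodule.span k {x | x ∈ (List.range N).flatMap
      fun i => (l i).map (DirectSum.lof k ℤ E i)} = ⊤ := by
    rw [eq_top_iff]
    intro x _
    rw [← DirectSum.sum_support_of x]
    refine sum_mem fun p _ => ?_
    by_cases hp : p < 0 ∨ N ≤ p
    · have := hE p hp
      rw [Subsingleton.elim (x p) 0, map_zero]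
      exact zero_mem _
    · push Not at hp
      lift p to ℕ using hp.1
      have hpN : p < N := by exact_mod_cast hp.2
      rw [span_list_flatMap]
      refine Submodule.mem_iSup_of_mem p (Submodule.mem_iSup_of_mem (List.mem_range.2 hpN) ?_)
      rw [span_list_map, (h p hpN).2]
      exact ⟨x p, trivial, rfl⟩
  refine IsBasisList.of_span hs ?_
  have := finite_of_span_list hs
  have hfin : ∀ i : Fin N, Module.Finite k (E (i : ℕ)) := fun i => (h i i.2).finite
  let T : (∀ i : Fin N, E (i : ℕ)) →ₗ[k] ⨁ p, E p :=
    ∑ i : Fin N, (DirectSum.lof k ℤ E (i : ℕ)).comp (LinearMap.proj i)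
  have hT : Function.Injective T := by
    rw [injective_iff_map_eq_zero]
    intro x hx
    ext i
    have h1 := congrArg (DirectSum.component k ℤ E (i : ℕ)) hx
    simp only [T, LinearMap.sum_apply, LinearMap.comp_apply, LinearMap.proj_apply, map_sum,
      map_zero] at h1
    rw [Finset.sum_eq_single i, DirectSum.component.lof_self] at h1
    · exact h1
    · intro j _ hj
      rw [DirectSum.component.of, dif_neg]
      simpa [Fin.ext_iff] using hj
    · simp
  have h1 := LinearMap.finrank_le_finrank_of_injective hT
  rw [Module.finrank_pi_fintype] at h1
  rw [List.length_flatMap_range, Finset.sum_range]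
  refine le_trans (le_of_eq (Finset.sum_congr rfl fun i _ => ?_)) h1
  rw [List.length_map, (h i i.2).finrank_eq]

end Lists

namespace GradedLine

variable {k : Type u} [Field k]

theorem signElt_smul {L : GradedLine.{u, w} k} {x : L.carrier} (hx : x ≠ 0) {a : k} (ha : a ≠ 0)
    (s : Bool) : L.signElt (a • x) s = (if s then a⁻¹ else a) • L.signElt x s := by
  cases s
  · rfl
  · exact recip_smul hx ha

theorem signPow_degree (L : GradedLine.{u, w} k) (s : Bool) :
    (L.signPow s).degree = if s then -L.degree else L.degree := by
  cases s <;> rfl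

end GradedLine

/-! ### The determinant of the second page -/

namespace DGModule

variable {k : Type u} [Field k] {A : CommDGAlgebra.{u, v} k} (m : DGModule.{u, v, w} A)
  (t : A.Twist) [CharZero k]

theorem isBasisList_pageT_iff {N : ℕ} (hN : ∀ i ≥ N, m.deg i = ⊥) {r : ℤ} {ε : ZMod 2}
    {z : ∀ i : ℕ, List (m.Zt t r i ε)} :
    IsBasisList k ((List.range N).flatMap fun i => (z i).map (m.toPageT t r i ε)) ↔
      ∀ i < N, IsBasisList k ((z i).map (m.toEt t r i ε)) := by
  have h : ((List.range N).flatMap fun i => (z i).map (m.toPageT t r i ε)) =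
      (List.range N).flatMap fun i => ((z i).map (m.toEt t r i ε)).map
        (DirectSum.lof k ℤ (fun p => m.Et t r p ε) i) := by
    simp only [List.map_map]
    rfl
  constructor
  · intro h1 i hi
    rw [h] at h1
    exact isBasisList_of_flatMap_lof (E := fun p => m.Et t r p ε) h1 hi
  · intro h1
    rw [h]
    refine isBasisList_flatMap_lof (E := fun p => m.Et t r p ε) (fun p hp => ?_) h1
    rcases hp with hp | hp
    · exact m.subsingleton_Et t (Or.inl hp)
    · exact m.subsingleton_Et_of_le t hN hp ε

/-- Representatives of ordered bases of the cohomology and the corresponding bases of the second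
page. -/
structure SecondPageBasis (N : ℕ) where
  c : ∀ i : ℕ, List (m.cocycles i)
  z : ∀ (ε : ZMod 2) (i : ℕ), List (m.Zt t 2 i ε)
  hz : ∀ ε i, (z ε i).map (m.Zt t 2 i ε).subtype =
    if (i : ZMod 2) = ε then (c i).map (m.cocycles i).subtype else []
  hc : ∀ i, IsBasisList k ((c i).map (m.toH i))
  b : ∀ ε, IsBasisList k ((List.range N).flatMap fun i => (z ε i).map (m.toPageT t 2 i ε))

theorem nonempty_secondPageBasis {N : ℕ} (hN : ∀ i ≥ N, m.deg i = ⊥)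
    (hfin : ∀ i, Module.Finite k (m.H i)) : Nonempty (m.SecondPageBasis t N) := by
  have h1 : ∀ i, ∃ c : List (m.cocycles i), IsBasisList k (c.map (m.toH i)) := by
    intro i
    obtain ⟨l, hl⟩ := IsBasisList.exists_of_finite k (m.H i)
    obtain ⟨c, rfl⟩ := IsBasisList.exists_map_eq (l := l)
      (Submodule.mkQ_surjective ((m.coboundaries i).submoduleOf (m.cocycles i)))
    exact ⟨c, hl⟩
  choose c hc using h1
  -- Only the parity of `i` contributes; the list is empty in the other one, where `E_2^i` is zero.
  let z : ∀ (ε : ZMod 2) (i : ℕ), List (m.Zt t 2 i ε) := fun ε i =>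
    if h : (i : ZMod 2) = ε then
      (c i).map (Submodule.inclusion fun _ => m.mem_Zt_two_of_mem_cocycles t h) else []
  have hz : ∀ ε i, (z ε i).map (m.Zt t 2 i ε).subtype =
      if (i : ZMod 2) = ε then (c i).map (m.cocycles i).subtype else [] := by
    intro ε i
    by_cases h : (i : ZMod 2) = ε
    · simp only [z, dif_pos h, if_pos h, List.map_map]
      rfl
    · simp only [z, dif_neg h, if_neg h, List.map_nil]
  refine ⟨⟨c, z, hz, hc, fun ε => (m.isBasisList_pageT_iff t hN).2 fun i _ => ?_⟩⟩
  have hzi := hz ε i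
  by_cases h : (i : ZMod 2) = ε
  · obtain ⟨η, hη⟩ := m.exists_equiv_Et_two t i h
    rw [if_pos h] at hzi
    have h2 : (z ε i).map (m.toEt t 2 i ε) = ((c i).map (m.toH i)).map η := by
      rw [List.map_map]
      exact List.map_eq_map_of_map_eq_map (fun x y hxy => (hη y x hxy.symm).symm) hzi
    rw [h2]
    exact (hc i).map η
  · rw [if_neg h, List.map_eq_nil_iff] at hzi
    have := m.subsingleton_Et t (r := 2) (p := i) (ε := ε) (Or.inr (by simpa using h))
    rw [hzi]
    exact IsBasisList.of_span (Subsingleton.elim _ _) (by simp)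

namespace SecondPageBasis

variable {m t} {N : ℕ} (a a₀ : m.SecondPageBasis t N)

theorem length_z (ε : ZMod 2) (i : ℕ) :
    (a.z ε i).length = if (i : ZMod 2) = ε then (a.c i).length else 0 := by
  have := congrArg List.length (a.hz ε i)
  rw [List.length_map] at this
  rw [this]
  split_ifs <;> simp

/-- The image of the product of the basis of the cohomology in the determinant line. -/
def elt : (m.detH N).carrier :=
  GradedLine.prodElt (fun i => (GradedLine.det k (m.H i)).signPow i.bodd)
    (fun i => (GradedLine.det k (m.H i)).signElt (vol (a.hc i)) i.bodd) N

theorem elt_ne_zero : a.elt ≠ 0 :=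
  GradedLine.prodElt_ne_zero (fun _ => GradedLine.signElt_ne_zero (vol_ne_zero _) _) N

/-- The sign in the definition of the isomorphism with the determinant of the second page. -/
def sign : k :=
  (-1 : k) ^ (∑ j ∈ Finset.range N, ∑ i ∈ Finset.range j,
        if Odd i then (a.c i).length * (a.c j).length else 0)

theorem sign_ne_zero : a.sign ≠ 0 := pow_ne_zero _ (neg_ne_zero.2 one_ne_zero)

theorem length_c (i : ℕ) : (a.c i).length = Module.finrank k (m.H i) := by
  rw [(a.hc i).finrank_eq, List.length_map]

theorem sign_eq : a.sign = a₀.sign := by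
  simp only [sign, length_c]

theorem bodd_eq_true_iff (i : ℕ) : i.bodd = true ↔ (i : ZMod 2) = 1 := by
  rw [ZMod.natCast_eq_one_iff_odd, ← Nat.not_even_iff_odd, Nat.even_iff, Nat.mod_two_of_bodd]
  cases i.bodd <;> simp

theorem natCast_eq_zero_iff (i : ℕ) : (i : ZMod 2) = 0 ↔ i.bodd = false := by
  rw [ZMod.natCast_eq_zero_iff_even, Nat.even_iff, Nat.mod_two_of_bodd]
  cases i.bodd <;> simp

include a in
theorem degree_eq : (m.detH N).degree = (m.pageT t 2).detLine.degree := by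
  rw [Z2Complex.detLine, GradedLine.detPair_degree (a.b 0) (a.b 1), List.length_flatMap_range,
    List.length_flatMap_range, detH, GradedLine.prod_degree]
  push_cast
  rw [← Finset.sum_sub_distrib]
  refine Finset.sum_congr rfl fun i _ => ?_
  rw [GradedLine.signPow_degree, List.length_map, List.length_map, length_z, length_z, length_c]
  simp only [natCast_eq_zero_iff, ← bodd_eq_true_iff]
  cases i.bodd <;> simp [GradedLine.det]

/-- If the volume of `H^i` is multiplied by `d i`, then both elements are multiplied by the product
of the `d i` over even `i` and of the `(d i)⁻¹` over odd `i`. -/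
theorem exists_smul : ∃ q : k, a.elt = q • a₀.elt ∧
    volPair (a.b 0) (a.b 1) = q • volPair (a₀.b 0) (a₀.b 1) := by
  have h1 := fun i => (a.hc i).exists_vol_eq_smul (a₀.hc i)
  choose d hd hvol using h1
  have key : ∀ ε, wedge k ((List.range N).flatMap fun i => (a.z ε i).map (m.toPageT t 2 i ε)) =
      (∏ i ∈ Finset.range N, if (i : ZMod 2) = ε then d i else 1) •
        wedge k ((List.range N).flatMap fun i => (a₀.z ε i).map (m.toPageT t 2 i ε)) := by
    intro ε
    refine wedge_flatMap_range_eq_smul fun i _ => ?_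
    have hz := a.hz ε i
    have hz₀ := a₀.hz ε i
    by_cases h : (i : ZMod 2) = ε
    · obtain ⟨η, hη⟩ := m.exists_equiv_Et_two t i h
      rw [if_pos h] at hz hz₀ ⊢
      let s : m.H i →ₗ[k] (m.pageT t 2).X ε :=
        (DirectSum.lof k ℤ (fun p => m.Et t 2 p ε) i).comp η.toLinearMap
      have h2 : ∀ (c : List (m.cocycles i)) (z : List (m.Zt t 2 i ε)),
          z.map (m.Zt t 2 i ε).subtype = c.map (m.cocycles i).subtype →
          z.map (m.toPageT t 2 i ε) = (c.map (m.toH i)).map s := by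
        intro c z h
        rw [List.map_map]
        exact List.map_eq_map_of_map_eq_map (fun x y hxy =>
          congrArg (DirectSum.lof k ℤ (fun p => m.Et t 2 p ε) i) (hη y x hxy.symm).symm) h
      rw [h2 _ _ hz, h2 _ _ hz₀, ← map_wedge s, ← map_wedge s,
        (vol_eq_smul_iff _ _).1 (hvol i), map_smul]
    · rw [if_neg h, List.map_eq_nil_iff] at hz hz₀
      rw [hz, hz₀, if_neg h, one_smul]
  refine ⟨∏ i ∈ Finset.range N, if i.bodd then (d i)⁻¹ else d i, ?_, ?_⟩
  · have h2 : a.elt = GradedLine.prodElt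
        (fun i => (GradedLine.det k (m.H i)).signPow i.bodd)
        (fun i => (if i.bodd then (d i)⁻¹ else d i) •
          (GradedLine.det k (m.H i)).signElt (vol (a₀.hc i)) i.bodd) N := by
      unfold elt
      congr 1
      funext i
      rw [hvol, GradedLine.signElt_smul (vol_ne_zero _) (hd i)]
    rw [h2, GradedLine.prodElt_smul]
    rfl
  · have h0 : (∏ i ∈ Finset.range N, if (i : ZMod 2) = 1 then d i else 1) ≠ 0 :=
      Finset.prod_ne_zero_iff.2 fun i _ => by split_ifs <;> simp [hd i]
    rw [volPair_eq_smul (a.b 0) (a.b 1) (a₀.b 0) (a₀.b 1) h0 (key 0) (key 1),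
      ← Finset.prod_inv_distrib, ← Finset.prod_mul_distrib]
    congr 1
    refine Finset.prod_congr rfl fun i _ => ?_
    simp only [natCast_eq_zero_iff, ← bodd_eq_true_iff]
    cases i.bodd <;> simp

theorem isDetSecondPageIso_iff (φ : GradedLine.Iso (m.detH N) (m.pageT t 2).detLine) :
    m.IsDetSecondPageIso t N φ ↔ φ.equiv a.elt = a.sign • volPair (a.b 0) (a.b 1) := by
  refine ⟨fun h => h a.c a.z a.hz a.hc a.b, fun h c z hz hc b => ?_⟩
  let a' : m.SecondPageBasis t N := ⟨c, z, hz, hc, b⟩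
  obtain ⟨q, h1, h2⟩ := a'.exists_smul a
  change φ.equiv a'.elt = a'.sign • volPair (a'.b 0) (a'.b 1)
  rw [h1, h2, map_smul, h, a'.sign_eq a, smul_comm]

include a in
theorem exists_isDetSecondPageIso : ∃ φ, m.IsDetSecondPageIso t N φ := by
  obtain ⟨φ, hφ⟩ := GradedLine.Iso.exists_apply_eq a.elt_ne_zero
    (smul_ne_zero a.sign_ne_zero (volPair_ne_zero (a.b 0) (a.b 1))) a.degree_eq
  exact ⟨φ, (a.isDetSecondPageIso_iff φ).2 hφ⟩

include a in
theorem isDetSecondPageIso_unique {φ φ' : GradedLine.Iso (m.detH N) (m.pageT t 2).detLine}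
    (h : m.IsDetSecondPageIso t N φ) (h' : m.IsDetSecondPageIso t N φ') : φ = φ' := by
  rw [a.isDetSecondPageIso_iff] at h h'
  exact GradedLine.Iso.ext_of_apply_eq a.elt_ne_zero (h.trans h'.symm)

end SecondPageBasis

end DGModule

/-! ### The determinant of the limit page -/

namespace DGModule

variable {k : Type u} [Field k] {A : CommDGAlgebra.{u, v} k} (m : DGModule.{u, v, w} A)
  (t : A.Twist) [CharZero k] {N : ℕ} (hN : ∀ i ≥ N, m.deg i = ⊥) {r : ℤ} (hr : N + 1 ≤ r)

/-- For `r` large, the elements of `Z_r^i` are closed. -/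
def ZtToCycles (i : ℕ) (ε : ZMod 2) : m.Zt t r i ε →ₗ[k] (m.twisted t).cycles ε where
  toFun z := ⟨⟨z, m.fil_le_par _ _ z.2.1⟩,
    Subtype.ext ((m.mem_Zt_iff_of_le t hN (by lia)).1 z.2).2⟩
  map_add' _ _ := rfl
  map_smul' _ _ := rfl

theorem ZtToCycles_eq {i : ℕ} {ε : ZMod 2} {z : m.Zt t r i ε} {c : (m.twisted t).cycles ε}
    (h : (z : m.carrier) = m.twistedCyclesVal t ε c) : m.ZtToCycles t hN hr i ε z = c :=
  Subtype.ext (Subtype.ext h)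

theorem toEt_eq_zero_iff_toH_mem (i : ℕ) (ε : ZMod 2) (z : m.Zt t r i ε) :
    m.toEt t r i ε z = 0 ↔
      (m.twisted t).toH ε (m.ZtToCycles t hN hr i ε z) ∈ m.twistedFil t ε (i + 1) :=
  m.toEt_eq_zero_iff_of_le t hN hr z _ rfl

section

variable {ε : ZMod 2} {z z₀ : ∀ i : ℕ, List (m.Zt t r i ε)}

include hN hr in
-- Descending induction on the filtration, with `l = N - n` the number of remaining steps: a class
-- of `G_n` agrees modulo `G_{n+1}` with a combination of the representatives at level `n`.
theorem twistedFil_le_span (hz : ∀ i < N, Submodule.span k {x | x ∈ (z i).map (m.toEt t r i ε)} = ⊤)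
    {n l : ℕ} (hl : n + l = N) : m.twistedFil t ε n ≤ Submodule.span k
      {x | x ∈ (List.range' n l).flatMap fun i =>
        ((z i).map (m.ZtToCycles t hN hr i ε)).map ((m.twisted t).toH ε)} := by
  induction l generalizing n with
  | zero =>
    rw [m.twistedFil_eq_bot t hN ε (by lia)]
    exact bot_le
  | succ l ih =>
    rw [List.range'_succ, List.flatMap_cons, span_list_append]
    rintro _ ⟨c, hc, rfl⟩
    have hcl : m.twistedD t (m.twistedCyclesVal t ε c) = 0 := congrArg Subtype.val c.2
    let y : m.Zt t r n ε := ⟨m.twistedCyclesVal t ε c,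
      (m.mem_Zt_iff_of_le t hN (by lia)).2 ⟨hc, hcl⟩⟩
    have h1 : m.toEt t r n ε y ∈ (Submodule.span k {x | x ∈ z n}).map (m.toEt t r n ε) := by
      rw [← span_list_map, hz n (by lia)]
      trivial
    obtain ⟨u, hu, h2⟩ := h1
    rw [eq_comm, ← sub_eq_zero, ← map_sub, m.toEt_eq_zero_iff_toH_mem t hN hr, map_sub,
      map_sub] at h2
    have h3 : (m.twisted t).toH ε c = (m.twisted t).toH ε (m.ZtToCycles t hN hr n ε u) +
        ((m.twisted t).toH ε (m.ZtToCycles t hN hr n ε y) -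
          (m.twisted t).toH ε (m.ZtToCycles t hN hr n ε u)) := by
      rw [add_sub_cancel]
      rfl
    rw [h3]
    refine Submodule.add_mem_sup ?_ (ih (by lia) h2)
    rw [span_list_map, span_list_map]
    exact ⟨_, ⟨u, hu, rfl⟩, rfl⟩

include hN hr in
theorem finrank_twistedFil (hz : ∀ i < N, IsBasisList k ((z i).map (m.toEt t r i ε)))
    [Module.Finite k ((m.twisted t).H ε)] {n l : ℕ} (hl : n + l = N) :
    Module.finrank k (m.twistedFil t ε n) = ∑ i ∈ Finset.Ico n N, (z i).length := by
  induction l generalizing n with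
  | zero =>
    rw [m.twistedFil_eq_bot t hN ε (by lia), finrank_bot, Finset.Ico_eq_empty (by lia),
      Finset.sum_empty]
  | succ l ih =>
    obtain ⟨e, -⟩ := m.exists_equiv_gr t hN hr n ε
    have h1 := Submodule.finrank_quotient_add_finrank
      ((m.twistedFil t ε (n + 1)).submoduleOf (m.twistedFil t ε n))
    have h2 := (Submodule.submoduleOfEquivOfLe
      (m.twistedFil_antitone t ε (Nat.le_succ n))).finrank_eq
    rw [← e.finrank_eq, h2, ih (by lia), (hz n (by lia)).finrank_eq, List.length_map] at h1
    rw [Finset.sum_eq_sum_Ico_succ_bot (show n < N by lia), h1]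

/-- Lifts of bases of the graded pieces of a finite filtration form a basis of the whole: they span,
and the dimensions of the graded pieces add up. -/
theorem isBasisList_twistedH (hz : ∀ i < N, IsBasisList k ((z i).map (m.toEt t r i ε))) :
    IsBasisList k ((List.range N).flatMap fun i =>
        ((z i).map (m.ZtToCycles t hN hr i ε)).map ((m.twisted t).toH ε)) := by
  have h1 := m.twistedFil_le_span t hN hr (fun i hi => (hz i hi).2) (zero_add N)
  rw [m.twistedFil_zero, top_le_iff, ← List.range_eq_range'] at h1
  have := finite_of_span_list h1
  refine IsBasisList.of_span h1 ?_
  have h2 := m.finrank_twistedFil t hN hr hz (zero_add N)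
  rw [m.twistedFil_zero, finrank_top, ← Finset.range_eq_Ico] at h2
  rw [h2, List.length_flatMap_range]
  simp

/-- The product of the classes in the twisted cohomology depends only on the products of the
classes in the `E_r^i`. -/
theorem wedge_twistedH_eq_smul
    (hz : ∀ i < N, Submodule.span k {x | x ∈ (z i).map (m.toEt t r i ε)} = ⊤)
    (hz₀ : ∀ i < N, Submodule.span k {x | x ∈ (z₀ i).map (m.toEt t r i ε)} = ⊤) {d : ℕ → k}
    (hd : ∀ i < N, wedge k ((z i).map (m.toEt t r i ε)) =
      d i • wedge k ((z₀ i).map (m.toEt t r i ε))) {n l : ℕ} (hl : n + l = N) :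
    wedge k ((List.range' n l).flatMap fun i =>
        ((z i).map (m.ZtToCycles t hN hr i ε)).map ((m.twisted t).toH ε)) =
      (∏ i ∈ Finset.Ico n N, d i) • wedge k ((List.range' n l).flatMap fun i =>
        ((z₀ i).map (m.ZtToCycles t hN hr i ε)).map ((m.twisted t).toH ε)) := by
  induction l generalizing n with
  | zero =>
    obtain rfl : n = N := by lia
    simp
  | succ l ih =>
    obtain ⟨σ, hσ⟩ := LinearMap.exists_rightInverse_of_surjective (m.toEt t r n ε)
      (Submodule.range_mkQ _)
    let s : m.Et t r n ε →ₗ[k] (m.twisted t).H ε :=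
      ((m.twisted t).toH ε).comp ((m.ZtToCycles t hN hr n ε).comp σ)
    -- The later factors span `G_{n+1}`, so `R` is annihilated by it. The factors of level `n` then
    -- enter only through their classes in `E_r^n`, lifted by the section `σ`.
    let R := wedge k ((List.range' (n + 1) l).flatMap fun i =>
        ((z₀ i).map (m.ZtToCycles t hN hr i ε)).map ((m.twisted t).toH ε))
    have h1 : ∀ y : List (m.Zt t r n ε),
        wedge k ((y.map (m.ZtToCycles t hN hr n ε)).map ((m.twisted t).toH ε)) * R =
          ExteriorAlgebra.map s (wedge k (y.map (m.toEt t r n ε))) * R := by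
      intro y
      rw [map_wedge, List.map_map, List.map_map]
      refine wedge_mul_congr (K := m.twistedFil t ε (n + 1)) (fun x hx => ?_) ?_
      · exact ι_mul_wedge_of_mem_span (m.twistedFil_le_span t hN hr hz₀ (by lia) hx)
      · rw [List.forall₂_map_left_iff, List.forall₂_map_right_iff, List.forall₂_same]
        intro x _
        have h2 : m.toEt t r n ε (x - σ (m.toEt t r n ε x)) = 0 := by
          rw [map_sub, sub_eq_zero]
          exact (LinearMap.congr_fun hσ _).symm
        rw [m.toEt_eq_zero_iff_toH_mem t hN hr, map_sub, map_sub] at h2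
        exact h2
    rw [List.range'_succ, List.flatMap_cons, List.flatMap_cons, wedge_append, wedge_append,
      ih (by lia), mul_smul_comm, h1, hd n (by lia), map_smul, smul_mul_assoc, ← h1, smul_smul,
      mul_comm, Finset.prod_eq_prod_Ico_succ_bot (show n < N by lia)]

end

/-- Closed elements which represent bases of the page `E_r` and of the twisted cohomology. -/
structure AbutmentBasis (N : ℕ) (r : ℤ) where
  z : ∀ (ε : ZMod 2) (i : ℕ), List (m.Zt t r i ε)
  c : ∀ (ε : ZMod 2) (_ : ℕ), List ((m.twisted t).cycles ε)
  hzc : ∀ ε i, (z ε i).map (m.Zt t r i ε).subtype = (c ε i).map (m.twistedCyclesVal t ε)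
  b : ∀ ε, IsBasisList k ((List.range N).flatMap fun i => (z ε i).map (m.toPageT t r i ε))
  b' : ∀ ε, IsBasisList k ((List.range N).flatMap fun i => (c ε i).map ((m.twisted t).toH ε))

include hN hr in
theorem nonempty_abutmentBasis (hfin : ∀ ε, Module.Finite k ((m.pageT t r).X ε)) :
    Nonempty (m.AbutmentBasis t N r) := by
  have h1 : ∀ (ε : ZMod 2) (i : ℕ),
      ∃ z : List (m.Zt t r i ε), IsBasisList k (z.map (m.toEt t r i ε)) := by
    intro ε i
    have : Module.Finite k (⨁ p : ℤ, m.Et t r p ε) := hfin ε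
    have : Module.Finite k (m.Et t r i ε) :=
      Module.Finite.of_surjective (DirectSum.component k ℤ (fun p => m.Et t r p ε) i)
        fun x => ⟨DirectSum.lof k ℤ _ _ x, DirectSum.component.lof_self _ _ _⟩
    obtain ⟨l, hl⟩ := IsBasisList.exists_of_finite k (m.Et t r i ε)
    obtain ⟨z, rfl⟩ := IsBasisList.exists_map_eq (l := l)
      (FilteredZ2.toE_surjective (D := m.twistedD t) (F := m.fil) r i ε)
    exact ⟨z, hl⟩
  choose z hz using h1
  refine ⟨⟨z, fun ε i => (z ε i).map (m.ZtToCycles t hN hr i ε), fun ε i => ?_,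
    fun ε => (m.isBasisList_pageT_iff t hN).2 fun i _ => hz ε i,
    fun ε => m.isBasisList_twistedH t hN hr fun i _ => hz ε i⟩⟩
  rw [List.map_map]
  rfl

namespace AbutmentBasis

variable {m t} (a a₀ : m.AbutmentBasis t N r)

include a in
theorem degree_eq : (m.pageT t r).detLine.degree = (m.twisted t).detH.degree := by
  rw [Z2Complex.detLine, Z2Complex.detH, GradedLine.detPair_degree (a.b 0) (a.b 1),
    GradedLine.detPair_degree (a.b' 0) (a.b' 1)]
  simp only [List.length_flatMap_range, List.length_map]
  have h : ∀ ε i, (a.z ε i).length = (a.c ε i).length := fun ε i => by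
    simpa using congrArg List.length (a.hzc ε i)
  simp only [h]

include hN hr in
theorem exists_smul : ∃ q : k, volPair (a.b 0) (a.b 1) = q • volPair (a₀.b 0) (a₀.b 1) ∧
    volPair (a.b' 0) (a.b' 1) = q • volPair (a₀.b' 0) (a₀.b' 1) := by
  have hb := fun ε => (m.isBasisList_pageT_iff t hN).1 (a.b ε)
  have hb₀ := fun ε => (m.isBasisList_pageT_iff t hN).1 (a₀.b ε)
  have h1 : ∀ (ε : ZMod 2) (i : ℕ), ∃ d : k, i < N → d ≠ 0 ∧
      wedge k ((a.z ε i).map (m.toEt t r i ε)) = d • wedge k ((a₀.z ε i).map (m.toEt t r i ε)) := by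
    intro ε i
    by_cases hi : i < N
    · obtain ⟨d, hd⟩ := (hb ε i hi).exists_wedge_eq_smul (hb₀ ε i hi)
      exact ⟨d, fun _ => hd⟩
    -- Nothing is known about the lists beyond `N`; the value 1 only makes `d` total.
    · exact ⟨1, fun h => absurd h hi⟩
  choose d hd using h1
  have h2 : ∀ ε, wedge k ((List.range N).flatMap fun i => (a.z ε i).map (m.toPageT t r i ε)) =
      (∏ i ∈ Finset.range N, d ε i) •
        wedge k ((List.range N).flatMap fun i => (a₀.z ε i).map (m.toPageT t r i ε)) := by
    intro ε
    refine wedge_flatMap_range_eq_smul fun i hi => ?_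
    let s : m.Et t r i ε →ₗ[k] (m.pageT t r).X ε :=
      DirectSum.lof k ℤ (fun p => m.Et t r p ε) i
    have h3 : ∀ z : List (m.Zt t r i ε), wedge k (z.map (m.toPageT t r i ε)) =
        ExteriorAlgebra.map s (wedge k (z.map (m.toEt t r i ε))) := by
      intro z
      rw [map_wedge, List.map_map]
      rfl
    rw [h3, h3, (hd ε i hi).2, map_smul]
  have h3 : ∀ (a : m.AbutmentBasis t N r) (ε : ZMod 2) (i : ℕ),
      (a.c ε i) = (a.z ε i).map (m.ZtToCycles t hN hr i ε) := by
    intro a ε i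
    have := List.map_eq_map_of_map_eq_map (f := m.ZtToCycles t hN hr i ε) (g := id)
      (fun x y hxy => m.ZtToCycles_eq t hN hr hxy) (a.hzc ε i)
    rw [this, List.map_id]
  have h4 : ∀ ε, wedge k ((List.range N).flatMap fun i => (a.c ε i).map ((m.twisted t).toH ε)) =
      (∏ i ∈ Finset.range N, d ε i) •
        wedge k ((List.range N).flatMap fun i => (a₀.c ε i).map ((m.twisted t).toH ε)) := by
    intro ε
    have h5 := m.wedge_twistedH_eq_smul t hN hr (fun i hi => (hb ε i hi).2)
      (fun i hi => (hb₀ ε i hi).2) (fun i hi => (hd ε i hi).2) (zero_add N)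
    rw [← List.range_eq_range', ← Finset.range_eq_Ico] at h5
    simp only [h3]
    exact h5
  have h0 : ∏ i ∈ Finset.range N, d 1 i ≠ 0 :=
    Finset.prod_ne_zero_iff.2 fun i hi => (hd 1 i (Finset.mem_range.1 hi)).1
  exact ⟨_, volPair_eq_smul _ _ _ _ h0 (h2 0) (h2 1), volPair_eq_smul _ _ _ _ h0 (h4 0) (h4 1)⟩

include hN hr in
theorem isDetAbutmentIso_iff (φ : GradedLine.Iso (m.pageT t r).detLine (m.twisted t).detH) :
    m.IsDetAbutmentIso t N r φ ↔
      φ.equiv (volPair (a.b 0) (a.b 1)) = volPair (a.b' 0) (a.b' 1) := by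
  refine ⟨fun h => h a.z a.c a.hzc a.b a.b', fun h z c hzc b b' => ?_⟩
  let a' : m.AbutmentBasis t N r := ⟨z, c, hzc, b, b'⟩
  obtain ⟨q, h1, h2⟩ := a'.exists_smul hN hr a
  change φ.equiv (volPair (a'.b 0) (a'.b 1)) = volPair (a'.b' 0) (a'.b' 1)
  rw [h1, h2, map_smul, h]

include hN hr a in
theorem exists_isDetAbutmentIso : ∃ φ, m.IsDetAbutmentIso t N r φ := by
  obtain ⟨φ, hφ⟩ := GradedLine.Iso.exists_apply_eq (volPair_ne_zero (a.b 0) (a.b 1))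
    (volPair_ne_zero (a.b' 0) (a.b' 1)) a.degree_eq
  exact ⟨φ, (a.isDetAbutmentIso_iff hN hr φ).2 hφ⟩

include hN hr a in
theorem isDetAbutmentIso_unique {φ φ' : GradedLine.Iso (m.pageT t r).detLine (m.twisted t).detH}
    (h : m.IsDetAbutmentIso t N r φ) (h' : m.IsDetAbutmentIso t N r φ') : φ = φ' := by
  rw [a.isDetAbutmentIso_iff hN hr] at h h'
  exact GradedLine.Iso.ext_of_apply_eq (volPair_ne_zero (a.b 0) (a.b 1)) (h.trans h'.symm)

end AbutmentBasis

end DGModule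

/-! ### Transition isomorphisms between determinants of consecutive pages -/

theorem GradedLine.Iso.symm_trans_equiv_apply {k : Type u} [Field k]
    {L L' L'' : GradedLine.{u, w} k} (χ : Iso L L') (φ : Iso L L'') {x : L.carrier}
    {y : L'.carrier} (h : χ.equiv x = y) : (χ.symm.trans φ).equiv y = φ.equiv x :=
  congrArg φ.equiv ((LinearEquiv.symm_apply_eq _).2 h.symm)

theorem Submodule.exists_list_map_subtype_eq {k : Type u} [Field k] {M : Type w} [AddCommGroup M]
    [Module k M] {S T : Submodule k M} (h : S ≤ T) (l : List S) :
    ∃ l' : List T, l'.map T.subtype = l.map S.subtype := by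
  refine ⟨l.map (Submodule.inclusion h), ?_⟩
  rw [List.map_map]
  rfl

namespace FilteredZ2

variable {k : Type u} [Field k] {M : Type w} [AddCommGroup M] [Module k M]
  {D : M →ₗ[k] M} {F : ℤ → ZMod 2 → Submodule k M} (hD : D.comp D = 0)
  (hF : ∀ ε, Antitone fun p => F p ε)

theorem IsNextPageIso.apply_toPageCycles {r : ℤ}
    {e : ∀ ε, (page D F hD r).H ε ≃ₗ[k] (page D F hD (r + 1)).X ε}
    (he : IsNextPageIso D F hD r (r + 1) e) (p : ℤ) (ε : ZMod 2) (z : Z D F (r + 1) p ε) :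
    e ε ((page D F hD r).toH ε (toPageCycles hD hF r p ε z)) = toPage D F hD (r + 1) p ε z :=
  he ε p z (Submodule.inclusion (Z_succ_le hF r p ε) z) _ rfl rfl

theorem coe_toPageCycles {r p : ℤ} {ε : ZMod 2} (z' : Z D F (r + 1) p ε) (z : Z D F r p ε)
    (h : (z' : M) = z) :
    (toPageCycles hD hF r p ε z' : (page D F hD r).X ε) = toPage D F hD r p ε z :=
  toPage_eq_of_toE_eq hD (toE_comp_inclusion hF z' z h)

include hF in
-- The condition fixes the values on classes of elements of `Z_{r+1}`, and these span `H(E_r)`.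
theorem IsNextPageIso.unique {r : ℤ}
    {e e' : ∀ ε, (page D F hD r).H ε ≃ₗ[k] (page D F hD (r + 1)).X ε}
    (he : IsNextPageIso D F hD r (r + 1) e) (he' : IsNextPageIso D F hD r (r + 1) e') : e = e' := by
  refine funext fun ε => LinearEquiv.ext fun x => ?_
  induction x using page_H_induction hD hF with
  | h0 => rw [map_zero, map_zero]
  | hadd x y hx hy => rw [map_add, map_add, hx, hy]
  | hz p z => rw [he.apply_toPageCycles hD hF, he'.apply_toPageCycles hD hF]

include hF in
theorem exists_isDetNextPageIso (r : ℤ) (hfin : ∀ ε, Module.Finite k ((page D F hD r).X ε)) :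
    ∃ φ, IsDetNextPageIso D F hD r (r + 1) φ := by
  have := hfin 0
  have := hfin 1
  obtain ⟨ψ, hψ⟩ := (page D F hD r).exists_isDetCohomologyIso
  obtain ⟨e, he⟩ := exists_isNextPageIso hD hF r
  exact ⟨_, ψ, hψ, e, he, rfl⟩

include hF in
theorem IsDetNextPageIso.unique {r : ℤ} (hfin : ∀ ε, Module.Finite k ((page D F hD r).X ε))
    {φ φ' : GradedLine.Iso (page D F hD r).detLine (page D F hD (r + 1)).detLine}
    (h : IsDetNextPageIso D F hD r (r + 1) φ) (h' : IsDetNextPageIso D F hD r (r + 1) φ') :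
    φ = φ' := by
  have := hfin 0
  have := hfin 1
  obtain ⟨ψ, hψ, e, he, rfl⟩ := h
  obtain ⟨ψ', hψ', e', he', rfl⟩ := h'
  rw [hψ.unique hψ', he.unique hD hF he']

include hF in
theorem finite_page_succ {r : ℤ} {ε : ZMod 2} (hfin : Module.Finite k ((page D F hD r).X ε)) :
    Module.Finite k ((page D F hD (r + 1)).X ε) := by
  obtain ⟨e, -⟩ := exists_isNextPageIso_aux hD hF r ε
  exact Module.Finite.equiv e

end FilteredZ2

namespace Z2Complex

variable {k : Type u} [Field k] {C : Z2Complex.{u, w} k}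

theorem exists_equiv_H_of_d_eq_zero (hd : ∀ ε ε' h, C.d ε ε' h = 0) (ε : ZMod 2) :
    ∃ e : C.X ε ≃ₗ[k] C.H ε, ∀ c : C.cycles ε, e c = C.toH ε c := by
  refine exists_equiv_of_ker_eq (C.cycles ε).subtype (C.toH ε) (fun x => ⟨⟨x, ?_⟩, rfl⟩)
    (Submodule.mkQ_surjective _) fun c => ?_
  · rw [LinearMap.mem_ker, hd, LinearMap.zero_apply]
  · rw [Submodule.mkQ_submoduleOf_eq_zero, boundaries, hd, LinearMap.range_zero,
      Submodule.mem_bot, Submodule.subtype_apply]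

theorem isBasisList_toH_of_d_eq_zero (hd : ∀ ε ε' h, C.d ε ε' h = 0) {ε : ZMod 2}
    {l : List (C.cycles ε)} (b : IsBasisList k (l.map (C.cycles ε).subtype)) :
    IsBasisList k (l.map (C.toH ε)) := by
  obtain ⟨e, he⟩ := exists_equiv_H_of_d_eq_zero hd ε
  have h1 : l.map (C.toH ε) = (l.map (C.cycles ε).subtype).map e := by
    rw [List.map_map]
    exact List.map_congr_left fun c _ => (he c).symm
  rw [h1]
  exact b.map e

/-- With bases made of closed elements the complements `x` and `y` are empty, so the exponent of the
sign is 0. -/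
theorem IsDetCohomologyIso.apply_of_cycles {φ : GradedLine.Iso C.detLine C.detH}
    (h : C.IsDetCohomologyIso φ) {l : List (C.cycles 0)} {l' : List (C.cycles 1)}
    (b : IsBasisList k (l.map (C.cycles 0).subtype))
    (b' : IsBasisList k (l'.map (C.cycles 1).subtype)) (c : IsBasisList k (l.map (C.toH 0)))
    (c' : IsBasisList k (l'.map (C.toH 1))) : φ.equiv (volPair b b') = volPair c c' := by
  have e : ([] : List (C.X 1)).map (C.d 1 0 rfl) ++ l.map (C.cycles 0).subtype ++ [] =
    l.map (C.cycles 0).subtype := by simp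
  have e' : ([] : List (C.X 0)).map (C.d 0 1 rfl) ++ l'.map (C.cycles 1).subtype ++ [] =
    l'.map (C.cycles 1).subtype := by simp
  have h1 := h [] [] l l' (e.symm ▸ b) (e'.symm ▸ b') c c'
  rw [volPair_congr _ _ b b' e e'] at h1
  simpa using h1

end Z2Complex

namespace FilteredZ2

variable {k : Type u} [Field k] {M : Type w} [AddCommGroup M] [Module k M]
  {D : M →ₗ[k] M} {F : ℤ → ZMod 2 → Submodule k M} (hD : D.comp D = 0)
  (hF : ∀ ε, Antitone fun p => F p ε)

include hF in
-- Once `d_r = 0`, the passage to the next page is the identity on representatives, without sign;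
-- this makes the determinant of `E_∞` well defined.
theorem IsDetNextPageIso.apply_of_d_eq_zero {r : ℤ}
    {χ : GradedLine.Iso (page D F hD r).detLine (page D F hD (r + 1)).detLine}
    (hχ : IsDetNextPageIso D F hD r (r + 1) χ) (hd : ∀ ε ε' h, (page D F hD r).d ε ε' h = 0)
    {N : ℕ} (z : ∀ (ε : ZMod 2) (i : ℕ), List (Z D F r i ε))
    (z' : ∀ (ε : ZMod 2) (i : ℕ), List (Z D F (r + 1) i ε))
    (hz : ∀ ε i, (z' ε i).map (Z D F (r + 1) i ε).subtype = (z ε i).map (Z D F r i ε).subtype)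
    (b : ∀ ε, IsBasisList k
      ((List.range N).flatMap fun i => (z ε i).map (toPage D F hD r i ε))) :
    ∃ b' : ∀ ε, IsBasisList k
      ((List.range N).flatMap fun i => (z' ε i).map (toPage D F hD (r + 1) i ε)),
      χ.equiv (volPair (b 0) (b 1)) = volPair (b' 0) (b' 1) := by
  obtain ⟨ψ, hψ, e, he, rfl⟩ := hχ
  let h : ∀ ε, List ((page D F hD r).cycles ε) := fun ε => (List.range N).flatMap fun i =>
    (z' ε i).map (toPageCycles hD hF r i ε)
  have e₁ : ∀ ε, (h ε).map ((page D F hD r).cycles ε).subtype =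
      (List.range N).flatMap fun i => (z ε i).map (toPage D F hD r i ε) := by
    intro ε
    rw [List.map_flatMap]
    refine congrArg (List.flatMap · _) (funext fun i => ?_)
    rw [List.map_map]
    exact List.map_eq_map_of_map_eq_map (fun y x hyx => coe_toPageCycles hD hF y x hyx) (hz ε i)
  have e₂ : ∀ ε, ((h ε).map ((page D F hD r).toH ε)).map (e ε) =
      (List.range N).flatMap fun i => (z' ε i).map (toPage D F hD (r + 1) i ε) := by
    intro ε
    rw [List.map_flatMap, List.map_flatMap]
    refine congrArg (List.flatMap · _) (funext fun i => ?_)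
    rw [List.map_map, List.map_map]
    exact List.map_congr_left fun y _ => he.apply_toPageCycles hD hF i ε y
  have b₁ : ∀ ε, IsBasisList k ((h ε).map ((page D F hD r).cycles ε).subtype) := fun ε =>
    (e₁ ε).symm ▸ b ε
  have c : ∀ ε, IsBasisList k ((h ε).map ((page D F hD r).toH ε)) := fun ε =>
    Z2Complex.isBasisList_toH_of_d_eq_zero hd (b₁ ε)
  refine ⟨fun ε => (e₂ ε) ▸ (c ε).map (e ε), ?_⟩
  rw [GradedLine.Iso.trans_equiv_apply,
    volPair_congr (b 0) (b 1) (b₁ 0) (b₁ 1) (e₁ 0).symm (e₁ 1).symm,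
    hψ.apply_of_cycles (b₁ 0) (b₁ 1) (c 0) (c 1), GradedLine.Iso.detPair_equiv_volPair]
  exact volPair_congr _ _ _ _ (e₂ 0) (e₂ 1)

end FilteredZ2

/-! ### Finiteness, existence and uniqueness of the composite isomorphism -/

namespace DGModule

variable {k : Type u} [Field k] {A : CommDGAlgebra.{u, v} k} (m : DGModule.{u, v, w} A)
  (t : A.Twist) [CharZero k] {N : ℕ} (hN : ∀ i ≥ N, m.deg i = ⊥)

include hN in
theorem finite_pageT (hfin : ∀ i, Module.Finite k (m.H i)) {r : ℤ} (hr : 2 ≤ r) (ε : ZMod 2) :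
    Module.Finite k ((m.pageT t r).X ε) := by
  induction r, hr using Int.leInduction with
  | base =>
    obtain ⟨a⟩ := m.nonempty_secondPageBasis t hN hfin
    exact (a.b ε).finite
  | succ r _ ih => exact FilteredZ2.finite_page_succ _ m.fil_antitone ih

include hN in
theorem finite_twistedH (hfin : ∀ i, Module.Finite k (m.H i)) (ε : ZMod 2) :
    Module.Finite k ((m.twisted t).H ε) := by
  obtain ⟨a⟩ := m.nonempty_abutmentBasis t hN (r := N + 2) (by lia)
    (m.finite_pageT t hN hfin (by lia))
  exact (a.b' ε).finite

include hN in
theorem pageT_d_eq_zero {r : ℤ} (hr : N ≤ r) (ε ε' : ZMod 2) (h : ε' = ε + 1) :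
    (m.pageT t r).d ε ε' h = 0 := by
  have key : FilteredZ2.pageD (F := m.fil) (m.twistedD_comp_twistedD t) r ε ε' h = 0 := by
    refine DirectSum.linearMap_ext k fun p => LinearMap.ext fun x => ?_
    rw [LinearMap.comp_apply, FilteredZ2.pageD_lof _ r p (p + r) ε ε' rfl h,
      m.dE_eq_zero_of_le t hN _ hr, LinearMap.zero_apply, map_zero]
    rfl
  exact key

omit [CharZero k] in
include hN in
theorem mem_Zt_of_mem_Zt {r r' : ℤ} (hr : N ≤ r) (hr' : N ≤ r') {i : ℕ} {ε : ZMod 2}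
    {x : m.carrier} (hx : x ∈ m.Zt t r i ε) : x ∈ m.Zt t r' i ε :=
  (m.mem_Zt_iff_of_le t hN (by lia)).2 ((m.mem_Zt_iff_of_le t hN (by lia)).1 hx)

include hN in
/-- The isomorphisms of the determinants of the pages with the determinant of the twisted
cohomology are compatible. -/
theorem IsDetAbutmentIso.succ {r : ℤ} (hr : N + 1 ≤ r)
    (hfin : ∀ ε, Module.Finite k ((m.pageT t r).X ε))
    {χ : GradedLine.Iso (m.pageT t r).detLine (m.pageT t (r + 1)).detLine}
    (hχ : FilteredZ2.IsDetNextPageIso (m.twistedD t) m.fil (m.twistedD_comp_twistedD t) r (r + 1) χ)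
    {φ : GradedLine.Iso (m.pageT t r).detLine (m.twisted t).detH}
    (hφ : m.IsDetAbutmentIso t N r φ) : m.IsDetAbutmentIso t N (r + 1) (χ.symm.trans φ) := by
  obtain ⟨a⟩ := m.nonempty_abutmentBasis t hN hr hfin
  obtain ⟨z', hz'⟩ : ∃ z' : ∀ (ε : ZMod 2) (i : ℕ), List (m.Zt t (r + 1) i ε), ∀ ε i,
      (z' ε i).map (m.Zt t (r + 1) i ε).subtype = (a.z ε i).map (m.Zt t r i ε).subtype := by
    have h1 := fun (ε : ZMod 2) (i : ℕ) => Submodule.exists_list_map_subtype_eq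
      (fun x hx => m.mem_Zt_of_mem_Zt t hN (r' := r + 1) (by lia) (by lia) hx) (a.z ε i)
    choose z' hz' using h1
    exact ⟨z', hz'⟩
  obtain ⟨b, hb⟩ := hχ.apply_of_d_eq_zero _ m.fil_antitone
    (m.pageT_d_eq_zero t hN (show N ≤ r by lia)) a.z z' hz' a.b
  have h : φ.equiv (volPair (a.b 0) (a.b 1)) = volPair (a.b' 0) (a.b' 1) :=
    (a.isDetAbutmentIso_iff hN hr φ).1 hφ
  -- The same closed elements serve on both pages, since for large `r` the spaces `Z_r^i` do not
  -- depend on `r`.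
  let a' : m.AbutmentBasis t N (r + 1) :=
    { z := z'
      c := a.c
      hzc := fun ε i => (hz' ε i).trans (a.hzc ε i)
      b := b
      b' := a.b' }
  exact (a'.isDetAbutmentIso_iff hN (by lia) _).2
    ((GradedLine.Iso.symm_trans_equiv_apply χ φ hb).trans h)

include hN in
theorem exists_isCanonicalDetIso (hfin : ∀ i, Module.Finite k (m.H i)) :
    ∃ Φ, m.IsCanonicalDetIso t N Φ := by
  obtain ⟨a⟩ := m.nonempty_secondPageBasis t hN hfin
  obtain ⟨φ₀, hφ₀⟩ := a.exists_isDetSecondPageIso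
  have hχ := fun (r : ℤ) (hr : 2 ≤ r) => FilteredZ2.exists_isDetNextPageIso
    (m.twistedD_comp_twistedD t) m.fil_antitone r (m.finite_pageT t hN hfin hr)
  choose χ hχ using hχ
  -- The links are composed recursively from the second page. The chain is closed at `N + 2`, which
  -- is at least 2 and at least `N + 1`; later pages are compatible by `IsDetAbutmentIso.succ`.
  let Ψ : ∀ r : ℤ, 2 ≤ r → GradedLine.Iso (m.detH N) (m.pageT t r).detLine :=
    Int.leInduction (motive := fun r _ => GradedLine.Iso (m.detH N) (m.pageT t r).detLine) φ₀
      fun r hr φ => φ.trans (χ r hr)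
  have hΨ₀ : Ψ 2 le_rfl = φ₀ := Int.leInduction_base _ _
  have hΨ : ∀ r hr, Ψ (r + 1) (by lia) = (Ψ r hr).trans (χ r hr) := fun r hr =>
    Int.leInduction_add_one _ _ r hr
  obtain ⟨a₁⟩ := m.nonempty_abutmentBasis t hN (r := N + 2) (by lia)
    (m.finite_pageT t hN hfin (by lia))
  obtain ⟨α, hα⟩ := a₁.exists_isDetAbutmentIso hN (by lia)
  refine ⟨(Ψ (N + 2) (by lia)).trans α, Ψ, by rw [hΨ₀]; exact hφ₀, fun r hr => ?_, N + 2,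
    fun r hr hr' => ?_⟩
  · rw [hΨ r hr, GradedLine.Iso.symm_trans_trans]
    exact hχ r hr
  · induction r, hr' using Int.leInduction with
    | base =>
      rw [GradedLine.Iso.symm_trans_trans]
      exact hα
    | succ r hr' ih =>
      have h := (ih (by lia)).succ m t hN (by lia) (m.finite_pageT t hN hfin (by lia))
        (hχ r (by lia))
      rw [hΨ r (by lia)]
      exact h

include hN in
-- The first link and all transitions are unique, so the two chains agree on every page. A page
-- beyond both thresholds and beyond `N + 1` then compares the last links.
theorem IsCanonicalDetIso.unique (hfin : ∀ i, Module.Finite k (m.H i))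
    {Φ Φ' : GradedLine.Iso (m.detH N) (m.twisted t).detH} (h : m.IsCanonicalDetIso t N Φ)
    (h' : m.IsCanonicalDetIso t N Φ') : Φ = Φ' := by
  obtain ⟨a⟩ := m.nonempty_secondPageBasis t hN hfin
  obtain ⟨Ψ, h2, hs, r₀, hr₀⟩ := h
  obtain ⟨Ψ', h2', hs', r₀', hr₀'⟩ := h'
  have key : ∀ r hr, Ψ r hr = Ψ' r hr := by
    intro r hr
    induction r, hr using Int.leInduction with
    | base => exact a.isDetSecondPageIso_unique h2 h2'
    | succ r hr ih =>
      have h3 := (hs r hr).unique _ m.fil_antitone (m.finite_pageT t hN hfin hr) (hs' r hr)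
      rw [← GradedLine.Iso.trans_symm_trans (Ψ r hr) (Ψ (r + 1) (by lia)), h3, ih,
        GradedLine.Iso.trans_symm_trans]
  have hr : 2 ≤ max (N + 2 : ℤ) (max r₀ r₀') := by lia
  obtain ⟨a₁⟩ := m.nonempty_abutmentBasis t hN (r := max (N + 2 : ℤ) (max r₀ r₀')) (by lia)
    (m.finite_pageT t hN hfin hr)
  have h4 := a₁.isDetAbutmentIso_unique hN (by lia) (hr₀ _ hr (by lia)) (hr₀' _ hr (by lia))
  rw [← GradedLine.Iso.trans_symm_trans (Ψ _ hr) Φ, h4, key, GradedLine.Iso.trans_symm_trans]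

end DGModule

/-! ### Naturality of the isomorphisms between the pages -/

namespace Z2Complex

variable {k : Type u} [Field k] {C C' : Z2Complex.{u, w} k} (g : ∀ ε, C.X ε →ₗ[k] C'.X ε)
  (hg : ∀ ε ε' hε x, g ε' (C.d ε ε' hε x) = C'.d ε ε' hε (g ε x))

include hg in
theorem cycles_le_comap (ε : ZMod 2) : C.cycles ε ≤ (C'.cycles ε).comap (g ε) := by
  intro c hc
  rw [Submodule.mem_comap, LinearMap.mem_ker]
  rw [LinearMap.mem_ker] at hc
  rw [← hg, hc, map_zero]

include hg in
theorem boundaries_le_comap (ε : ZMod 2) : C.boundaries ε ≤ (C'.boundaries ε).comap (g ε) := by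
  rintro _ ⟨x, rfl⟩
  exact ⟨g _ x, (hg _ _ _ _).symm⟩

/-- The map induced on cohomology by a morphism of complexes. -/
def mapH (ε : ZMod 2) : C.H ε →ₗ[k] C'.H ε :=
  Submodule.mapQ _ _ ((g ε).restrict (cycles_le_comap g hg ε))
    fun _ hx => boundaries_le_comap g hg ε hx

theorem mapH_toH {ε : ZMod 2} {c : C.cycles ε} {c' : C'.cycles ε}
    (h : (c' : C'.X ε) = g ε c) : mapH g hg ε (C.toH ε c) = C'.toH ε c' :=
  congrArg (C'.toH ε) (Subtype.ext h.symm)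

end Z2Complex

namespace FilteredZ2

variable {k : Type u} [Field k] {M M' : Type w} [AddCommGroup M] [Module k M]
  [AddCommGroup M'] [Module k M'] {D : M →ₗ[k] M} {F : ℤ → ZMod 2 → Submodule k M}
  {D' : M' →ₗ[k] M'} {F' : ℤ → ZMod 2 → Submodule k M'}
  {g : M →ₗ[k] M'} (hg : ∀ x, g (D x) = D' (g x)) (hgF : ∀ p ε, F p ε ≤ (F' p ε).comap g)
  (hD : D.comp D = 0) (hD' : D'.comp D' = 0)

theorem IsNextPageIso.natural (hF : ∀ ε, Antitone fun p => F p ε)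
    (hF' : ∀ ε, Antitone fun p => F' p ε) {r : ℤ}
    (h : ∀ p ε, Function.Bijective (mapE hg hgF r p ε))
    (h' : ∀ p ε, Function.Bijective (mapE hg hgF (r + 1) p ε))
    {e : ∀ ε, (page D F hD r).H ε ≃ₗ[k] (page D F hD (r + 1)).X ε}
    (he : IsNextPageIso D F hD r (r + 1) e)
    {e' : ∀ ε, (page D' F' hD' r).H ε ≃ₗ[k] (page D' F' hD' (r + 1)).X ε}
    (he' : IsNextPageIso D' F' hD' r (r + 1) e') {ε : ZMod 2} (x : (page D F hD r).H ε) :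
    mapPage hg hgF hD hD' h' ε (e ε x) =
      e' ε (Z2Complex.mapH (fun ε => (mapPage hg hgF hD hD' h ε).toLinearMap)
        (mapPage_d hg hgF hD hD' h) ε x) := by
  induction x using page_H_induction hD hF with
  | h0 => simp only [map_zero]
  | hadd x y hx hy => simp only [map_add, hx, hy]
  | hz p z =>
    have h1 : (toPageCycles hD' hF' r p ε ⟨g z, Z_le_comap hg hgF (r + 1) p ε z.2⟩ :
        (page D' F' hD' r).X ε) =
        mapPage hg hgF hD hD' h ε (toPageCycles hD hF r p ε z) :=
      (mapPage_toPage hg hgF hD hD' h p ε (Submodule.inclusion (Z_succ_le hF r p ε) z)).symm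
    rw [he.apply_toPageCycles hD hF, mapPage_toPage, Z2Complex.mapH_toH _ _ h1,
      he'.apply_toPageCycles hD' hF']

theorem IsDetNextPageIso.natural (hF : ∀ ε, Antitone fun p => F p ε)
    (hF' : ∀ ε, Antitone fun p => F' p ε) {r : ℤ}
    (hfin : ∀ ε, Module.Finite k ((page D F hD r).X ε))
    (h : ∀ p ε, Function.Bijective (mapE hg hgF r p ε))
    (h' : ∀ p ε, Function.Bijective (mapE hg hgF (r + 1) p ε))
    {χ : GradedLine.Iso (page D F hD r).detLine (page D F hD (r + 1)).detLine}
    (hχ : IsDetNextPageIso D F hD r (r + 1) χ)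
    {χ' : GradedLine.Iso (page D' F' hD' r).detLine (page D' F' hD' (r + 1)).detLine}
    (hχ' : IsDetNextPageIso D' F' hD' r (r + 1) χ') :
    χ.trans (GradedLine.Iso.detPair (mapPage hg hgF hD hD' h' 0) (mapPage hg hgF hD hD' h' 1)) =
      (GradedLine.Iso.detPair (mapPage hg hgF hD hD' h 0) (mapPage hg hgF hD hD' h 1)).trans
        χ' := by
  have := hfin 0
  have := hfin 1
  obtain ⟨a⟩ := (page D F hD r).nonempty_adaptedBasis
  obtain ⟨ψ, hψ, e, he, rfl⟩ := hχ
  obtain ⟨ψ', hψ', e', he', rfl⟩ := hχ'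
  -- The isomorphism of cohomologies is obtained by transporting the one on `E_{r+1}`; that it is
  -- the map induced by the morphism of pages is the naturality of `H(E_r) ≅ E_{r+1}`.
  let gH : ∀ ε, (page D F hD r).H ε ≃ₗ[k] (page D' F' hD' r).H ε := fun ε =>
    (e ε).trans ((mapPage hg hgF hD hD' h' ε).trans (e' ε).symm)
  have h1 := hψ.natural hψ' (mapPage hg hgF hD hD' h) (mapPage_d hg hgF hD hD' h) gH
    (fun ε c c' hc => by
      refine (LinearEquiv.symm_apply_eq _).2 ?_
      exact (he.natural hg hgF hD hD' hF hF' h h' he' _).trans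
        (congrArg (e' ε) (Z2Complex.mapH_toH _ _ hc)))
  rw [← GradedLine.Iso.trans_assoc, ← h1, GradedLine.Iso.trans_assoc, GradedLine.Iso.trans_assoc]
  refine congrArg ψ.trans (GradedLine.Iso.ext_of_apply_eq (volPair_ne_zero a.c₀ a.c₁) ?_)
  rw [GradedLine.Iso.trans_equiv_apply, GradedLine.Iso.trans_equiv_apply,
    GradedLine.Iso.detPair_equiv_volPair, GradedLine.Iso.detPair_equiv_volPair,
    GradedLine.Iso.detPair_equiv_volPair, GradedLine.Iso.detPair_equiv_volPair]
  refine volPair_congr _ _ _ _ ?_ ?_ <;>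
  · simp only [List.map_map]
    exact List.map_congr_left fun x _ => ((e' _).apply_symm_apply _).symm

end FilteredZ2

theorem List.map_subtype_map_restrict {k : Type u} [Field k] {M M' : Type w} [AddCommGroup M]
    [Module k M] [AddCommGroup M'] [Module k M'] {g : M →ₗ[k] M'} {S : Submodule k M}
    {T : Submodule k M'} (h : S ≤ T.comap g) (l : List S) :
    (l.map (g.restrict h)).map T.subtype = (l.map S.subtype).map g := by
  rw [List.map_map, List.map_map]
  rfl

theorem vol_congr {k : Type u} [Field k] {V : Type w} [AddCommGroup V] [Module k V]
    {l l' : List V} (h : IsBasisList k l) (h' : IsBasisList k l') (e : l = l') :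
    vol h = vol h' := by
  subst e
  rfl

/-! ### Functoriality -/

namespace TwistedHom

variable {k : Type u} [Field k] {A : CommDGAlgebra.{u, v} k} {B : CommDGAlgebra.{u, v'} k}
  {m : DGModule.{u, v, w} A} {t : A.Twist} {n : DGModule.{u, v', w} B} {s : B.Twist}
  (f : TwistedHom m t n s)

theorem fil_le_comap (p : ℤ) (ε : ZMod 2) : m.fil p ε ≤ (n.fil p ε).comap f.toFun :=
  m.fil_le fun _ hp hε _ hx => n.deg_le_fil hp hε (f.map_deg hx)

/-- The map induced on `E_r^p`. -/
abbrev mapEt (r p : ℤ) (ε : ZMod 2) : m.Et t r p ε →ₗ[k] n.Et s r p ε :=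
  FilteredZ2.mapE f.map_twistedD f.fil_le_comap r p ε

/-- The map induced on `Z_r^p`. -/
abbrev mapZt (r p : ℤ) (ε : ZMod 2) : m.Zt t r p ε →ₗ[k] n.Zt s r p ε :=
  f.toFun.restrict (FilteredZ2.Z_le_comap f.map_twistedD f.fil_le_comap r p ε)

variable (hf : f.IsQuasiIso)

include hf in
theorem mapEt_two_bijective (p : ℤ) (ε : ZMod 2) : Function.Bijective (f.mapEt 2 p ε) := by
  by_cases h : p < 0 ∨ (p : ZMod 2) ≠ ε
  · have := m.subsingleton_Et t (r := 2) h
    have := n.subsingleton_Et s (r := 2) h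
    exact ⟨Function.injective_of_subsingleton _, fun y => ⟨0, Subsingleton.elim _ _⟩⟩
  · rw [not_or, not_lt, not_not] at h
    obtain ⟨i, rfl⟩ := Int.eq_ofNat_of_zero_le h.1
    have hi : (i : ZMod 2) = ε := by simpa using h.2
    obtain ⟨η, hη⟩ := m.exists_equiv_Et_two t i hi
    obtain ⟨η', hη'⟩ := n.exists_equiv_Et_two s i hi
    have key : ∀ x, f.mapEt 2 i ε (η x) = η' (f.mapH i x) := by
      intro x
      obtain ⟨c, rfl⟩ := Submodule.mkQ_surjective _ x
      have hc := m.mem_Zt_two_of_mem_cocycles t hi c.2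
      exact (congrArg (f.mapEt 2 i ε) (hη c ⟨c, hc⟩ rfl)).trans
        (hη' ⟨f.toFun c, f.map_cocycles c.2⟩ (f.mapZt 2 i ε ⟨c, hc⟩) rfl).symm
    have h1 : (f.mapEt 2 i ε : m.Et t 2 i ε → n.Et s 2 i ε) = η' ∘ f.mapH i ∘ η.symm :=
      funext fun x => by
        rw [Function.comp_apply, Function.comp_apply, ← key, LinearEquiv.apply_symm_apply]
    change Function.Bijective (f.mapEt 2 i ε)
    rw [h1]
    exact η'.bijective.comp ((hf i).comp η.symm.bijective)

variable [CharZero k]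

include hf in
theorem mapEt_bijective {r : ℤ} (hr : 2 ≤ r) (p : ℤ) (ε : ZMod 2) :
    Function.Bijective (f.mapEt r p ε) :=
  FilteredZ2.mapE_bijective_of_le f.map_twistedD f.fil_le_comap m.fil_antitone n.fil_antitone
    (m.twistedD_comp_twistedD t) (n.twistedD_comp_twistedD s) (f.mapEt_two_bijective hf) hr p ε

/-- The isomorphism of pages induced by a quasi-isomorphism. -/
abbrev pageEquiv {r : ℤ} (hr : 2 ≤ r) (ε : ZMod 2) : (m.pageT t r).X ε ≃ₗ[k] (n.pageT s r).X ε :=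
  FilteredZ2.mapPage f.map_twistedD f.fil_le_comap (m.twistedD_comp_twistedD t)
    (n.twistedD_comp_twistedD s) (f.mapEt_bijective hf hr) ε

theorem pageEquiv_toPageT {r : ℤ} (hr : 2 ≤ r) (p : ℤ) (ε : ZMod 2) (z : m.Zt t r p ε) :
    f.pageEquiv hf hr ε (m.toPageT t r p ε z) = n.toPageT s r p ε (f.mapZt r p ε z) :=
  FilteredZ2.mapPage_toPage _ _ _ _ _ _ _ _

theorem map_pageEquiv_flatMap {r : ℤ} (hr : 2 ≤ r) {N : ℕ} (ε : ZMod 2)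
    (z : ∀ i : ℕ, List (m.Zt t r i ε)) :
    ((List.range N).flatMap fun i => (z i).map (m.toPageT t r i ε)).map (f.pageEquiv hf hr ε) =
      (List.range N).flatMap fun i => ((z i).map (f.mapZt r i ε)).map (n.toPageT s r i ε) := by
  rw [List.map_flatMap]
  refine congrArg (List.flatMap · _) (funext fun i => ?_)
  rw [List.map_map, List.map_map]
  exact List.map_congr_left fun x _ => f.pageEquiv_toPageT hf hr i ε x

/-! ### The twisted cohomology -/

/-- The map induced on the closed elements. -/
abbrev mapTwistedCycles (ε : ZMod 2) : (m.twisted t).cycles ε →ₗ[k] (n.twisted s).cycles ε :=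
  (f.mapPar ε).restrict fun _ hx => f.mapPar_mem_cycles hx

theorem mapTwistedH_toH (ε : ZMod 2) (c : (m.twisted t).cycles ε) :
    f.mapTwistedH ε ((m.twisted t).toH ε c) = (n.twisted s).toH ε (f.mapTwistedCycles ε c) := rfl

theorem twistedCyclesVal_mapTwistedCycles (ε : ZMod 2) (c : (m.twisted t).cycles ε) :
    n.twistedCyclesVal s ε (f.mapTwistedCycles ε c) = f.toFun (m.twistedCyclesVal t ε c) := rfl

include hf in
-- An isomorphism on the graded pieces of two finite filtrations is an isomorphism. Both filtrations
-- end by the common bound `N`, and the page `N + 2` computes the graded pieces.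
theorem mapTwistedH_bijective (hm : m.IsBounded) (hn : n.IsBounded) (ε : ZMod 2) :
    Function.Bijective (f.mapTwistedH ε) := by
  obtain ⟨N₁, hN₁⟩ := hm
  obtain ⟨N₂, hN₂⟩ := hn
  obtain ⟨N, hN, hN'⟩ : ∃ N : ℕ, (∀ i ≥ N, m.deg i = ⊥) ∧ ∀ i ≥ N, n.deg i = ⊥ :=
    ⟨max N₁ N₂, fun i hi => hN₁ i (le_of_max_le_left hi), fun i hi => hN₂ i (le_of_max_le_right hi)⟩
  have hr : (N : ℤ) + 1 ≤ N + 2 := by lia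
  have hE := fun p => f.mapEt_bijective hf (r := N + 2) (by lia) p ε
  have hz : ∀ (p : ℕ) (c : (m.twisted t).cycles ε), m.twistedCyclesVal t ε c ∈ m.fil p ε →
      m.twistedCyclesVal t ε c ∈ m.Zt t (N + 2) p ε := fun p c hc =>
    (m.mem_Zt_iff_of_le t hN (by lia)).2 ⟨hc, congrArg Subtype.val c.2⟩
  have hz' : ∀ (p : ℕ) (c : (n.twisted s).cycles ε), n.twistedCyclesVal s ε c ∈ n.fil p ε →
      n.twistedCyclesVal s ε c ∈ n.Zt s (N + 2) p ε := fun p c hc =>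
    (n.mem_Zt_iff_of_le s hN' (by lia)).2 ⟨hc, congrArg Subtype.val c.2⟩
  constructor
  · rw [injective_iff_map_eq_zero]
    intro x hx
    -- Injectivity on `E_r^p` pushes an element of the kernel down the filtration, one step at a
    -- time, until it reaches zero.
    have key : ∀ p, x ∈ m.twistedFil t ε p := by
      intro p
      induction p with
      | zero =>
        rw [m.twistedFil_zero]
        trivial
      | succ p ih =>
        obtain ⟨c, hc, rfl⟩ := ih
        let z : m.Zt t (N + 2) p ε := ⟨_, hz p c hc⟩
        rw [mapTwistedH_toH] at hx
        have h1 : n.toEt s (N + 2) p ε (f.mapZt (N + 2) p ε z) = 0 := by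
          rw [n.toEt_eq_zero_iff_of_le s hN' hr _ (f.mapTwistedCycles ε c) rfl, hx]
          exact zero_mem _
        have h2 : m.toEt t (N + 2) p ε z = 0 := (hE p).1 (h1.trans (map_zero _).symm)
        exact (m.toEt_eq_zero_iff_of_le t hN hr z c rfl).1 h2
    have h1 := key N
    rwa [m.twistedFil_eq_bot t hN ε le_rfl, Submodule.mem_bot] at h1
  -- Surjectivity climbs up from `G_N = 0`: a class of `G_p` is corrected by an image so that it
  -- falls into `G_{p+1}`.
  · have key : ∀ l p : ℕ, p + l = N →
        n.twistedFil s ε p ≤ LinearMap.range (f.mapTwistedH ε) := by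
      intro l
      induction l with
      | zero =>
        intro p hp
        rw [n.twistedFil_eq_bot s hN' ε (by lia)]
        exact bot_le
      | succ l ih =>
        rintro p hp _ ⟨c', hc', rfl⟩
        obtain ⟨y, hy⟩ := (hE p).2 (n.toEt s (N + 2) p ε ⟨_, hz' p c' hc'⟩)
        obtain ⟨z, rfl⟩ := FilteredZ2.toE_surjective _ _ _ y
        let c := m.ZtToCycles t hN hr p ε z
        have h1 : n.toEt s (N + 2) p ε (⟨_, hz' p c' hc'⟩ - f.mapZt (N + 2) p ε z) = 0 := by
          rw [map_sub, ← hy, sub_eq_zero]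
          rfl
        rw [n.toEt_eq_zero_iff_of_le s hN' hr _ (c' - f.mapTwistedCycles ε c) rfl] at h1
        obtain ⟨x, hx⟩ := ih (p + 1) (by lia) h1
        refine ⟨x + (m.twisted t).toH ε c, ?_⟩
        rw [map_add, hx, mapTwistedH_toH, map_sub, sub_add_cancel]
    have h1 := key N 0 (zero_add N)
    rw [n.twistedFil_zero, top_le_iff] at h1
    exact LinearMap.range_eq_top.1 h1

end TwistedHom

/-! ### Naturality of the isomorphisms of determinants -/

namespace DGModule

variable {k : Type u} [Field k] {A : CommDGAlgebra.{u, v} k} {B : CommDGAlgebra.{u, v'} k}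
  {m : DGModule.{u, v, w} A} {t : A.Twist} {n : DGModule.{u, v', w} B} {s : B.Twist}
  [CharZero k] {N : ℕ} (f : TwistedHom m t n s) (hf : f.IsQuasiIso)

/-- The image of a basis under a quasi-isomorphism. -/
def SecondPageBasis.map (a : m.SecondPageBasis t N) : n.SecondPageBasis s N where
  c i := (a.c i).map (f.toFun.restrict fun _ hx => f.map_cocycles hx)
  z ε i := (a.z ε i).map (f.mapZt 2 i ε)
  hz ε i := by
    rw [List.map_subtype_map_restrict, a.hz, List.map_subtype_map_restrict]
    split_ifs
    · rfl
    · rfl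
  hc i := by
    have h1 := (a.hc i).map (LinearEquiv.ofBijective (f.mapH i) (hf i))
    rw [List.map_map] at h1 ⊢
    exact h1
  b ε := by
    rw [← f.map_pageEquiv_flatMap hf le_rfl]
    exact (a.b ε).map _

theorem SecondPageBasis.detH_elt (a : m.SecondPageBasis t N) :
    (f.detH hf N).equiv a.elt = (a.map f hf).elt := by
  refine (GradedLine.Iso.prod_equiv_prodElt _ _ N).trans ?_
  refine congrArg (GradedLine.prodElt _ · N) (funext fun i => ?_)
  rw [GradedLine.Iso.signPow_equiv_signElt _ (vol_ne_zero _), GradedLine.Iso.det_equiv_vol]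
  refine congrArg (GradedLine.signElt _ · i.bodd) (vol_congr _ _ ?_)
  simp only [map, List.map_map]
  rfl

theorem SecondPageBasis.sign_map (a : m.SecondPageBasis t N) : (a.map f hf).sign = a.sign := by
  simp only [sign, map, List.length_map]

theorem SecondPageBasis.detPair_volPair (a : m.SecondPageBasis t N) :
    (GradedLine.Iso.detPair (f.pageEquiv hf le_rfl 0) (f.pageEquiv hf le_rfl 1)).equiv
      (volPair (a.b 0) (a.b 1)) = volPair ((a.map f hf).b 0) ((a.map f hf).b 1) := by
  rw [GradedLine.Iso.detPair_equiv_volPair]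
  exact volPair_congr _ _ _ _ (f.map_pageEquiv_flatMap hf le_rfl 0 (a.z 0))
    (f.map_pageEquiv_flatMap hf le_rfl 1 (a.z 1))

theorem IsDetSecondPageIso.natural (hN : ∀ i ≥ N, m.deg i = ⊥)
    (hfin : ∀ i, Module.Finite k (m.H i))
    {φ : GradedLine.Iso (m.detH N) (m.pageT t 2).detLine} (h : m.IsDetSecondPageIso t N φ)
    {φ' : GradedLine.Iso (n.detH N) (n.pageT s 2).detLine} (h' : n.IsDetSecondPageIso s N φ') :
    φ.trans (GradedLine.Iso.detPair (f.pageEquiv hf le_rfl 0) (f.pageEquiv hf le_rfl 1)) =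
      (f.detH hf N).trans φ' := by
  obtain ⟨a⟩ := m.nonempty_secondPageBasis t hN hfin
  refine GradedLine.Iso.ext_of_apply_eq a.elt_ne_zero ?_
  rw [GradedLine.Iso.trans_equiv_apply, GradedLine.Iso.trans_equiv_apply,
    (a.isDetSecondPageIso_iff φ).1 h, map_smul, a.detPair_volPair f hf, a.detH_elt f hf,
    ((a.map f hf).isDetSecondPageIso_iff φ').1 h', a.sign_map f hf]

/-- The image of a basis under a quasi-isomorphism. -/
def AbutmentBasis.map {r : ℤ} (hr : 2 ≤ r) (hft : ∀ ε, Function.Bijective (f.mapTwistedH ε))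
    (a : m.AbutmentBasis t N r) : n.AbutmentBasis s N r where
  z ε i := (a.z ε i).map (f.mapZt r i ε)
  c ε i := (a.c ε i).map (f.mapTwistedCycles ε)
  hzc ε i := by
    rw [List.map_subtype_map_restrict, a.hzc, List.map_map, List.map_map]
    exact List.map_congr_left fun c _ => (f.twistedCyclesVal_mapTwistedCycles ε c).symm
  b ε := by
    rw [← f.map_pageEquiv_flatMap hf hr]
    exact (a.b ε).map _
  b' ε := by
    have h1 := (a.b' ε).map (LinearEquiv.ofBijective (f.mapTwistedH ε) (hft ε))
    simp only [List.map_flatMap, List.map_map] at h1 ⊢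
    exact h1

theorem IsDetAbutmentIso.natural {r : ℤ} (hN : ∀ i ≥ N, m.deg i = ⊥) (hN' : ∀ i ≥ N, n.deg i = ⊥)
    (hr : 2 ≤ r) (hr' : N + 1 ≤ r) (hft : ∀ ε, Function.Bijective (f.mapTwistedH ε))
    (hfin : ∀ ε, Module.Finite k ((m.pageT t r).X ε))
    {φ : GradedLine.Iso (m.pageT t r).detLine (m.twisted t).detH} (h : m.IsDetAbutmentIso t N r φ)
    {φ' : GradedLine.Iso (n.pageT s r).detLine (n.twisted s).detH}
    (h' : n.IsDetAbutmentIso s N r φ') :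
    φ.trans (f.detTwistedH hft) =
      (GradedLine.Iso.detPair (f.pageEquiv hf hr 0) (f.pageEquiv hf hr 1)).trans φ' := by
  obtain ⟨a⟩ := m.nonempty_abutmentBasis t hN hr' hfin
  refine GradedLine.Iso.ext_of_apply_eq (volPair_ne_zero (a.b 0) (a.b 1)) ?_
  have h1 : (GradedLine.Iso.detPair (f.pageEquiv hf hr 0) (f.pageEquiv hf hr 1)).equiv
      (volPair (a.b 0) (a.b 1)) =
      volPair ((a.map f hf hr hft).b 0) ((a.map f hf hr hft).b 1) := by
    rw [GradedLine.Iso.detPair_equiv_volPair]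
    exact volPair_congr _ _ _ _ (f.map_pageEquiv_flatMap hf hr 0 (a.z 0))
      (f.map_pageEquiv_flatMap hf hr 1 (a.z 1))
  have h2 : (f.detTwistedH hft).equiv (volPair (a.b' 0) (a.b' 1)) =
      volPair ((a.map f hf hr hft).b' 0) ((a.map f hf hr hft).b' 1) := by
    rw [TwistedHom.detTwistedH, GradedLine.Iso.detPair_equiv_volPair]
    refine volPair_congr _ _ _ _ ?_ ?_ <;>
    · simp only [List.map_flatMap, List.map_map, AbutmentBasis.map]
      rfl
  rw [GradedLine.Iso.trans_equiv_apply, GradedLine.Iso.trans_equiv_apply,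
    (a.isDetAbutmentIso_iff hN hr' φ).1 h, h1, h2,
    ((a.map f hf hr hft).isDetAbutmentIso_iff hN' hr' φ').1 h']

/-- Pasting of the squares for the second page, for the transitions by induction on `r`, and for the
abutment, on a page late enough for both modules. -/
theorem IsCanonicalDetIso.natural (hN : ∀ i ≥ N, m.deg i = ⊥) (hN' : ∀ i ≥ N, n.deg i = ⊥)
    (hft : ∀ ε, Function.Bijective (f.mapTwistedH ε)) (hfin : ∀ i, Module.Finite k (m.H i))
    {Φ : GradedLine.Iso (m.detH N) (m.twisted t).detH} (h : m.IsCanonicalDetIso t N Φ)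
    {Φ' : GradedLine.Iso (n.detH N) (n.twisted s).detH} (h' : n.IsCanonicalDetIso s N Φ') :
    Φ.trans (f.detTwistedH hft) = (f.detH hf N).trans Φ' := by
  obtain ⟨Ψ, h2, hs, r₀, hr₀⟩ := h
  obtain ⟨Ψ', h2', hs', r₀', hr₀'⟩ := h'
  have key : ∀ r hr, (Ψ r hr).trans
      (GradedLine.Iso.detPair (f.pageEquiv hf hr 0) (f.pageEquiv hf hr 1)) =
        (f.detH hf N).trans (Ψ' r hr) := by
    intro r hr
    induction r, hr using Int.leInduction with
    | base => exact h2.natural f hf hN hfin h2'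
    | succ r hr ih =>
      have h3 := (hs r hr).natural f.map_twistedD f.fil_le_comap _ _ m.fil_antitone n.fil_antitone
        (m.finite_pageT t hN hfin hr) (f.mapEt_bijective hf hr)
        (f.mapEt_bijective hf (by lia)) (hs' r hr)
      rw [← GradedLine.Iso.trans_symm_trans (Ψ r hr) (Ψ (r + 1) (by lia)),
        GradedLine.Iso.trans_assoc, h3, ← GradedLine.Iso.trans_assoc, ih,
        GradedLine.Iso.trans_assoc, GradedLine.Iso.trans_symm_trans]
  obtain ⟨r, hr, h3, h4, h5⟩ : ∃ r : ℤ, 2 ≤ r ∧ N + 1 ≤ r ∧ r₀ ≤ r ∧ r₀' ≤ r :=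
    ⟨max (N + 2 : ℤ) (max r₀ r₀'), by lia, by lia, by lia, by lia⟩
  have h6 := (hr₀ r hr h4).natural f hf hN hN' hr h3 hft (m.finite_pageT t hN hfin hr)
    (hr₀' r hr h5)
  rw [← GradedLine.Iso.trans_symm_trans (Ψ r hr) Φ, GradedLine.Iso.trans_assoc, h6,
    ← GradedLine.Iso.trans_assoc, key, GradedLine.Iso.trans_assoc,
    GradedLine.Iso.trans_symm_trans]

end DGModule

/-! ### Vanishing in the spectral sequence, and the theorem -/

namespace DGModule

variable {k : Type u} [Field k] {A : CommDGAlgebra.{u, v} k} (m : DGModule.{u, v, w} A)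
  (t : A.Twist) [CharZero k]

theorem spectralPage_d_eq_zero {N : ℕ} (hN : ∀ i ≥ N, m.deg i = ⊥) {r : ℤ} (hr : N ≤ r)
    (pq pq' : ℤ × ℤ) : (m.spectralPage t r).d pq pq' = 0 := by
  unfold spectralPage
  by_cases h : pq'.1 = pq.1 + r ∧ pq'.2 = pq.2 + (1 - r)
  · refine (dif_pos h).trans ?_
    rw [m.dE_eq_zero_of_le t hN _ hr]
    rfl
  · exact dif_neg h

theorem isZero_spectralPage {p q : ℤ} (h : Odd q ∨ p < 0) :
    CategoryTheory.Limits.IsZero ((m.spectralPage t 2).X (p, q)) := by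
  have : Subsingleton (m.Et t 2 p ((p + q : ℤ) : ZMod 2)) := by
    refine m.subsingleton_Et t ?_
    rcases h with h | h
    · refine Or.inr fun h1 => ?_
      rw [Int.cast_add, ZMod.intCast_eq_one_iff_odd.2 h] at h1
      exact one_ne_zero (left_eq_add.1 h1)
    · exact Or.inl h
  exact ModuleCat.isZero_of_subsingleton (ModuleCat.of k (m.Et t 2 p ((p + q : ℤ) : ZMod 2)))

end DGModule

end

theorem proposition2 {k : Type u} [Field k] [CharZero k] (A : CommDGAlgebra.{u, v} k)
    (m : DGModule.{u, v, w} A) (hm : m.IsBounded) (t : A.Twist) :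
    (∃ (E : CategoryTheory.E₂CohomologicalSpectralSequence (ModuleCat.{w} k))
      (κ : ∀ (r : ℤ) (hr : 2 ≤ r) (p q : ℤ),
        m.Et t r p ((p + q : ℤ) : ZMod 2) ≃ₗ[k] (E.page r hr).X (p, q)),
      m.IsSpectralSequence t E κ ∧
      -- the second page
      (∀ (p : ℕ) (q : ℤ), Even q →
        ∃ η : m.H p ≃ₗ[k] (E.page 2 le_rfl).X ((p : ℤ), q),
          ∀ (c : m.cocycles p) (z : m.Zt t 2 p ((p + q : ℤ) : ZMod 2)),
            (c : m.carrier) = z → η (m.toH p c) = κ 2 le_rfl p q (m.toEt t 2 p _ z)) ∧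
      (∀ (p q : ℤ), Odd q ∨ p < 0 →
        CategoryTheory.Limits.IsZero ((E.page 2 le_rfl).X (p, q))) ∧
      -- convergence
      (∀ ε : ZMod 2, Antitone (m.twistedFil t ε) ∧ m.twistedFil t ε 0 = ⊤ ∧
        ∃ n : ℕ, m.twistedFil t ε n = ⊥) ∧
      (∃ r₀ : ℤ, 2 ≤ r₀ ∧ ∀ (r : ℤ) (hr : 2 ≤ r), r₀ ≤ r →
        (∀ pq pq' : ℤ × ℤ, (E.page r hr).d pq pq' = 0) ∧
        ∀ (p : ℕ) (q : ℤ), ∃ l : (E.page r hr).X ((p : ℤ), q) ≃ₗ[k]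
            (m.twistedFil t ((p + q : ℤ) : ZMod 2) p ⧸
              (m.twistedFil t ((p + q : ℤ) : ZMod 2) (p + 1)).submoduleOf
                (m.twistedFil t ((p + q : ℤ) : ZMod 2) p)),
          ∀ (z : m.Zt t r p ((p + q : ℤ) : ZMod 2))
            (c : (m.twisted t).cycles ((p + q : ℤ) : ZMod 2))
            (g : m.twistedFil t ((p + q : ℤ) : ZMod 2) p),
            (z : m.carrier) = m.twistedCyclesVal t _ c →
            (g : (m.twisted t).H ((p + q : ℤ) : ZMod 2)) = (m.twisted t).toH _ c →
            l (κ r hr p q (m.toEt t r p _ z)) = Submodule.Quotient.mk g)) ∧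
    ((∀ p, FiniteDimensional k (m.H p)) →
      -- the canonical isomorphism of determinants
      (∀ ε, FiniteDimensional k ((m.twisted t).H ε)) ∧
      (∀ N : ℕ, (∀ i ≥ N, m.deg i = ⊥) →
        ∃! Φ : GradedLine.Iso (m.detH N) (m.twisted t).detH, m.IsCanonicalDetIso t N Φ) ∧
      -- functoriality
      (∀ (B : CommDGAlgebra.{u, v'} k) (n : DGModule.{u, v', w} B) (s : B.Twist)
        (f : TwistedHom m t n s) (hf : f.IsQuasiIso), n.IsBounded →
        ∃ hft : ∀ ε, Function.Bijective (f.mapTwistedH ε),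
          ∀ N : ℕ, (∀ i ≥ N, m.deg i = ⊥) → (∀ i ≥ N, n.deg i = ⊥) →
            ∀ (Φ : GradedLine.Iso (m.detH N) (m.twisted t).detH)
              (Φ' : GradedLine.Iso (n.detH N) (n.twisted s).detH),
              m.IsCanonicalDetIso t N Φ → n.IsCanonicalDetIso s N Φ' →
              Φ.trans (f.detTwistedH hft) = (f.detH hf N).trans Φ')) := by
  have hm' := hm
  obtain ⟨N, hN⟩ := hm'
  refine ⟨⟨m.spectralSequence t,
    fun r _ p q => LinearEquiv.refl k (m.Et t r p ((p + q : ℤ) : ZMod 2)),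
    m.isSpectralSequence_spectralSequence t, fun p q hq => ?_,
    fun p q h => m.isZero_spectralPage t h,
    fun ε => ⟨m.twistedFil_antitone t ε, m.twistedFil_zero t ε, N,
      m.twistedFil_eq_bot t hN ε le_rfl⟩,
    max 2 (N + 1), le_max_left _ _, fun r hr hr' => ⟨m.spectralPage_d_eq_zero t hN (by lia),
      fun p q => m.exists_equiv_gr t hN (by lia) p _⟩⟩,
    fun hfin => ⟨m.finite_twistedH t hN hfin, fun N hN => ?_, fun B n s f hf hn =>
      ⟨f.mapTwistedH_bijective hf hm hn, fun N hN hN' Φ Φ' h h' =>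
        h.natural f hf hN hN' _ hfin h'⟩⟩⟩
  · refine m.exists_equiv_Et_two t p ?_
    push_cast
    rw [ZMod.intCast_eq_zero_iff_even.2 hq, add_zero]
  · obtain ⟨Φ, hΦ⟩ := m.exists_isCanonicalDetIso t hN hfin
    exact ⟨Φ, hΦ, fun Φ' hΦ' => DGModule.IsCanonicalDetIso.unique m t hN hfin hΦ' hΦ⟩
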